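/- **Setting.** Let $k$ be a perfect field of characteristic $p>0$, $W=W(k)$, $K_0=W[\frac1p]$, $\mathfrak S=W[[u]]$, and let $\varphi$ be the endomorphism of $\mathfrak S$ (and of $\mathcal A=K_0[[u]]$) that is the Frobenius on coefficients and maps $u$ to $u^p$. Let $E\in W[u]$ be a (monic) Eisenstein polynomial of degree $e\ge 1$, and let $\widehat{\mathfrak S}$ be the completion of $\mathfrak S[\frac1p]$ with respect to the ideal $(E)$. For a module $M$ over a ring $A$ with an endomorphism $\varphi$, write ${}^{\varphi}M=M\otimes_{A,\varphi}A$. Let $\mathcal O\subset\mathcal A$ be the ring of power series $\sum x_nu^n$ with $\sup_n|x_n|r^n<\infty$ for all $r\in\,]0,1[$, and let $\lambda=\prod_{n\ge0}\varphi^n(E/E(0))\in\mathcal O$. **$\varphi$-modules of Hodge–Pink.** A $\varphi$-module is a finite-dimensional $K_0$-vector space $D$ with an isomorphism $\varphi_D:{}^{\varphi}D\to D$. A $\varphi$-module of Hodge–Pink is a $\varphi$-module with a $\widehat{\mathfrak S}$-lattice $V_D$ in ${}^{\varphi}D\otimes_{K_0}\widehat{\mathfrak S}[\frac1E]$. Put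 $U_D={}^{\varphi}D\otimes_{K_0}\widehat{\mathfrak S}$. The integers $t_N(D)$ and $t_H(D)$ are defined by: the determinant of the matrix of $\varphi_D$ in a basis is $p^{t_N(D)}$ times a unit of $W$, and $\det V_D=E^{-t_H(D)}\det U_D$. A sub-$\varphi$-module is a subspace $D'$ with $\varphi_D({}^{\varphi}D')=D'$; it carries the restriction of $\varphi_D$ and $V_{D'}=V_D\cap({}^{\varphi}D'\otimes_{K_0}\widehat{\mathfrak S}[\frac1E])$. One says that $D$ is weakly admissible if $t_H(D)=t_N(D)$ and $t_H(D')\le t_N(D')$ for every sub-$\varphi$-module $D'$. **Pseudo-iso-$\varphi/\mathfrak S$-modules.** For integers $s\le t$, a pseudo-iso-$\varphi/\mathfrak S$-module of amplitude in $[s,t]$ is a free $\mathfrak S[\frac1p]$-module $\mathfrak N$ of finite rank with an isomorphism $\varphi_{\mathfrak N}:{}^{\varphi}\mathfrak N[\frac1E]\to\mathfrak N[\frac1E]$ such that, for some free $\mathfrak S$-module $\mathfrak M$ with $\mathfrak M[\frac1p]=\mathfrak N$, there is a constant $C$ such that for all $n\ge1$, with $\Phi_n=\varphi_{\mathfrak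 N}\circ{}^{\varphi}\varphi_{\mathfrak N}\circ\cdots\circ{}^{\varphi^{n-1}}\varphi_{\mathfrak N}$ and $e_n=E\,\varphi(E)\cdots\varphi^{n-1}(E)$, $$\Phi_n\in p^{-C}e_n^{\,s}\,\mathrm{Hom}_{\mathfrak S}({}^{\varphi^n}\mathfrak M,\mathfrak M),\qquad \Phi_n^{-1}\in p^{-C}e_n^{-t}\,\mathrm{Hom}_{\mathfrak S}(\mathfrak M,{}^{\varphi^n}\mathfrak M).$$ **The functor $\mathbb D_{\mathrm{iso}}$.** It maps $(\mathfrak N,\varphi_{\mathfrak N})$ to $(D,\varphi_D,V_D)$, where $D=\mathfrak N/u\mathfrak N$, $\varphi_D=\varphi_{\mathfrak N}\bmod u$, and $$V_D=(\varphi_D\otimes1)^{-1}\bigl(\xi^{-1}(\mathfrak N\otimes_{\mathfrak S[\frac1p]}\widehat{\mathfrak S})\bigr).$$ Here $\xi:D\otimes_{K_0}\mathcal O[\frac1\lambda]\to\mathfrak N\otimes_{\mathfrak S[\frac1p]}\mathcal O[\frac1\lambda]$ is the unique $\mathcal O[\frac1\lambda]$-linear map that is congruent to $1$ modulo $u$ and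 satisfies $\xi\circ(\varphi_D\otimes1)=(\varphi_{\mathfrak N}\otimes1)\circ{}^{\varphi}\xi$. It is extended to $\widehat{\mathfrak S}[\frac1E]$ through the canonical morphism $\mathcal O[\frac1\lambda]\to\widehat{\mathfrak S}[\frac1E]$, that is, the unique ring morphism that is the canonical one on $\mathfrak S[\frac1p]$ and maps $\mathcal O$ to $\widehat{\mathfrak S}$. **Proposition 3.11.** For every pseudo-iso-$\varphi/\mathfrak S$-module $(\mathfrak N,\varphi_{\mathfrak N})$, the above construction makes sense (the canonical morphism and $\xi$ exist and are unique), and $\mathbb D_{\mathrm{iso}}(\mathfrak N,\varphi_{\mathfrak N})=(D,\varphi_D,V_D)$ is a weakly admissible $\varphi$-module of Hodge–Pink: $t_H(D)=t_N(D)$, and $t_H(D')\le t_N(D')$ for every sub-$\varphi$-module $D'\subset D$. -/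

import Mathlib

open scoped TensorProduct Polynomial

namespace HodgePink

noncomputable section

/-! ## Extension of scalars along a ring homomorphism -/

section Extension

universe u v w

variable {A : Type u} {B : Type v} [CommRing A] [CommRing B] (σ : A →+* B)
  (M : Type w) [AddCommGroup M] [Module A M]

/-- The extension of scalars `B ⊗_{A, σ} M` of an `A`-module `M` along `σ : A → B`.
For `σ` a Frobenius `φ : A → A` this is the module denoted `^φ M`. -/
def Ext : Type (max v w) :=
  letI : Algebra A B := σ.toAlgebra
  B ⊗[A] M

instance : AddCommGroup (Ext σ M) :=
  @TensorProduct.addCommGroup A _ B M _ _ σ.toAlgebra.toModule _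

/-- `B ⊗_{A, σ} M` is a module over `B`, hence over any ring `R` over which `B` is an algebra. -/
instance {R : Type*} [CommRing R] [Algebra R B] : Module R (Ext σ M) :=
  letI : Algebra A B := σ.toAlgebra
  haveI : SMulCommClass A R B := ⟨fun a r b => by
    simp only [Algebra.smul_def]; ring⟩
  (TensorProduct.leftModule : Module R (B ⊗[A] M))

instance {R : Type*} [CommRing R] [Algebra R B] : IsScalarTower R B (Ext σ M) :=
  letI : Algebra A B := σ.toAlgebra
  ⟨fun r b x => by
    change (r • b) • (show B ⊗[A] M from x) = r • b • (show B ⊗[A] M from x)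
    induction (show B ⊗[A] M from x) using TensorProduct.induction_on with
    | zero => simp
    | tmul c m =>
      change (((r • b) * c) ⊗ₜ[A] m : B ⊗[A] M) = (r • (b * c)) ⊗ₜ[A] m
      rw [smul_mul_assoc]
    | add y z hy hz => simp only [smul_add, hy, hz]⟩

variable {M}

/-- The canonical `σ`-semilinear map `m ↦ 1 ⊗ m` from `M` to `B ⊗_{A, σ} M`. -/
def Ext.mk : M →ₛₗ[σ] Ext σ M :=
  letI : Algebra A B := σ.toAlgebra
  { toFun := fun m => ((1 : B) ⊗ₜ[A] m : B ⊗[A] M)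
    map_add' := fun x y => TensorProduct.tmul_add _ _ _
    map_smul' := fun a m => by
      change (1 : B) ⊗ₜ[A] (a • m) = σ a • ((1 : B) ⊗ₜ[A] m : B ⊗[A] M)
      rw [TensorProduct.tmul_smul, TensorProduct.smul_tmul', TensorProduct.smul_tmul',
        Algebra.smul_def, smul_eq_mul]
      rfl }

/-- The composition of semilinear maps. -/
def scomp {C P Q : Type*} [CommRing C] [AddCommGroup P] [Module B P] [AddCommGroup Q] [Module C Q]
    {σ : A →+* B} {τ : B →+* C} (g : P →ₛₗ[τ] Q) (f : M →ₛₗ[σ] P) : M →ₛₗ[τ.comp σ] Q :=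
  haveI : RingHomCompTriple σ τ (τ.comp σ) := ⟨rfl⟩
  g.comp f

@[simp] theorem scomp_apply {C P Q : Type*} [CommRing C] [AddCommGroup P] [Module B P]
    [AddCommGroup Q] [Module C Q] {σ : A →+* B} {τ : B →+* C} (g : P →ₛₗ[τ] Q) (f : M →ₛₗ[σ] P)
    (m : M) : scomp g f m = g (f m) := rfl

/-- The universal property of `B ⊗_{A, σ} M`, in a semilinear form: if `P` is a module over `C`,
`τ : B → C` is a ring homomorphism, and `f : M → P` is semilinear with respect to `τ ∘ σ = ρ`, this
is the `τ`-semilinear map `b ⊗ m ↦ τ b • f m`. -/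
def Ext.lift {C P : Type*} [CommRing C] [AddCommGroup P] [Module C P] (τ : B →+* C)
    {ρ : A →+* C} (f : M →ₛₗ[ρ] P) (h : ∀ a, τ (σ a) = ρ a) : Ext σ M →ₛₗ[τ] P :=
  letI : Algebra A B := σ.toAlgebra
  let F : B ⊗[A] M →+ P := TensorProduct.liftAddHom
    (AddMonoidHom.mk' (fun b => AddMonoidHom.mk' (fun m => τ b • f m)
        (fun x y => by rw [map_add, smul_add]))
      (fun b b' => by ext m; simp [add_smul]))
    (fun a b m => by
      change τ (a • b) • f m = τ b • f (a • m)
      rw [f.map_smulₛₗ, smul_smul, Algebra.smul_def, map_mul, mul_comm, ← h]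
      rfl)
  { toFun := F
    map_add' := F.map_add
    map_smul' := fun c x => by
      change F (c • (show B ⊗[A] M from x)) = τ c • F x
      induction (show B ⊗[A] M from x) using TensorProduct.induction_on with
      | zero => simp
      | tmul b m =>
        change τ (c * b) • f m = τ c • (τ b • f m)
        rw [map_mul, mul_smul]
      | add x y hx hy => rw [smul_add, map_add, hx, hy, map_add, smul_add] }

@[simp] theorem Ext.lift_mk {C P : Type*} [CommRing C] [AddCommGroup P] [Module C P]
    (τ : B →+* C) {ρ : A →+* C} (f : M →ₛₗ[ρ] P) (h : ∀ a, τ (σ a) = ρ a) (m : M) :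
    Ext.lift σ τ f h (Ext.mk σ m) = f m := by
  change τ 1 • f m = f m
  rw [map_one, one_smul]

/-- The `B`-linear map `B ⊗_{A, σ} M → P`, `b ⊗ m ↦ b f(m)`, attached to a `σ`-semilinear map
`f : M → P`. -/
def Ext.linearization {P : Type*} [AddCommGroup P] [Module B P] (f : M →ₛₗ[σ] P) :
    Ext σ M →ₗ[B] P :=
  Ext.lift σ (RingHom.id B) f (fun _ => rfl)

/-- The functoriality of `B ⊗_{A, σ} M` in `M`. -/
def Ext.map {M' : Type*} [AddCommGroup M'] [Module A M'] (f : M →ₗ[A] M') :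
    Ext σ M →ₗ[B] Ext σ M' :=
  Ext.linearization σ ((Ext.mk σ).comp f)

/-- The base change map `B ⊗_{A, σ} M → C ⊗_{A, ρ} M`, `b ⊗ m ↦ τ b ⊗ m`, for
`τ : B → C` with `τ ∘ σ = ρ`. -/
def Ext.push {C : Type*} [CommRing C] (τ : B →+* C) (ρ : A →+* C)
    (h : ∀ a, τ (σ a) = ρ a) : Ext σ M →ₛₗ[τ] Ext ρ M :=
  Ext.lift σ τ (Ext.mk ρ) h

end Extension

/-! ## The rings -/

section Rings

variable (p : ℕ) [Fact p.Prime] (k : Type*) [Field k] [CharP k p] [PerfectRing k p]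

/-- `W = W(k)`. -/
abbrev W : Type _ := WittVector p k

/-- `K₀ = Frac W = W[1/p]`. -/
abbrev K₀ : Type _ := FractionRing (WittVector p k)

/-- `𝔖 = W[[u]]`. -/
abbrev 𝔖 : Type _ := PowerSeries (W p k)

/-- `𝒜 = K₀[[u]]`, which contains all the rings below up to `𝒪[1/λ]`. -/
abbrev 𝒜 : Type _ := PowerSeries (K₀ p k)

/-- The Frobenius of `K₀`. -/
abbrev φK₀ : K₀ p k →+* K₀ p k := WittVector.FractionRing.frobeniusRingHom p k

/-- The Frobenius `φ` of `𝒜`: the Frobenius on the coefficients and `u ↦ u ^ p`. -/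
def φ𝒜 : 𝒜 p k →+* 𝒜 p k :=
  (PowerSeries.expand p (Fact.out : p.Prime).ne_zero : 𝒜 p k →ₐ[K₀ p k] 𝒜 p k).toRingHom.comp
    (PowerSeries.map (φK₀ p k))

/-- The inclusion `𝔖 ⊂ 𝒜`. -/
def ofS : 𝔖 p k →+* 𝒜 p k := PowerSeries.map (algebraMap (W p k) (K₀ p k))

/-- The constant term `𝒜 → K₀`, that is, reduction modulo `u`. -/
abbrev ev₀ : 𝒜 p k →+* K₀ p k := PowerSeries.constantCoeff

/-- The `p`-adic absolute value of `K₀`, with `|p| = 1/p`. -/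
def absK₀ (x : K₀ p k) : ℝ :=
  (WithZeroMulInt.toNNReal (e := (p : NNReal))
    (Nat.cast_ne_zero.mpr (Fact.out : p.Prime).ne_zero)
    ((IsDiscreteValuationRing.maximalIdeal (W p k)).valuation (K₀ p k) x) : ℝ)


theorem absK₀_nonneg (x : K₀ p k) : 0 ≤ absK₀ p k x := NNReal.coe_nonneg _

theorem absK₀_zero : absK₀ p k 0 = 0 := by simp [absK₀]

theorem absK₀_mul (x y : K₀ p k) : absK₀ p k (x * y) = absK₀ p k x * absK₀ p k y := by
  simp [absK₀]

theorem absK₀_add_le (x y : K₀ p k) :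
    absK₀ p k (x + y) ≤ max (absK₀ p k x) (absK₀ p k y) := by
  have hp : (1 : NNReal) < (p : NNReal) := by exact_mod_cast (Fact.out : p.Prime).one_lt
  have hmono := (WithZeroMulInt.toNNReal_strictMono hp).monotone
  have h := hmono (((IsDiscreteValuationRing.maximalIdeal (W p k)).valuation (K₀ p k)).map_add x y)
  rw [hmono.map_max] at h
  exact_mod_cast h

theorem absK₀_algebraMap_le (x : W p k) : absK₀ p k (algebraMap (W p k) (K₀ p k) x) ≤ 1 := by
  have hp : (1 : NNReal) < (p : NNReal) := by exact_mod_cast (Fact.out : p.Prime).one_lt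
  have h := (WithZeroMulInt.toNNReal_le_one_iff hp).2
    ((IsDiscreteValuationRing.maximalIdeal (W p k)).valuation_le_one (K := K₀ p k) x)
  exact_mod_cast h

theorem exists_p_pow_mul (c : K₀ p k) :
    ∃ (n : ℕ) (w : W p k), (p : K₀ p k) ^ n * c = algebraMap (W p k) (K₀ p k) w := by
  obtain ⟨a, b, hb, rfl⟩ := IsFractionRing.div_surjective (A := W p k) c
  obtain ⟨n, v, hv⟩ := WittVector.exists_eq_pow_p_mul' b (nonZeroDivisors.ne_zero hb)
  refine ⟨n, a * (v⁻¹ : (W p k)ˣ), ?_⟩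
  have hb0 : algebraMap (W p k) (K₀ p k) b ≠ 0 := by
    simpa using nonZeroDivisors.ne_zero hb
  rw [mul_div_assoc', div_eq_iff hb0, ← map_natCast (algebraMap (W p k) (K₀ p k)), ← map_pow,
    ← map_mul, ← map_mul]
  congr 1
  rw [hv]
  linear_combination (-(p : W p k) ^ n * a) * v.inv_mul

/-- `𝔖[1/p]`, as the subring of `𝒜` of the elements `x` such that `p ^ n x ∈ 𝔖` for some `n`. -/
def Sp : Subalgebra (K₀ p k) (𝒜 p k) where
  carrier := {x | ∃ (n : ℕ) (s : 𝔖 p k), (p : 𝒜 p k) ^ n * x = ofS p k s}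
  mul_mem' := by
    rintro x y ⟨n, s, hs⟩ ⟨m, t, ht⟩
    exact ⟨n + m, s * t, by rw [map_mul, ← hs, ← ht]; ring⟩
  add_mem' := by
    rintro x y ⟨n, s, hs⟩ ⟨m, t, ht⟩
    refine ⟨n + m, (p : 𝔖 p k) ^ m * s + (p : 𝔖 p k) ^ n * t, ?_⟩
    rw [map_add, map_mul, map_mul, ← hs, ← ht]
    simp only [map_pow, map_natCast]
    ring
  algebraMap_mem' := by
    intro c
    obtain ⟨n, w, hw⟩ := exists_p_pow_mul p k c
    refine ⟨n, PowerSeries.C w, ?_⟩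
    rw [ofS, PowerSeries.map_C, ← hw, map_mul, map_pow, map_natCast]
    rfl

/-- The ring `𝒪` of the power series `∑ xₙ uⁿ` that converge on the open unit disc:
`sup |xₙ| rⁿ < ∞` for all `r` in `]0, 1[`. -/
def 𝒪 : Subalgebra (K₀ p k) (𝒜 p k) where
  carrier := {x | ∀ r : ℝ, 0 < r → r < 1 →
    BddAbove (Set.range fun n : ℕ => absK₀ p k (PowerSeries.coeff n x) * r ^ n)}
  mul_mem' := by
    intro x y hx hy r h0 h1
    obtain ⟨C, hC⟩ := hx r h0 h1
    obtain ⟨D, hD⟩ := hy r h0 h1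
    have hC' : ∀ n, absK₀ p k (PowerSeries.coeff n x) * r ^ n ≤ C := fun n => hC ⟨n, rfl⟩
    have hD' : ∀ n, absK₀ p k (PowerSeries.coeff n y) * r ^ n ≤ D := fun n => hD ⟨n, rfl⟩
    have hC0 : 0 ≤ C := le_trans (mul_nonneg (absK₀_nonneg p k _) (by positivity)) (hC' 0)
    have hD0 : 0 ≤ D := le_trans (mul_nonneg (absK₀_nonneg p k _) (by positivity)) (hD' 0)
    refine ⟨C * D, ?_⟩
    rintro _ ⟨n, rfl⟩
    have key : ∀ s : Finset (ℕ × ℕ), (∀ a ∈ s, a.1 + a.2 = n) →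
        absK₀ p k (∑ a ∈ s, PowerSeries.coeff a.1 x * PowerSeries.coeff a.2 y) * r ^ n
          ≤ C * D := by
      intro s
      induction s using Finset.induction_on with
      | empty =>
        intro _
        simp only [Finset.sum_empty, absK₀_zero, zero_mul]
        positivity
      | insert a s ha ih =>
        intro h
        rw [Finset.sum_insert ha]
        refine le_trans (mul_le_mul_of_nonneg_right (absK₀_add_le p k _ _) (by positivity)) ?_
        rw [max_mul_of_nonneg _ _ (by positivity)]
        refine max_le ?_ (ih fun b hb => h b (Finset.mem_insert_of_mem hb))
        rw [absK₀_mul, ← h a (Finset.mem_insert_self _ _), pow_add]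
        calc _ = (absK₀ p k (PowerSeries.coeff a.1 x) * r ^ a.1) *
              (absK₀ p k (PowerSeries.coeff a.2 y) * r ^ a.2) := by ring
          _ ≤ C * D := mul_le_mul (hC' _) (hD' _)
              (mul_nonneg (absK₀_nonneg p k _) (by positivity)) hC0
    change absK₀ p k (PowerSeries.coeff n (x * y)) * r ^ n ≤ C * D
    rw [PowerSeries.coeff_mul]
    exact key _ (fun a ha => Finset.HasAntidiagonal.mem_antidiagonal.1 ha)
  add_mem' := by
    intro x y hx hy r h0 h1
    obtain ⟨C, hC⟩ := hx r h0 h1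
    obtain ⟨D, hD⟩ := hy r h0 h1
    refine ⟨max C D, ?_⟩
    rintro _ ⟨n, rfl⟩
    change absK₀ p k (PowerSeries.coeff n (x + y)) * r ^ n ≤ max C D
    rw [map_add]
    refine le_trans (mul_le_mul_of_nonneg_right (absK₀_add_le p k _ _) (by positivity)) ?_
    rw [max_mul_of_nonneg _ _ (by positivity)]
    exact max_le_max (hC ⟨n, rfl⟩) (hD ⟨n, rfl⟩)
  algebraMap_mem' := by
    intro c r h0 h1
    refine ⟨absK₀ p k c, ?_⟩
    rintro _ ⟨n, rfl⟩
    change absK₀ p k (PowerSeries.coeff n (PowerSeries.C c)) * r ^ n ≤ absK₀ p k c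
    rw [PowerSeries.coeff_C]
    split_ifs with h
    · simp [h]
    · rw [absK₀_zero, zero_mul]
      exact absK₀_nonneg p k c

theorem Sp_le_𝒪 : Sp p k ≤ 𝒪 p k := by
  rintro x ⟨n, s, hs⟩ r h0 h1
  have hp0 : (p : K₀ p k) ^ n ≠ 0 := pow_ne_zero _ (WittVector.FractionRing.p_nonzero p k)
  refine ⟨absK₀ p k ((p : K₀ p k) ^ n)⁻¹, ?_⟩
  rintro _ ⟨m, rfl⟩
  have h : PowerSeries.coeff m x =
      ((p : K₀ p k) ^ n)⁻¹ * algebraMap (W p k) (K₀ p k) (PowerSeries.coeff m s) := by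
    rw [eq_inv_mul_iff_mul_eq₀ hp0, ← PowerSeries.coeff_map, ← PowerSeries.coeff_C_mul]
    change _ = PowerSeries.coeff m (ofS p k s)
    rw [← hs, map_pow, map_natCast]
  change absK₀ p k (PowerSeries.coeff m x) * r ^ m ≤ _
  rw [h, absK₀_mul, mul_assoc]
  refine mul_le_of_le_one_right (absK₀_nonneg p k _) ?_
  exact mul_le_one₀ (absK₀_algebraMap_le p k _) (by positivity) (pow_le_one₀ h0.le h1.le)

theorem φ𝒜_ofS (s : 𝔖 p k) : φ𝒜 p k (ofS p k s) =
    ofS p k (PowerSeries.expand p (Fact.out : p.Prime).ne_zero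
      (PowerSeries.map (WittVector.frobenius : W p k →+* W p k) s)) := by
  have hcomp : (φK₀ p k).comp (algebraMap (W p k) (K₀ p k)) =
      (algebraMap (W p k) (K₀ p k)).comp WittVector.frobenius := by
    ext x
    exact IsFractionRing.ringEquivOfRingEquiv_algebraMap (WittVector.frobeniusEquiv p k) x
  have hp := (Fact.out : p.Prime).ne_zero
  change PowerSeries.expand p hp (PowerSeries.map (φK₀ p k) (PowerSeries.map _ s)) =
    PowerSeries.map _ (PowerSeries.expand p hp _)
  rw [PowerSeries.map_expand, ← RingHom.comp_apply, ← PowerSeries.map_comp, hcomp,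
    PowerSeries.map_comp, RingHom.comp_apply]

theorem φ𝒜_mem_Sp {x : 𝒜 p k} (hx : x ∈ Sp p k) : φ𝒜 p k x ∈ Sp p k := by
  obtain ⟨n, s, hs⟩ := hx
  refine ⟨n, PowerSeries.expand p (Fact.out : p.Prime).ne_zero
      (PowerSeries.map (WittVector.frobenius : W p k →+* W p k) s), ?_⟩
  rw [← φ𝒜_ofS, ← hs, map_mul, map_pow, map_natCast]

/-- The Frobenius `φ` of `𝔖[1/p]`. -/
def φSp : Sp p k →+* Sp p k :=
  (φ𝒜 p k).restrict (Sp p k) (Sp p k) fun _ hx => φ𝒜_mem_Sp p k hx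

theorem ev₀_φ𝒜 (x : 𝒜 p k) : ev₀ p k (φ𝒜 p k x) = φK₀ p k (ev₀ p k x) := by
  have hp := (Fact.out : p.Prime).ne_zero
  change PowerSeries.constantCoeff (PowerSeries.expand p hp (PowerSeries.map (φK₀ p k) x)) = _
  rw [PowerSeries.constantCoeff_expand, ← PowerSeries.coeff_zero_eq_constantCoeff_apply,
    PowerSeries.coeff_map, PowerSeries.coeff_zero_eq_constantCoeff_apply]

variable (E : (W p k)[X])

/-- `E`, as an element of `𝔖`. -/
def E𝔖 : 𝔖 p k := (E : PowerSeries (W p k))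

/-- `E`, as an element of `𝒜`. -/
def E𝒜 : 𝒜 p k := ofS p k (E𝔖 p k E)

/-- `E`, as an element of `𝔖[1/p]`. -/
def ESp : Sp p k := ⟨E𝒜 p k E, 0, E𝔖 p k E, by simp [E𝒜]⟩

/-- `𝔖[1/p, 1/E]`, as the subring of `𝒜` generated by `𝔖[1/p]` and the inverse of `E`. -/
def SpE : Subalgebra (K₀ p k) (𝒜 p k) := Sp p k ⊔ Algebra.adjoin (K₀ p k) {(E𝒜 p k E)⁻¹}

/-- `λ = ∏_{n ≥ 0} φⁿ(E / E(0))`. As `φⁱ(E / E(0))` is congruent to `1` modulo `u ^ (p ^ i)` and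
`p ^ i > n` for `i > n`, the coefficient of `uⁿ` in this product is that of the product of its
factors of index at most `n`. -/
def lam : 𝒜 p k :=
  PowerSeries.mk fun n => PowerSeries.coeff n (∏ i ∈ Finset.range (n + 1),
    (φ𝒜 p k)^[i] (PowerSeries.C (ev₀ p k (E𝒜 p k E))⁻¹ * E𝒜 p k E))

/-- `𝒪[1/λ]`, as the subring of `𝒜` generated by `𝒪` and the inverse of `λ`. -/
def 𝒪lam : Subalgebra (K₀ p k) (𝒜 p k) := 𝒪 p k ⊔ Algebra.adjoin (K₀ p k) {(lam p k E)⁻¹}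

/-- The inclusion `𝔖[1/p] → 𝔖[1/p, 1/E]`. -/
def SpToSpE : Sp p k →+* SpE p k E := (Subalgebra.inclusion le_sup_left).toRingHom

/-- The inclusion `𝒪 → 𝒪[1/λ]`. -/
def 𝒪To𝒪lam : 𝒪 p k →+* 𝒪lam p k E := (Subalgebra.inclusion le_sup_left).toRingHom

/-- The inclusion `𝔖[1/p] → 𝒪[1/λ]`. -/
def SpTo𝒪lam : Sp p k →+* 𝒪lam p k E :=
  (Subalgebra.inclusion ((Sp_le_𝒪 p k).trans le_sup_left)).toRingHom

/-- The inclusion `𝔖[1/p] → 𝒜`. -/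
def SpTo𝒜 : Sp p k →+* 𝒜 p k := (Sp p k).val.toRingHom

/-- The inclusion `𝔖[1/p, 1/E] → 𝒜`. -/
def SpETo𝒜 : SpE p k E →+* 𝒜 p k := (SpE p k E).val.toRingHom

/-- The inclusion `𝒪[1/λ] → 𝒜`. -/
def 𝒪lamTo𝒜 : 𝒪lam p k E →+* 𝒜 p k := (𝒪lam p k E).val.toRingHom

/-- `\widehat 𝔖`: the completion of `𝔖[1/p]` with respect to the ideal generated by `E`. -/
abbrev Shat : Type _ := AdicCompletion (Ideal.span {ESp p k E}) (Sp p k)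

/-- `\widehat 𝔖[1/E]`. -/
abbrev ShatE : Type _ := Localization.Away (algebraMap (Sp p k) (Shat p k E) (ESp p k E))

/-- `𝔖[1/p] → \widehat 𝔖[1/E]`. -/
def SpToShatE : Sp p k →+* ShatE p k E :=
  (algebraMap (Shat p k E) (ShatE p k E)).comp (algebraMap (Sp p k) (Shat p k E))

/-- `K₀ → \widehat 𝔖[1/E]`. -/
def K₀ToShatE : K₀ p k →+* ShatE p k E := (SpToShatE p k E).comp (algebraMap (K₀ p k) (Sp p k))

/-- `E`, as a unit of `\widehat 𝔖[1/E]`. -/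
def EShatE : (ShatE p k E)ˣ :=
  (IsLocalization.Away.algebraMap_isUnit (S := ShatE p k E)
    (algebraMap (Sp p k) (Shat p k E) (ESp p k E))).unit

/-- The canonical morphism `𝒪[1/λ] → \widehat 𝔖[1/E]`: the one that extends the canonical morphism
of `𝔖[1/p]` and maps `𝒪` to `\widehat 𝔖`. -/
structure IsCanonical (ι : 𝒪lam p k E →+* ShatE p k E) : Prop where
  extends_Sp : ∀ x : Sp p k, ι (SpTo𝒪lam p k E x) = SpToShatE p k E x
  maps_𝒪 : ∀ x : 𝒪 p k, ι (𝒪To𝒪lam p k E x) ∈ (algebraMap (Shat p k E) (ShatE p k E)).range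

end Rings

/-! ## `φ`-modules of Hodge–Pink and weak admissibility -/

section HodgePinkModules

variable {p : ℕ} [Fact p.Prime] {k : Type*} [Field k] [CharP k p] [PerfectRing k p]
  {D : Type*} [AddCommGroup D] [Module (K₀ p k) D]

/-- `(D, φ_D)` is a `φ`-module: `D` is finite dimensional over `K₀` and the linear map
`^φ D → D` attached to the semilinear map `φ_D` is an isomorphism. -/
structure IsPhiModule (φD : D →ₛₗ[φK₀ p k] D) : Prop where
  finite : Module.Finite (K₀ p k) D
  bijective : Function.Bijective (Ext.linearization (φK₀ p k) φD)

/-- `t_N(D) = n`: the matrix `P` of `φ_D` in a basis of `D` has determinant `p ^ n` times a unit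
of `W`. (The determinant of `P` is the matrix of `φ_{det D}`.) -/
def IsNewtonNumber (φD : D →ₛₗ[φK₀ p k] D) (n : ℤ) : Prop :=
  ∃ (r : ℕ) (b : Module.Basis (Fin r) (K₀ p k) D) (P : Matrix (Fin r) (Fin r) (K₀ p k))
    (w : (W p k)ˣ), (∀ j, φD (b j) = ∑ i, P i j • b i) ∧
      P.det = (p : K₀ p k) ^ n * algebraMap (W p k) (K₀ p k) w

variable (p k) (E : (W p k)[X]) (D)

/-- `^φ D ⊗_{K₀} \widehat 𝔖[1/E]`. -/
abbrev PhiD : Type _ := Ext ((K₀ToShatE p k E).comp (φK₀ p k)) D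

/-- `V` is a Hodge–Pink structure on `D`: a free `\widehat 𝔖`-module which is a lattice in
`^φ D ⊗_{K₀} \widehat 𝔖[1/E]`, that is, the `\widehat 𝔖`-span of a `\widehat 𝔖[1/E]`-basis. -/
def IsHodgePinkStructure (V : Submodule (Shat p k E) (PhiD p k D E)) : Prop :=
  ∃ (r : ℕ) (c : Module.Basis (Fin r) (ShatE p k E) (PhiD p k D E)),
    V = Submodule.span (Shat p k E) (Set.range c)

/-- `t_H(D) = h`: `det V = E ^ (-h) det U`, where `U = ^φ D ⊗_{K₀} \widehat 𝔖`. Here `b` is a basis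
of `D`, which gives the basis `1 ⊗ b i` of `U`; `c` is a basis of `V`; the matrix `P` expresses the
second one in the first one, so that `⋀ c = det P • ⋀ (1 ⊗ b)`. -/
def IsHodgeNumber (V : Submodule (Shat p k E) (PhiD p k D E)) (h : ℤ) : Prop :=
  ∃ (r : ℕ) (b : Module.Basis (Fin r) (K₀ p k) D)
    (c : Module.Basis (Fin r) (ShatE p k E) (PhiD p k D E))
    (P : Matrix (Fin r) (Fin r) (ShatE p k E)) (w : (Shat p k E)ˣ),
    V = Submodule.span (Shat p k E) (Set.range c) ∧
    (∀ j, c j = ∑ i, P i j • Ext.mk ((K₀ToShatE p k E).comp (φK₀ p k)) (b i)) ∧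
    P.det = ((EShatE p k E ^ (-h) : (ShatE p k E)ˣ) : ShatE p k E) *
      algebraMap (Shat p k E) (ShatE p k E) w

variable {p k D}

/-- The restriction of `φ_D` to a subspace `D'` stable by `φ_D`. -/
def restrictPhi (φD : D →ₛₗ[φK₀ p k] D) (D' : Submodule (K₀ p k) D)
    (h : ∀ x ∈ D', φD x ∈ D') : D' →ₛₗ[φK₀ p k] D' :=
  (φD.comp D'.subtype).codRestrict D' fun x => h x x.2

/-- `V_{D'} = V_D ∩ (^φ D' ⊗_{K₀} \widehat 𝔖[1/E])`. -/
def inducedHodgePink (V : Submodule (Shat p k E) (PhiD p k D E)) (D' : Submodule (K₀ p k) D) :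
    Submodule (Shat p k E) (PhiD p k D' E) :=
  V.comap ((Ext.map ((K₀ToShatE p k E).comp (φK₀ p k)) D'.subtype).restrictScalars (Shat p k E))

/-- `(D, φ_D, V)` is a `φ`-module of Hodge–Pink. -/
structure IsHodgePinkModule (φD : D →ₛₗ[φK₀ p k] D)
    (V : Submodule (Shat p k E) (PhiD p k D E)) : Prop where
  isPhiModule : IsPhiModule φD
  isHodgePinkStructure : IsHodgePinkStructure p k D E V

/-- Weak admissibility: `t_H(D) = t_N(D)`, and `t_H(D') ≤ t_N(D')` for all sub-`φ`-modules `D'`,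
that is, for all subspaces `D'` with `φ_D(^φ D') = D'`. -/
structure IsWeaklyAdmissible (φD : D →ₛₗ[φK₀ p k] D)
    (V : Submodule (Shat p k E) (PhiD p k D E)) : Prop where
  eq : ∃ t : ℤ, IsHodgeNumber p k D E V t ∧ IsNewtonNumber φD t
  le : ∀ (D' : Submodule (K₀ p k) D) (hD' : Submodule.span (K₀ p k) (φD '' D') = D'),
    ∃ h n : ℤ, IsHodgeNumber p k D' E (inducedHodgePink E V D') h ∧
      IsNewtonNumber (restrictPhi φD D' fun _ hx =>
        hD' ▸ Submodule.subset_span (Set.mem_image_of_mem φD hx)) n ∧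
      h ≤ n

end HodgePinkModules

/-! ## Pseudo-iso-`φ/𝔖`-modules -/

section PseudoIso

variable (p : ℕ) [Fact p.Prime] (k : Type*) [Field k] [CharP k p] [PerfectRing k p]

/-- `x ^ m` for `m ∈ ℤ` and `x ∈ 𝒜` with nonzero constant term. -/
def zpow𝒜 (x : 𝒜 p k) : ℤ → 𝒜 p k
  | Int.ofNat m => x ^ m
  | Int.negSucc m => x⁻¹ ^ (m + 1)

variable (E : (W p k)[X]) (N : Type*) [AddCommGroup N] [Module (Sp p k) N]

/-- `N[1/E]`. -/
abbrev InvE : Type _ := Ext (SpToSpE p k E) N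

/-- `𝔖[1/p] → 𝔖[1/p, 1/E]`, `x ↦ φ(x)`, so that a map `^φ N[1/E] → N[1/E]` is the same as a map
`N → N[1/E]` which is semilinear with respect to it. -/
abbrev φSpE : Sp p k →+* SpE p k E := (SpToSpE p k E).comp (φSp p k)

variable {p k N}

/-- The condition (PIM) with amplitude in `[s, t]`. The basis `b` gives the free `𝔖`-module
`𝔐 = ⨁ 𝔖 b i` with `𝔐[1/p] = N`; `T` is the matrix of `φ_N` in this basis, so that
`T φ(T) ⋯ φ^{n-1}(T)` is the matrix of `φ_N ∘ ^φ φ_N ∘ ⋯ ∘ ^{φ^{n-1}} φ_N`; with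
`e = E φ(E) ⋯ φ^{n-1}(E)`, it is `p ^ (-C) e ^ s` times a matrix `Q` with coefficients in `𝔖`, and
its inverse is `p ^ (-C) e ^ (-t)` times a matrix `Q'` with coefficients in `𝔖`. -/
def PIM (φN : N →ₛₗ[φSpE p k E] InvE p k E N) (s t : ℤ) : Prop :=
  ∃ (r : ℕ) (b : Module.Basis (Fin r) (Sp p k) N) (T : Matrix (Fin r) (Fin r) (SpE p k E)),
    (∀ j, φN (b j) = ∑ i, T i j • Ext.mk (SpToSpE p k E) (b i)) ∧
    ∃ C : ℕ, ∀ n : ℕ, 1 ≤ n →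
      ∃ Q Q' : Matrix (Fin r) (Fin r) (𝔖 p k),
        let Tn : Matrix (Fin r) (Fin r) (𝒜 p k) :=
          ((List.range n).map fun i => T.map fun x => (φ𝒜 p k)^[i] (SpETo𝒜 p k E x)).prod
        let e : 𝒜 p k := ∏ i ∈ Finset.range n, (φ𝒜 p k)^[i] (E𝒜 p k E)
        (p : 𝒜 p k) ^ C • Tn = zpow𝒜 p k e s • Q.map (ofS p k) ∧
        Tn * Q'.map (ofS p k) = ((p : 𝒜 p k) ^ C * zpow𝒜 p k e t) • 1

/-- `(N, φ_N)` is a pseudo-iso-`φ/𝔖`-module of amplitude in `[s, t]`, where `φ_N` is given as a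
semilinear map: `N` is free of finite type over `𝔖[1/p]`, the linear map `^φ N[1/E] → N[1/E]` is an
isomorphism, and (PIM) holds. -/
structure IsPseudoIso (φN : N →ₛₗ[φSpE p k E] InvE p k E N) (s t : ℤ) : Prop where
  free : Module.Free (Sp p k) N
  finite : Module.Finite (Sp p k) N
  bijective : Function.Bijective (Ext.linearization (φSpE p k E) φN)
  pim : PIM E φN s t

/-! ## The functor `D_iso` -/

variable (p k N)

/-- `𝔖[1/p] → K₀`, reduction modulo `u`. -/
abbrev SpTo₀ : Sp p k →+* K₀ p k := (ev₀ p k).comp (SpTo𝒜 p k)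

/-- `D = N ⊗_{𝔖[1/p]} K₀ = N / u N`. -/
abbrev Dmod : Type _ := Ext (SpTo₀ p k) N

variable {p k N}

/-- `φ_D = φ_N mod u`. -/
def phiD (φN : N →ₛₗ[φSpE p k E] InvE p k E N) : Dmod p k N →ₛₗ[φK₀ p k] Dmod p k N :=
  Ext.lift (SpTo₀ p k) (φK₀ p k)
    (scomp (Ext.push (SpToSpE p k E) ((ev₀ p k).comp (SpETo𝒜 p k E)) (SpTo₀ p k)
      (fun _ => rfl)) φN)
    (fun a => (ev₀_φ𝒜 p k a).symm)

/-- `φ_N ⊗ 1` on `N ⊗ 𝒜`, as a semilinear endomorphism. -/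
def phiN𝒜 (φN : N →ₛₗ[φSpE p k E] InvE p k E N) :
    Ext (SpTo𝒜 p k) N →ₛₗ[φ𝒜 p k] Ext (SpTo𝒜 p k) N :=
  Ext.lift (SpTo𝒜 p k) (φ𝒜 p k)
    (scomp (Ext.push (SpToSpE p k E) (SpETo𝒜 p k E) (SpTo𝒜 p k) (fun _ => rfl)) φN)
    (fun _ => rfl)

variable (p k N)

/-- `D ⊗_{K₀} 𝒪[1/λ]`. -/
abbrev D𝒪lam : Type _ := Ext (algebraMap (K₀ p k) (𝒪lam p k E)) (Dmod p k N)

/-- `N ⊗_{𝔖[1/p]} 𝒪[1/λ]`. -/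
abbrev N𝒪lam : Type _ := Ext (SpTo𝒪lam p k E) N

variable {p k N}

/-- `ξ : D ⊗_{K₀} 𝒪[1/λ] → N ⊗_{𝔖[1/p]} 𝒪[1/λ]` is congruent to `1` modulo `u` and satisfies
`ξ ∘ (φ_D ⊗ 1) = (φ_N ⊗ 1) ∘ ^φ ξ`. The second equality is between maps from `^φ D ⊗ 𝒪[1/λ]`; it is
stated on the generators `1 ⊗ d`, and in `N ⊗_{𝔖[1/p]} 𝒜`, which contains
`N ⊗_{𝔖[1/p]} 𝒪[1/λ]` as `N` is free. -/
structure IsComparison (φN : N →ₛₗ[φSpE p k E] InvE p k E N)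
    (ξ : D𝒪lam p k E N →ₗ[𝒪lam p k E] N𝒪lam p k E N) : Prop where
  mod_u : ∀ d : Dmod p k N,
    Ext.push (SpTo𝒪lam p k E) ((ev₀ p k).comp (𝒪lamTo𝒜 p k E)) (SpTo₀ p k) (fun _ => rfl)
      (ξ (Ext.mk _ d)) = d
  comm : ∀ d : Dmod p k N,
    Ext.push (SpTo𝒪lam p k E) (𝒪lamTo𝒜 p k E) (SpTo𝒜 p k) (fun _ => rfl)
      (ξ (Ext.mk _ (phiD E φN d))) =
    phiN𝒜 E φN (Ext.push (SpTo𝒪lam p k E) (𝒪lamTo𝒜 p k E) (SpTo𝒜 p k) (fun _ => rfl)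
      (ξ (Ext.mk _ d)))

/-- The map `φ_D ⊗ 1 : ^φ D ⊗_{K₀} \widehat 𝔖[1/E] → D ⊗_{K₀} \widehat 𝔖[1/E]`. -/
def phiDShat (φN : N →ₛₗ[φSpE p k E] InvE p k E N) :
    PhiD p k (Dmod p k N) E →ₗ[ShatE p k E] Ext (K₀ToShatE p k E) (Dmod p k N) :=
  Ext.linearization _ (scomp (Ext.mk (K₀ToShatE p k E)) (phiD E φN))

/-- The map `D ⊗_{K₀} \widehat 𝔖[1/E] → N ⊗_{𝔖[1/p]} \widehat 𝔖[1/E]` obtained from `ξ` by base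
change along the canonical morphism `ι : 𝒪[1/λ] → \widehat 𝔖[1/E]`. -/
def xiShat (ι : 𝒪lam p k E →+* ShatE p k E) (hι : IsCanonical p k E ι)
    (ξ : D𝒪lam p k E N →ₗ[𝒪lam p k E] N𝒪lam p k E N) :
    Ext (K₀ToShatE p k E) (Dmod p k N) →ₗ[ShatE p k E] Ext (SpToShatE p k E) N :=
  Ext.lift (K₀ToShatE p k E) (RingHom.id _)
    (scomp (Ext.push (SpTo𝒪lam p k E) ι (SpToShatE p k E) hι.extends_Sp)
      (ξ.comp (Ext.mk (algebraMap (K₀ p k) (𝒪lam p k E)))))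
    (fun a => (hι.extends_Sp (algebraMap (K₀ p k) (Sp p k) a)).symm)

/-- `V_D = (φ_D ⊗ 1)⁻¹ (ξ⁻¹ (N ⊗_{𝔖[1/p]} \widehat 𝔖))`. -/
def VD (φN : N →ₛₗ[φSpE p k E] InvE p k E N) (ι : 𝒪lam p k E →+* ShatE p k E)
    (hι : IsCanonical p k E ι) (ξ : D𝒪lam p k E N →ₗ[𝒪lam p k E] N𝒪lam p k E N) :
    Submodule (Shat p k E) (PhiD p k (Dmod p k N) E) :=
  (Submodule.span (Shat p k E) (Set.range (Ext.mk (SpToShatE p k E) : N → _))).comap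
    (((xiShat E ι hι ξ).comp (phiDShat E φN)).restrictScalars (Shat p k E))

end PseudoIso

end

end HodgePink

/-!
# Weak admissibility of the `φ`-modules of Hodge–Pink of pseudo-iso-`φ/𝔖`-modules

In a basis of `N` the Frobenius is a matrix `T`, and `ξ` is a matrix `X` with `X ≡ 1` modulo `u`
and `X T(0) = T φ(X)`. Since `X ↦ T φ(X) T(0)⁻¹` is contracting for the `u`-adic topology, this
equation has exactly one solution over `𝒜` (`exists_formal_solution`, `formal_solution_unique`).
To bound its coefficients, replace `T` by `E⁻ˢ T`; as `E(0) λ = E φ(λ)`, this replaces `X` by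
`Y = λ⁻ˢ X`, and the amplitude becomes `[0, m]` with `m = t - s` (`PIM₀_twist`,
`comparison_untwist`). Modulo `u ^ (p ^ n)` the matrix `Y` is `Tₙ Tₙ(0)⁻¹` with
`Tₙ = T φ(T) ⋯ φ^{n-1}(T)`, so that (PIM) gives its coefficients at most polynomial growth, and
`Y` has coefficients in `𝒪` (`PIM₀.mem_𝒪`).

By Weierstrass division (`exists_division`), `𝔖[1/p]` and `𝒪` have the same quotients by the
powers of `E` (`isPowIso_SpTo𝒪`), and the quotient by `E` is a field. Hence `\widehat 𝔖` is a
discrete valuation ring with uniformizer `E`, and receives a morphism from `𝒪`; this gives the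
canonical morphism (`existsUnique_canonical`), once it is known that `λ` has a simple zero at `E`
(`not_E_dvd_φ_lam`).

The heart of the proof is the inequality `le_of_E_pow_dvd`. Let `f` be a vector of functions in
`𝒪`, not all zero at `u = 0`, such that for all `n` the vector `aₙ f` is `p ^ (-C)` times an
integral matrix applied to `φⁿ(f)`, where `aₙ` is a constant of valuation `n ν`. If `E ^ h`
divides `f`, then `φⁿ(E) ^ h` divides `f` for all `n`, and therefore so does `eₙ ^ h`, with
`eₙ = E φ(E) ⋯ φ^{n-1}(E)`. The Gauss norm of `φⁿ(f)` of radius `r ^ (1 / pⁿ)` is the one of `f`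
of radius `r`, hence that of `f` of radius `r ^ (1 / pⁿ)` is bounded by a constant times
`p ^ (n ν)`. On the other hand `eₙ` is distinguished and `|eₙ(0)| = p ^ (-n)`, which makes this
norm at least a constant times `p ^ (n h)`. So `h ≤ ν`.

This is applied to four vectors. For `λ` alone it shows that the zero of `λ` at `E` is simple. For
`det Y` it bounds the order of `det Y` at `E` by the valuation of `det T(0)`, and for
`λ ^ (r m) / det Y`, which lies in `𝒪` by the second half of (PIM), it gives the reverse bound.
Hence the two are equal (`PIM₀.hasOrder_det`), that is, `t_H(D) = t_N(D)`. Finally let the columns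
of `B` be a basis of a sub-`φ`-module `D'`. The maximal minors of `Y B` satisfy equations with the
determinant of the Frobenius of `D'` (`PIM₀.le_of_dvd_minors`). Since `ξ ∘ φ_D` maps `V_{D'}` into
the lattice `N ⊗ \widehat 𝔖`, a power of `E` whose exponent is `t_H(D')`, up to the twist, divides
these minors, and the inequality reads `t_H(D') ≤ t_N(D')` (`PIM₀.le_of_integral`,
`isWeaklyAdmissible_VD`).
-/

namespace HodgePink

noncomputable section

set_option linter.unusedSectionVars false

/-! ### The absolute value of `K₀` -/

section AbsoluteValue

variable (p : ℕ) [Fact p.Prime] (k : Type*) [Field k] [CharP k p] [PerfectRing k p]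

theorem one_lt_p_real : (1 : ℝ) < p := by exact_mod_cast (Fact.out : p.Prime).one_lt

theorem p_real_pos : (0 : ℝ) < p := lt_trans one_pos (one_lt_p_real p)

theorem absK₀_one : absK₀ p k 1 = 1 := by simp [absK₀]

theorem absK₀_eq_zero_iff {x : K₀ p k} : absK₀ p k x = 0 ↔ x = 0 := by
  simp [absK₀]

theorem absK₀_ne_zero {x : K₀ p k} (hx : x ≠ 0) : absK₀ p k x ≠ 0 :=
  fun h => hx ((absK₀_eq_zero_iff p k).1 h)

theorem absK₀_pos {x : K₀ p k} (hx : x ≠ 0) : 0 < absK₀ p k x :=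
  lt_of_le_of_ne (absK₀_nonneg p k x) (absK₀_ne_zero p k hx).symm

/-- The `p`-adic absolute value of `K₀`, as a homomorphism of monoids with zero. -/
def absK₀Hom : K₀ p k →*₀ ℝ where
  toFun := absK₀ p k
  map_zero' := absK₀_zero p k
  map_one' := absK₀_one p k
  map_mul' := absK₀_mul p k

theorem absK₀_pow (x : K₀ p k) (n : ℕ) : absK₀ p k (x ^ n) = absK₀ p k x ^ n :=
  map_pow (absK₀Hom p k) x n

theorem absK₀_zpow (x : K₀ p k) (n : ℤ) : absK₀ p k (x ^ n) = absK₀ p k x ^ n :=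
  map_zpow₀ (absK₀Hom p k) x n

theorem absK₀_inv (x : K₀ p k) : absK₀ p k x⁻¹ = (absK₀ p k x)⁻¹ :=
  map_inv₀ (absK₀Hom p k) x

theorem absK₀_prod {ι : Type*} (s : Finset ι) (f : ι → K₀ p k) :
    absK₀ p k (∏ i ∈ s, f i) = ∏ i ∈ s, absK₀ p k (f i) :=
  map_prod (absK₀Hom p k) f s

theorem absK₀_neg (x : K₀ p k) : absK₀ p k (-x) = absK₀ p k x := by
  simp [absK₀, Valuation.map_neg]

theorem absK₀_sub_le (x y : K₀ p k) :
    absK₀ p k (x - y) ≤ max (absK₀ p k x) (absK₀ p k y) := by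
  rw [sub_eq_add_neg, ← absK₀_neg p k y]
  exact absK₀_add_le p k _ _

theorem absK₀_sum_le {ι : Type*} (s : Finset ι) (f : ι → K₀ p k) {C : ℝ} (hC : 0 ≤ C)
    (h : ∀ i ∈ s, absK₀ p k (f i) ≤ C) : absK₀ p k (∑ i ∈ s, f i) ≤ C := by
  induction s using Finset.cons_induction with
  | empty => simpa [absK₀_zero] using hC
  | cons a s ha ih =>
    rw [Finset.sum_cons]
    exact (absK₀_add_le p k _ _).trans (max_le (h a (by simp))
      (ih fun i hi => h i (by simp [hi])))

theorem p_ne_zero : (p : K₀ p k) ≠ 0 := WittVector.FractionRing.p_nonzero p k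

theorem absK₀_p : absK₀ p k (p : K₀ p k) = (p : ℝ)⁻¹ := by
  have h1 : (p : K₀ p k) = algebraMap (W p k) (K₀ p k) (p : W p k) := by simp
  have hirr : Irreducible (p : W p k) := WittVector.irreducible p
  have h2 : (IsDiscreteValuationRing.maximalIdeal (W p k)).intValuation (p : W p k) =
      WithZero.exp (-1 : ℤ) := by
    refine IsDedekindDomain.HeightOneSpectrum.intValuation_singleton _ hirr.ne_zero ?_
    exact (IsDiscreteValuationRing.irreducible_iff_uniformizer _).1 hirr
  rw [absK₀, h1, IsDedekindDomain.HeightOneSpectrum.valuation_of_algebraMap, h2,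
    WithZeroMulInt.toNNReal_neg_apply _ WithZero.exp_ne_zero]
  have h3 : Multiplicative.toAdd (WithZero.unzero (WithZero.exp_ne_zero (a := (-1 : ℤ)))) = -1 :=
    rfl
  rw [h3]
  simp

theorem absK₀_unit (w : (W p k)ˣ) : absK₀ p k (algebraMap (W p k) (K₀ p k) w) = 1 := by
  refine le_antisymm (absK₀_algebraMap_le p k _) ?_
  have h : absK₀ p k (algebraMap (W p k) (K₀ p k) w) *
      absK₀ p k (algebraMap (W p k) (K₀ p k) (w⁻¹ : (W p k)ˣ)) = 1 := by
    rw [← absK₀_mul, ← map_mul, Units.mul_inv, map_one, absK₀_one]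
  rw [← h]
  exact mul_le_of_le_one_right (absK₀_nonneg p k _) (absK₀_algebraMap_le p k _)

theorem exists_zpow_mul_unit {c : K₀ p k} (hc : c ≠ 0) :
    ∃ (z : ℤ) (w : (W p k)ˣ), c = (p : K₀ p k) ^ z * algebraMap (W p k) (K₀ p k) w := by
  obtain ⟨n, v, hv⟩ := exists_p_pow_mul p k c
  have hp := p_ne_zero p k
  have hv0 : v ≠ 0 := by
    rintro rfl
    rw [map_zero] at hv
    exact mul_ne_zero (pow_ne_zero _ hp) hc hv
  obtain ⟨m, w, rfl⟩ := WittVector.exists_eq_pow_p_mul' v hv0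
  refine ⟨m - n, w, ?_⟩
  rw [map_mul, map_pow, map_natCast] at hv
  rw [zpow_sub₀ hp, zpow_natCast, zpow_natCast, div_mul_eq_mul_div, eq_div_iff (pow_ne_zero _ hp),
    ← hv, mul_comm]

theorem absK₀_zpow_mul_unit (z : ℤ) (w : (W p k)ˣ) :
    absK₀ p k ((p : K₀ p k) ^ z * algebraMap (W p k) (K₀ p k) w) = (p : ℝ) ^ (-z) := by
  rw [absK₀_mul, absK₀_unit, mul_one, absK₀_zpow, absK₀_p, inv_zpow, zpow_neg]

theorem exists_algebraMap_eq {c : K₀ p k} (hc : absK₀ p k c ≤ 1) :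
    ∃ w : W p k, algebraMap (W p k) (K₀ p k) w = c := by
  rcases eq_or_ne c 0 with rfl | h0
  · exact ⟨0, map_zero _⟩
  obtain ⟨z, w, rfl⟩ := exists_zpow_mul_unit p k h0
  rw [absK₀_zpow_mul_unit] at hc
  have hz : 0 ≤ z := by
    by_contra hz
    exact absurd hc (not_le.2 (one_lt_zpow₀ (one_lt_p_real p) (by omega)))
  obtain ⟨n, rfl⟩ := Int.eq_ofNat_of_zero_le hz
  exact ⟨(p : W p k) ^ n * w, by simp⟩

theorem exists_algebraMap_eq_p_pow {c : K₀ p k} {n : ℕ} (hc : absK₀ p k c ≤ (p : ℝ)⁻¹ ^ n) :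
    ∃ w : W p k, algebraMap (W p k) (K₀ p k) ((p : W p k) ^ n * w) = c := by
  obtain ⟨w, hw⟩ := exists_algebraMap_eq p k (c := (p : K₀ p k)⁻¹ ^ n * c) (by
    rw [absK₀_mul, absK₀_pow, absK₀_inv, absK₀_p]
    have := p_real_pos p
    calc _ ≤ ((p : ℝ)⁻¹)⁻¹ ^ n * (p : ℝ)⁻¹ ^ n := by gcongr
      _ = 1 := by rw [← mul_pow, inv_mul_cancel₀ (by positivity), one_pow])
  refine ⟨w, ?_⟩
  have hp := p_ne_zero p k
  rw [map_mul, hw, map_pow, map_natCast, ← mul_assoc, ← mul_pow, mul_inv_cancel₀ hp, one_pow,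
    one_mul]

theorem φK₀_algebraMap (x : W p k) : φK₀ p k (algebraMap (W p k) (K₀ p k) x) =
    algebraMap (W p k) (K₀ p k) (WittVector.frobenius x) :=
  IsFractionRing.ringEquivOfRingEquiv_algebraMap (WittVector.frobeniusEquiv p k) x

theorem absK₀_φK₀ (x : K₀ p k) : absK₀ p k (φK₀ p k x) = absK₀ p k x := by
  rcases eq_or_ne x 0 with rfl | h0
  · rw [map_zero]
  obtain ⟨z, w, rfl⟩ := exists_zpow_mul_unit p k h0
  rw [map_mul, map_zpow₀, map_natCast, φK₀_algebraMap]
  have := absK₀_zpow_mul_unit p k z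
    (Units.map (WittVector.frobenius : W p k →+* W p k).toMonoidHom w)
  rw [absK₀_zpow_mul_unit, ← this]
  rfl

/-- The ultrametric inequality along a sequence: a bound on the steps bounds all differences. -/
theorem absK₀_sub_le_of_step {a : ℕ → K₀ p k} {b : ℕ → ℝ} (hb : Antitone b)
    (hb0 : ∀ n, 0 ≤ b n) (h : ∀ n, absK₀ p k (a (n + 1) - a n) ≤ b n) {m n : ℕ} (hmn : m ≤ n) :
    absK₀ p k (a n - a m) ≤ b m := by
  induction n, hmn using Nat.le_induction with
  | base => simpa [absK₀_zero] using hb0 m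
  | succ n hmn ih =>
    rw [← sub_add_sub_cancel]
    exact (absK₀_add_le p k _ _).trans (max_le ((h n).trans (hb hmn)) ih)

/-- Completeness of `K₀`, for sequences with a geometric rate of convergence. -/
theorem exists_limit (a : ℕ → K₀ p k) (C θ : ℝ) (hC : 0 ≤ C) (h0 : 0 ≤ θ) (h1 : θ < 1)
    (h : ∀ n, absK₀ p k (a (n + 1) - a n) ≤ C * θ ^ n) :
    ∃ L : K₀ p k, ∀ n, absK₀ p k (L - a n) ≤ C * θ ^ n := by
  have hp := p_real_pos p
  have hstep : ∀ {m n : ℕ}, m ≤ n → absK₀ p k (a n - a m) ≤ C * θ ^ m :=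
    fun hmn => absK₀_sub_le_of_step p k
      (fun i j hij => mul_le_mul_of_nonneg_left (pow_le_pow_of_le_one h0 h1.le hij) hC)
      (fun n => by positivity) h hmn
  have hpi : (p : ℝ)⁻¹ < 1 := inv_lt_one_of_one_lt₀ (one_lt_p_real p)
  obtain ⟨K, hK⟩ := exists_pow_lt_of_lt_one (inv_pos.2 hp) h1
  -- After multiplication by a power of `p` the sequence lies in `W`.
  obtain ⟨N, hN⟩ : ∃ N : ℕ, max C (absK₀ p k (a 0)) ≤ (p : ℝ) ^ N :=
    (pow_unbounded_of_one_lt _ (one_lt_p_real p)).imp fun _ h => h.le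
  have hpN : absK₀ p k ((p : K₀ p k) ^ N) = ((p : ℝ) ^ N)⁻¹ := by
    rw [absK₀_pow, absK₀_p, inv_pow]
  have ha : ∀ n, absK₀ p k (a n) ≤ (p : ℝ) ^ N := fun n => by
    rw [← sub_add_cancel (a n) (a 0)]
    refine (absK₀_add_le p k _ _).trans (max_le ?_ ((le_max_right _ _).trans hN))
    refine ((hstep (Nat.zero_le n)).trans ?_).trans ((le_max_left _ _).trans hN)
    simp
  have hw : ∀ n, ∃ w : W p k, algebraMap (W p k) (K₀ p k) w = (p : K₀ p k) ^ N * a n := fun n =>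
    exists_algebraMap_eq p k (by
      rw [absK₀_mul, hpN, inv_mul_le_iff₀ (by positivity), mul_one]
      exact ha n)
  choose w hw using hw
  obtain ⟨L, hL⟩ := IsPrecomplete.prec (I := Ideal.span {(p : W p k)}) inferInstance
    (f := fun j => w (K * j)) (by
      intro m n hmn
      rw [SModEq.sub_mem, smul_eq_mul, Ideal.mul_top, Ideal.span_singleton_pow,
        Ideal.mem_span_singleton, dvd_sub_comm]
      obtain ⟨v, hv⟩ := exists_algebraMap_eq_p_pow p k (n := m)
        (c := (p : K₀ p k) ^ N * (a (K * n) - a (K * m))) (by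
          rw [absK₀_mul, hpN, inv_mul_le_iff₀ (by positivity)]
          refine (hstep (Nat.mul_le_mul_left K hmn)).trans ?_
          rw [pow_mul]
          gcongr
          exact (le_max_left _ _).trans hN)
      refine ⟨v, IsFractionRing.injective (W p k) (K₀ p k) ?_⟩
      rw [hv, map_sub, hw, hw, mul_sub])
  have hLn : ∀ j, absK₀ p k (((p : K₀ p k) ^ N)⁻¹ * algebraMap (W p k) (K₀ p k) L - a (K * j)) ≤
      (p : ℝ) ^ N * (p : ℝ)⁻¹ ^ j := by
    intro j
    have h3 := hL j
    rw [SModEq.sub_mem, smul_eq_mul, Ideal.mul_top, Ideal.span_singleton_pow,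
        Ideal.mem_span_singleton] at h3
    obtain ⟨v, hv⟩ := h3
    have h4 : ((p : K₀ p k) ^ N)⁻¹ * algebraMap (W p k) (K₀ p k) L - a (K * j) =
        -(((p : K₀ p k) ^ N)⁻¹ * ((p : K₀ p k) ^ j * algebraMap (W p k) (K₀ p k) v)) := by
      have h5 := congrArg (algebraMap (W p k) (K₀ p k)) hv
      rw [map_sub, map_mul, hw, map_pow, map_natCast] at h5
      rw [← h5]
      have := pow_ne_zero N (p_ne_zero p k)
      field_simp
      ring
    rw [h4, absK₀_neg, absK₀_mul, absK₀_inv, hpN, inv_inv, absK₀_mul, absK₀_pow, absK₀_p]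
    gcongr
    exact mul_le_of_le_one_right (by positivity) (absK₀_algebraMap_le p k _)
  refine ⟨((p : K₀ p k) ^ N)⁻¹ * algebraMap (W p k) (K₀ p k) L, fun n => ?_⟩
  refine le_of_forall_pos_le_add fun ε hε => ?_
  obtain ⟨j, hj⟩ := exists_pow_lt_of_lt_one (div_pos hε (pow_pos hp N)) hpi
  have hKpos : 0 < K := by
    rcases Nat.eq_zero_or_pos K with rfl | h
    · rw [pow_zero] at hK
      exact absurd hK (not_lt.2 hpi.le)
    · exact h
  have hnj : n ≤ K * (n + j) := le_trans (Nat.le_add_right n j) (Nat.le_mul_of_pos_left _ hKpos)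
  rw [← sub_add_sub_cancel _ (a (K * (n + j)))]
  refine (absK₀_add_le p k _ _).trans (max_le ?_ ?_)
  · refine (hLn (n + j)).trans ?_
    have h6 : (p : ℝ)⁻¹ ^ (n + j) ≤ ε / (p : ℝ) ^ N :=
      (pow_le_pow_of_le_one (inv_nonneg.2 hp.le) hpi.le (Nat.le_add_left j n)).trans hj.le
    calc _ ≤ (p : ℝ) ^ N * (ε / (p : ℝ) ^ N) := by gcongr
      _ = ε := by field_simp
      _ ≤ _ := by linarith [show 0 ≤ C * θ ^ n by positivity]
  · linarith [hstep hnj]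

end AbsoluteValue

/-! ### Gauss norms -/

section GaussNorm

variable (p : ℕ) [Fact p.Prime] (k : Type*) [Field k] [CharP k p] [PerfectRing k p]

variable {p k} in
/-- The Gauss norm of radius `r` of the power series `x` is at most `C`. -/
def GaussLE (r C : ℝ) (x : 𝒜 p k) : Prop :=
  ∀ n : ℕ, absK₀ p k (PowerSeries.coeff n x) * r ^ n ≤ C

variable {p k}

theorem GaussLE.nonneg {r C : ℝ} {x : 𝒜 p k} (h : GaussLE r C x) : 0 ≤ C := by
  have := h 0
  rw [pow_zero, mul_one] at this
  exact (absK₀_nonneg p k _).trans this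

theorem GaussLE.mono {r C D : ℝ} {x : 𝒜 p k} (h : GaussLE r C x) (hCD : C ≤ D) : GaussLE r D x :=
  fun n => (h n).trans hCD

theorem GaussLE.radius_mono {r s C : ℝ} {x : 𝒜 p k} (h : GaussLE s C x) (h0 : 0 ≤ r)
    (hrs : r ≤ s) : GaussLE r C x := fun n =>
  (mul_le_mul_of_nonneg_left (pow_le_pow_left₀ h0 hrs n) (absK₀_nonneg p k _)).trans (h n)

theorem GaussLE.sub {r C D : ℝ} (hr : 0 ≤ r) {x y : 𝒜 p k} (hx : GaussLE r C x)
    (hy : GaussLE r D y) : GaussLE r (max C D) (x - y) := fun n => by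
  rw [map_sub]
  refine le_trans (mul_le_mul_of_nonneg_right (absK₀_sub_le p k _ _) (by positivity)) ?_
  rw [max_mul_of_nonneg _ _ (by positivity)]
  exact max_le_max (hx n) (hy n)

theorem GaussLE.sum {ι : Type*} {r C : ℝ} (hr : 0 ≤ r) (hC : 0 ≤ C) (s : Finset ι)
    {x : ι → 𝒜 p k} (hx : ∀ i ∈ s, GaussLE r C (x i)) : GaussLE r C (∑ i ∈ s, x i) := fun n => by
  rcases hr.eq_or_lt with rfl | hr
  · rcases Nat.eq_zero_or_pos n with rfl | hn
    · rw [map_sum, pow_zero, mul_one]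
      exact absK₀_sum_le p k s _ hC fun i hi => by simpa using hx i hi 0
    · rw [zero_pow hn.ne', mul_zero]
      exact hC
  · rw [← le_div_iff₀ (by positivity), map_sum]
    exact absK₀_sum_le p k s _ (by positivity) fun i hi => by
      rw [le_div_iff₀ (by positivity)]
      exact hx i hi n

theorem GaussLE.mul {r C D : ℝ} (hr : 0 < r) {x y : 𝒜 p k} (hx : GaussLE r C x)
    (hy : GaussLE r D y) : GaussLE r (C * D) (x * y) := fun n => by
  have hC := hx.nonneg
  have hD := hy.nonneg
  rw [PowerSeries.coeff_mul, ← le_div_iff₀ (by positivity)]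
  refine absK₀_sum_le p k _ _ (by positivity) fun a ha => ?_
  rw [le_div_iff₀ (by positivity), absK₀_mul,
    ← Finset.HasAntidiagonal.mem_antidiagonal.1 ha, pow_add]
  calc _ = (absK₀ p k (PowerSeries.coeff a.1 x) * r ^ a.1) *
        (absK₀ p k (PowerSeries.coeff a.2 y) * r ^ a.2) := by ring
    _ ≤ C * D := mul_le_mul (hx _) (hy _)
        (mul_nonneg (absK₀_nonneg p k _) (by positivity)) hC

theorem gaussLE_ofS {r : ℝ} (h0 : 0 ≤ r) (h1 : r ≤ 1) (s : 𝔖 p k) :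
    GaussLE r 1 (ofS p k s) := fun n => by
  rw [ofS, PowerSeries.coeff_map]
  exact mul_le_one₀ (absK₀_algebraMap_le p k _) (by positivity) (pow_le_one₀ h0 h1)

theorem GaussLE.C_mul {r C : ℝ} {x : 𝒜 p k} (h : GaussLE r C x) (c : K₀ p k) :
    GaussLE r (absK₀ p k c * C) (PowerSeries.C c * x) := fun n => by
  rw [PowerSeries.coeff_C_mul, absK₀_mul, mul_assoc]
  exact mul_le_mul_of_nonneg_left (h n) (absK₀_nonneg p k c)

theorem coeff_φ𝒜 (x : 𝒜 p k) (n : ℕ) : PowerSeries.coeff n (φ𝒜 p k x) =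
    if p ∣ n then φK₀ p k (PowerSeries.coeff (n / p) x) else 0 := by
  have hp := (Fact.out : p.Prime).ne_zero
  change PowerSeries.coeff n (PowerSeries.expand p hp (PowerSeries.map (φK₀ p k) x)) = _
  rw [PowerSeries.coeff_expand, PowerSeries.coeff_map]

theorem GaussLE.φ𝒜 {r C : ℝ} {x : 𝒜 p k} (h : GaussLE (r ^ p) C x) :
    GaussLE r C (φ𝒜 p k x) := fun n => by
  rw [coeff_φ𝒜]
  split_ifs with hn
  · obtain ⟨m, rfl⟩ := hn
    rw [Nat.mul_div_cancel_left _ (Fact.out : p.Prime).pos, absK₀_φK₀, pow_mul]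
    exact h m
  · rw [absK₀_zero, zero_mul]
    exact h.nonneg

theorem GaussLE.φ𝒜_iterate {r C : ℝ} {x : 𝒜 p k} (n : ℕ) (h : GaussLE (r ^ p ^ n) C x) :
    GaussLE r C ((HodgePink.φ𝒜 p k)^[n] x) := by
  induction n generalizing r with
  | zero => simpa using h
  | succ n ih =>
    rw [Function.iterate_succ_apply']
    exact (ih (by rwa [← pow_mul, ← pow_succ'])).φ𝒜

theorem mem_𝒪_iff {x : 𝒜 p k} : x ∈ 𝒪 p k ↔ ∀ r : ℝ, 0 < r → r < 1 → ∃ C, GaussLE r C x := by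
  change (∀ r : ℝ, 0 < r → r < 1 → BddAbove _) ↔ _
  simp only [bddAbove_def, Set.forall_mem_range, GaussLE]

theorem φ𝒜_mem_𝒪 {x : 𝒜 p k} (hx : x ∈ 𝒪 p k) : φ𝒜 p k x ∈ 𝒪 p k := by
  rw [mem_𝒪_iff] at hx ⊢
  intro r h0 h1
  obtain ⟨C, hC⟩ := hx (r ^ p) (pow_pos h0 p) (pow_lt_one₀ h0.le h1 (Fact.out : p.Prime).ne_zero)
  exact ⟨C, hC.φ𝒜⟩

theorem φ𝒜_iterate_mem_𝒪 {x : 𝒜 p k} (hx : x ∈ 𝒪 p k) (n : ℕ) : (φ𝒜 p k)^[n] x ∈ 𝒪 p k := by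
  induction n with
  | zero => exact hx
  | succ n ih =>
    rw [Function.iterate_succ_apply']
    exact φ𝒜_mem_𝒪 ih

/-- `𝔖[1/p]` is the ring of the power series with bounded coefficients. -/
theorem mem_Sp_iff {x : 𝒜 p k} : x ∈ Sp p k ↔ ∃ C, GaussLE 1 C x := by
  have hp0 := p_ne_zero p k
  have hp := p_real_pos p
  constructor
  · rintro ⟨n, s, hs⟩
    have h : x = PowerSeries.C ((p : K₀ p k) ^ n)⁻¹ * ofS p k s := by
      rw [← hs, ← map_natCast PowerSeries.C, ← map_pow, ← mul_assoc, ← map_mul,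
        inv_mul_cancel₀ (pow_ne_zero _ hp0), map_one, one_mul]
    exact ⟨_, h ▸ (gaussLE_ofS zero_le_one le_rfl s).C_mul _⟩
  · rintro ⟨C, hC⟩
    obtain ⟨N, hN⟩ := pow_unbounded_of_one_lt C (one_lt_p_real p)
    have h : ∀ n, ∃ w : W p k, algebraMap (W p k) (K₀ p k) w =
        (p : K₀ p k) ^ N * PowerSeries.coeff n x := fun n =>
      exists_algebraMap_eq p k (by
        rw [absK₀_mul, absK₀_pow, absK₀_p, inv_pow, inv_mul_le_iff₀ (by positivity), mul_one]
        have := hC n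
        rw [one_pow, mul_one] at this
        exact this.trans hN.le)
    choose w hw using h
    refine ⟨N, PowerSeries.mk w, ?_⟩
    ext n
    rw [ofS, PowerSeries.coeff_map, PowerSeries.coeff_mk, hw, ← map_natCast PowerSeries.C,
      ← map_pow, PowerSeries.coeff_C_mul]

theorem ofS_mem_Sp (s : 𝔖 p k) : ofS p k s ∈ Sp p k := ⟨0, s, by simp⟩

theorem ofS_mem_𝒪 (s : 𝔖 p k) : ofS p k s ∈ 𝒪 p k := Sp_le_𝒪 p k (ofS_mem_Sp s)

end GaussNorm

/-! ### Distinguished power series -/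

section Distinguished

variable {p : ℕ} [Fact p.Prime] {k : Type*} [Field k] [CharP k p] [PerfectRing k p]

variable (p k) in
/-- The Frobenius `φ` of `𝔖`. -/
def φ𝔖 : 𝔖 p k →+* 𝔖 p k :=
  (PowerSeries.expand p (Fact.out : p.Prime).ne_zero : 𝔖 p k →ₐ[W p k] 𝔖 p k).toRingHom.comp
    (PowerSeries.map WittVector.frobenius)

theorem φ𝒜_ofS' (s : 𝔖 p k) : φ𝒜 p k (ofS p k s) = ofS p k (φ𝔖 p k s) := φ𝒜_ofS p k s

theorem φ𝒜_iterate_ofS (n : ℕ) (s : 𝔖 p k) :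
    (φ𝒜 p k)^[n] (ofS p k s) = ofS p k ((φ𝔖 p k)^[n] s) := by
  induction n with
  | zero => rfl
  | succ n ih => rw [Function.iterate_succ_apply', ih, φ𝒜_ofS', Function.iterate_succ_apply']

/-- `F ∈ 𝔖` is distinguished of degree `d`, in the weak sense that `F` is congruent to `u ^ d`
modulo `p`. -/
def IsDist (d : ℕ) (F : 𝔖 p k) : Prop := ∃ G : 𝔖 p k, F = PowerSeries.X ^ d + (p : 𝔖 p k) * G

theorem IsDist.one : IsDist 0 (1 : 𝔖 p k) := ⟨0, by simp⟩

theorem IsDist.mul {d d' : ℕ} {F F' : 𝔖 p k} (h : IsDist d F) (h' : IsDist d' F') :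
    IsDist (d + d') (F * F') := by
  obtain ⟨G, rfl⟩ := h
  obtain ⟨G', rfl⟩ := h'
  exact ⟨PowerSeries.X ^ d * G' + G * PowerSeries.X ^ d' + (p : 𝔖 p k) * G * G', by ring⟩

theorem IsDist.pow {d : ℕ} {F : 𝔖 p k} (h : IsDist d F) (n : ℕ) : IsDist (n * d) (F ^ n) := by
  induction n with
  | zero => simpa using IsDist.one
  | succ n ih =>
    rw [pow_succ, Nat.succ_mul]
    exact ih.mul h

theorem IsDist.prod {ι : Type*} (s : Finset ι) {d : ι → ℕ} {F : ι → 𝔖 p k}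
    (h : ∀ i ∈ s, IsDist (d i) (F i)) : IsDist (∑ i ∈ s, d i) (∏ i ∈ s, F i) := by
  induction s using Finset.cons_induction with
  | empty => simpa using IsDist.one
  | cons a s ha ih =>
    rw [Finset.sum_cons, Finset.prod_cons]
    exact (h a (by simp)).mul (ih fun i hi => h i (by simp [hi]))

/-- Multiplication by a power series that is distinguished of degree `d` multiplies the Gauss norm
of radius `r` by at least `r ^ d`, provided that `r ^ d > 1 / p`, as the term `u ^ d` dominates. -/
theorem GaussLE.of_dist_mul {d : ℕ} {F : 𝔖 p k} (hF : IsDist d F) {r C C' : ℝ} (h0 : 0 < r)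
    (h1 : r ≤ 1) (hr : (p : ℝ)⁻¹ < r ^ d) {y : 𝒜 p k} (hy : GaussLE r C' y)
    (h : GaussLE r C (ofS p k F * y)) : GaussLE r (C / r ^ d) y := by
  obtain ⟨G, rfl⟩ := hF
  have hp := p_real_pos p
  set θ : ℝ := (p : ℝ)⁻¹ / r ^ d with hθ
  have hθ0 : 0 ≤ θ := by positivity
  have hθ1 : θ < 1 := (div_lt_one (by positivity)).2 hr
  have hA : 0 ≤ C / r ^ d := div_nonneg h.nonneg (by positivity)
  have step : ∀ D, GaussLE r D y → GaussLE r (max (C / r ^ d) (θ * D)) y := by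
    intro D hD
    have h2 : PowerSeries.X ^ d * y = ofS p k (PowerSeries.X ^ d + (p : 𝔖 p k) * G) * y -
        PowerSeries.C (p : K₀ p k) * (ofS p k G * y) := by
      rw [map_add, map_mul, map_pow, map_natCast, map_natCast, ofS, PowerSeries.map_X]
      ring
    have h3 := h.sub h0.le (((gaussLE_ofS h0.le h1 G).mul h0 hD).C_mul (p : K₀ p k))
    rw [← h2, absK₀_p, one_mul] at h3
    intro n
    have h4 := h3 (n + d)
    rw [PowerSeries.coeff_X_pow_mul, pow_add, ← mul_assoc, ← le_div_iff₀ (by positivity),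
      ← max_div_div_right (pow_nonneg h0.le d)] at h4
    rwa [hθ, div_mul_eq_mul_div]
  have iter : ∀ j, GaussLE r (max (C / r ^ d) (θ ^ j * C')) y := by
    intro j
    induction j with
    | zero => simpa using hy.mono (le_max_right _ _)
    | succ j ih =>
      refine (step _ ih).mono (max_le (le_max_left _ _) ?_)
      rw [mul_max_of_nonneg _ _ hθ0]
      refine max_le_max (mul_le_of_le_one_left hA hθ1.le) (le_of_eq ?_)
      ring
  intro n
  have hlim : Filter.Tendsto (fun j : ℕ => max (C / r ^ d) (θ ^ j * C')) Filter.atTop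
      (nhds (max (C / r ^ d) (0 * C'))) :=
    tendsto_const_nhds.max ((tendsto_pow_atTop_nhds_zero_of_lt_one hθ0 hθ1).mul_const C')
  rw [zero_mul, max_eq_left hA] at hlim
  exact ge_of_tendsto' hlim fun j => iter j n

theorem exists_radius (p : ℕ) [Fact p.Prime] (d : ℕ) :
    ∃ r : ℝ, 0 < r ∧ r < 1 ∧ (p : ℝ)⁻¹ < r ^ d := by
  have hpow : ∀ᶠ r : ℝ in nhdsWithin 1 (Set.Iio 1), (p : ℝ)⁻¹ < r ^ d :=
    ((continuous_pow d).tendsto (1 : ℝ)).mono_left nhdsWithin_le_nhds |>.eventually_const_lt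
      (by rw [one_pow]; exact inv_lt_one_of_one_lt₀ (one_lt_p_real p))
  have hpos : ∀ᶠ r : ℝ in nhdsWithin 1 (Set.Iio 1), 0 < r :=
    nhdsWithin_le_nhds (lt_mem_nhds one_pos)
  obtain ⟨r, ⟨h1, h2⟩, h3⟩ := ((hpow.and hpos).and self_mem_nhdsWithin).exists
  exact ⟨r, h2, h3, h1⟩

/-- If `F` is distinguished and `F y` is bounded for `y ∈ 𝒪`, then `y` is bounded. -/
theorem mem_Sp_of_dist_mul {d : ℕ} {F : 𝔖 p k} (hF : IsDist d F) {y : 𝒜 p k} (hy : y ∈ 𝒪 p k)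
    (h : ofS p k F * y ∈ Sp p k) : y ∈ Sp p k := by
  rw [mem_Sp_iff] at h ⊢
  rw [mem_𝒪_iff] at hy
  obtain ⟨C, hC⟩ := h
  refine ⟨C, fun n => ?_⟩
  have hcont : Filter.Tendsto (fun r : ℝ => absK₀ p k (PowerSeries.coeff n y) * r ^ n * r ^ d)
      (nhdsWithin 1 (Set.Iio 1))
      (nhds (absK₀ p k (PowerSeries.coeff n y) * 1 ^ n * 1 ^ d)) :=
    (Continuous.tendsto (by fun_prop) 1).mono_left nhdsWithin_le_nhds
  rw [one_pow d, mul_one] at hcont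
  have hpow : ∀ᶠ r : ℝ in nhdsWithin 1 (Set.Iio 1), (p : ℝ)⁻¹ < r ^ d :=
    ((continuous_pow d).tendsto (1 : ℝ)).mono_left nhdsWithin_le_nhds |>.eventually_const_lt
      (by rw [one_pow]; exact inv_lt_one_of_one_lt₀ (one_lt_p_real p))
  have hpos : ∀ᶠ r : ℝ in nhdsWithin 1 (Set.Iio 1), 0 < r :=
    nhdsWithin_le_nhds (lt_mem_nhds one_pos)
  refine le_of_tendsto hcont ?_
  filter_upwards [hpow, hpos, self_mem_nhdsWithin] with r h1 h2 h3
  have h3 : r < 1 := h3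
  obtain ⟨C', hC'⟩ := hy r h2 h3
  have := GaussLE.of_dist_mul hF h2 h3.le h1 hC' (hC.radius_mono h2.le h3.le) n
  rwa [le_div_iff₀ (by positivity)] at this

end Distinguished

/-! ### Division by distinguished power series -/

section Division

variable {p : ℕ} [Fact p.Prime] {k : Type*} [Field k] [CharP k p] [PerfectRing k p]

/-- The power series `∑ x_{n + d} uⁿ`, that is, the quotient of `x` by `u ^ d`. -/
def shift (d : ℕ) (x : 𝒜 p k) : 𝒜 p k := PowerSeries.mk fun n => PowerSeries.coeff (n + d) x

@[simp] theorem coeff_shift (d n : ℕ) (x : 𝒜 p k) :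
    PowerSeries.coeff n (shift d x) = PowerSeries.coeff (n + d) x := PowerSeries.coeff_mk _ _

theorem shift_sub (d : ℕ) (x y : 𝒜 p k) : shift d (x - y) = shift d x - shift d y := by
  ext n; simp

theorem shift_X_pow_mul (d : ℕ) (x : 𝒜 p k) : shift d (PowerSeries.X ^ d * x) = x := by
  ext n; simp [PowerSeries.coeff_X_pow_mul]

theorem GaussLE.shift {r C : ℝ} (hr : 0 < r) {x : 𝒜 p k} (h : GaussLE r C x) (d : ℕ) :
    GaussLE r (C / r ^ d) (shift d x) := fun n => by
  rw [coeff_shift, le_div_iff₀ (by positivity), mul_assoc, ← pow_add]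
  exact h (n + d)

/-- Weierstrass division in `𝒪` by a distinguished power series `F = u ^ d + p G`: the quotient is
the fixed point of the operator that maps `y` to the quotient of `x - p G y` by `u ^ d`. -/
theorem exists_division {d : ℕ} {F : 𝔖 p k} (hF : IsDist d F) {x : 𝒜 p k} (hx : x ∈ 𝒪 p k) :
    ∃ (q : (K₀ p k)[X]) (y : 𝒜 p k), y ∈ 𝒪 p k ∧ q.degree < d ∧ x = q + ofS p k F * y := by
  obtain ⟨G, rfl⟩ := hF
  have hp := p_real_pos p
  rw [mem_𝒪_iff] at hx
  set pG : 𝒜 p k := PowerSeries.C (p : K₀ p k) * ofS p k G with hpG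
  have hG : ∀ {r : ℝ}, 0 < r → r < 1 → GaussLE r (p : ℝ)⁻¹ pG := fun h0 h1 => by
    have := (gaussLE_ofS h0.le h1.le G).C_mul (p : K₀ p k)
    rwa [absK₀_p, mul_one] at this
  let Ψ : 𝒜 p k → 𝒜 p k := fun y => shift d (x - pG * y)
  have hΨ : ∀ y z, Ψ y - Ψ z = shift d (pG * (z - y)) := fun y z => by
    rw [← shift_sub]
    congr 1
    ring
  let Y : ℕ → 𝒜 p k := fun j => Ψ^[j] 0
  have hY : ∀ j, Y (j + 1) = Ψ (Y j) := fun j => Function.iterate_succ_apply' _ _ _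
  -- Estimates that are uniform in `j`, at each radius `r` with `r ^ d > 1 / p`.
  have bound : ∀ r C : ℝ, 0 < r → r < 1 → (p : ℝ)⁻¹ < r ^ d → GaussLE r C x → ∀ j,
      GaussLE r (C / r ^ d) (Y j) ∧
      GaussLE r (C / r ^ d * ((p : ℝ)⁻¹ / r ^ d) ^ j) (Y (j + 1) - Y j) := by
    intro r C h0 h1 hr hC j
    have hθ1 : (p : ℝ)⁻¹ / r ^ d ≤ 1 := ((div_lt_one (by positivity)).2 hr).le
    have hD : 0 ≤ C / r ^ d := div_nonneg hC.nonneg (by positivity)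
    have h1' : ∀ j, GaussLE r (C / r ^ d) (Y j) := by
      intro j
      induction j with
      | zero => intro n; simpa [Y, absK₀_zero] using hD
      | succ j ih =>
        rw [hY]
        refine ((hC.sub h0.le ((hG h0 h1).mul h0 ih)).shift h0 d).mono ?_
        rw [← max_div_div_right (pow_nonneg h0.le d)]
        refine max_le le_rfl ?_
        rw [mul_comm, mul_div_assoc]
        exact mul_le_of_le_one_right hD hθ1
    refine ⟨h1' j, ?_⟩
    induction j with
    | zero => simpa [Y] using h1' 1
    | succ j ih =>
      rw [hY (j + 1), hY j, hΨ, ← hY j]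
      have h2 : GaussLE r (C / r ^ d * ((p : ℝ)⁻¹ / r ^ d) ^ j) (Y j - Y (j + 1)) := fun n => by
        rw [← neg_sub, map_neg, absK₀_neg]
        exact ih n
      refine (((hG h0 h1).mul h0 h2).shift h0 d).mono (le_of_eq ?_)
      ring
  obtain ⟨ρ, hρ0, hρ1, hρ⟩ := exists_radius p d
  obtain ⟨C, hC⟩ := hx ρ hρ0 hρ1
  set D := C / ρ ^ d with hDdef
  set θ := (p : ℝ)⁻¹ / ρ ^ d with hθdef
  have hθ0 : 0 ≤ θ := by positivity
  have hθ1 : θ < 1 := (div_lt_one (by positivity)).2 hρ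
  have hD : 0 ≤ D := div_nonneg hC.nonneg (by positivity)
  have hlim : ∀ n, ∃ L : K₀ p k, ∀ j,
      absK₀ p k (L - PowerSeries.coeff n (Y j)) ≤ D / ρ ^ n * θ ^ j := fun n => by
    refine exists_limit p k _ _ θ (by positivity) hθ0 hθ1 fun j => ?_
    have := (bound ρ C hρ0 hρ1 hρ hC j).2 n
    rw [map_sub, ← le_div_iff₀ (by positivity)] at this
    exact this.trans (le_of_eq (by ring))
  choose L hL using hlim
  set y : 𝒜 p k := PowerSeries.mk L with hy
  have hyY : ∀ j, GaussLE ρ (D * θ ^ j) (y - Y j) := fun j n => by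
    rw [map_sub, hy, PowerSeries.coeff_mk, ← le_div_iff₀ (by positivity)]
    exact (hL n j).trans (le_of_eq (by ring))
  have htend : Filter.Tendsto (fun j : ℕ => D * θ ^ j) Filter.atTop (nhds 0) := by
    simpa using (tendsto_pow_atTop_nhds_zero_of_lt_one hθ0 hθ1).const_mul D
  have hfix : Ψ y = y := by
    have h : ∀ j, GaussLE ρ (D * θ ^ (j + 1)) (Ψ y - y) := fun j => by
      have h1 := ((hG hρ0 hρ1).mul hρ0 (hyY j)).shift hρ0 d
      have h2 : Ψ y - y = 0 - (shift d (pG * (y - Y j))) - (y - Y (j + 1)) := by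
        have h3 : shift d (pG * (y - Y j)) = Ψ (Y j) - Ψ y := (hΨ _ _).symm
        rw [h3, hY]
        ring
      have h0 : GaussLE ρ 0 (0 : 𝒜 p k) := fun n => by simp [absK₀_zero]
      rw [h2]
      refine ((h0.sub hρ0.le h1).sub hρ0.le (hyY (j + 1))).mono ?_
      refine max_le (max_le (by positivity) (le_of_eq ?_)) le_rfl
      rw [hθdef]
      ring
    have h' : ∀ n, PowerSeries.coeff n (Ψ y - y) = 0 := fun n => by
      rw [← absK₀_eq_zero_iff p k]
      have h1 : absK₀ p k (PowerSeries.coeff n (Ψ y - y)) * ρ ^ n ≤ 0 :=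
        ge_of_tendsto' ((Filter.tendsto_add_atTop_iff_nat 1).2 htend) fun j => h j n
      exact le_antisymm (nonpos_of_mul_nonpos_left h1 (by positivity)) (absK₀_nonneg p k _)
    exact sub_eq_zero.1 (PowerSeries.ext fun n => by rw [h', map_zero])
  have hyO : y ∈ 𝒪 p k := by
    rw [mem_𝒪_iff]
    intro r h0 h1
    have hs1 : max r ρ < 1 := max_lt h1 hρ1
    have hs0 : 0 < max r ρ := lt_max_of_lt_left h0
    obtain ⟨C', hC'⟩ := hx _ hs0 hs1
    have hρs : (p : ℝ)⁻¹ < max r ρ ^ d :=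
      hρ.trans_le (pow_le_pow_left₀ hρ0.le (le_max_right _ _) d)
    refine ⟨C' / max r ρ ^ d, GaussLE.radius_mono (s := max r ρ) ?_ h0.le (le_max_left _ _)⟩
    intro n
    rcases eq_or_ne (PowerSeries.coeff n y) 0 with hn | hn
    · rw [hn, absK₀_zero, zero_mul]
      exact div_nonneg hC'.nonneg (by positivity)
    · have hev : ∀ᶠ j : ℕ in Filter.atTop,
          D * θ ^ j < absK₀ p k (PowerSeries.coeff n y) * ρ ^ n :=
        htend.eventually_lt_const (mul_pos (absK₀_pos p k hn) (by positivity))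
      obtain ⟨j, hj⟩ := hev.exists
      have h2 := (hyY j n).trans_lt hj
      have h3 := lt_of_mul_lt_mul_right h2 (by positivity)
      have h4 : absK₀ p k (PowerSeries.coeff n y) ≤ absK₀ p k (PowerSeries.coeff n (Y j)) := by
        have h5 := absK₀_add_le p k (PowerSeries.coeff n (y - Y j)) (PowerSeries.coeff n (Y j))
        rw [← map_add, sub_add_cancel] at h5
        exact (le_max_iff.1 h5).resolve_left (not_le.2 h3)
      exact (mul_le_mul_of_nonneg_right h4 (by positivity)).trans
        ((bound _ C' hs0 hs1 hρs hC' j).1 n)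
  have hFy : ofS p k (PowerSeries.X ^ d + (p : 𝔖 p k) * G) = PowerSeries.X ^ d + pG := by
    rw [map_add, map_mul, map_pow, map_natCast, hpG, map_natCast, ofS, PowerSeries.map_X]
  refine ⟨PowerSeries.trunc d (x - (PowerSeries.X ^ d + pG) * y), y, hyO,
    PowerSeries.degree_trunc_lt _ _, ?_⟩
  rw [hFy]
  have h0 : shift d (x - (PowerSeries.X ^ d + pG) * y) = 0 := by
    have : x - (PowerSeries.X ^ d + pG) * y = (x - pG * y) - PowerSeries.X ^ d * y := by ring
    rw [this, shift_sub, shift_X_pow_mul]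
    exact sub_eq_zero.2 hfix
  rw [← sub_eq_iff_eq_add]
  ext n
  rw [Polynomial.coeff_coe, PowerSeries.coeff_trunc]
  split_ifs with hn
  · rfl
  · have := congrArg (PowerSeries.coeff (n - d)) h0
    rwa [coeff_shift, Nat.sub_add_cancel (not_lt.1 hn), map_zero] at this

end Division

/-! ### Polynomials and Eisenstein polynomials -/

section Polynomials

variable {p : ℕ} [Fact p.Prime] {k : Type*} [Field k] [CharP k p] [PerfectRing k p]

theorem coe_mem_Sp (q : (K₀ p k)[X]) : (q : 𝒜 p k) ∈ Sp p k := by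
  have hX : (PowerSeries.X : 𝒜 p k) ∈ Sp p k := by
    have := ofS_mem_Sp (p := p) (k := k) PowerSeries.X
    rwa [ofS, PowerSeries.map_X] at this
  induction q using Polynomial.induction_on' with
  | add a b ha hb => rw [Polynomial.coe_add]; exact add_mem ha hb
  | monomial n c =>
    rw [← Polynomial.C_mul_X_pow_eq_monomial, Polynomial.coe_mul, Polynomial.coe_pow,
      Polynomial.coe_X, Polynomial.coe_C]
    exact mul_mem ((Sp p k).algebraMap_mem c) (pow_mem hX n)

variable (p k) in
/-- The inclusion `K₀[u] ⊂ 𝔖[1/p]`. -/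
def polyToSp : (K₀ p k)[X] →+* Sp p k :=
  (Polynomial.coeToPowerSeries.ringHom).codRestrict (Sp p k) coe_mem_Sp

@[simp] theorem coe_polyToSp (q : (K₀ p k)[X]) : (polyToSp p k q : 𝒜 p k) = q := rfl

variable (p k) in
/-- The inclusion `𝔖[1/p] ⊂ 𝒪`. -/
def SpTo𝒪 : Sp p k →+* 𝒪 p k := (Subalgebra.inclusion (Sp_le_𝒪 p k)).toRingHom

/-- The polynomial `F` is a monic Eisenstein polynomial. -/
structure IsEis (F : (W p k)[X]) : Prop where
  monic : F.Monic
  pos : 0 < F.natDegree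
  eis : F.IsEisensteinAt (Ideal.span {(p : W p k)})

/-- The Frobenius `φ` of `W[u]`. -/
def φPoly (F : (W p k)[X]) : (W p k)[X] :=
  Polynomial.expand (W p k) p (F.map WittVector.frobenius)

theorem coe_φPoly (F : (W p k)[X]) : ((φPoly F : (W p k)[X]) : 𝔖 p k) = φ𝔖 p k F := by
  have hp := (Fact.out : p.Prime).ne_zero
  ext1 n
  change _ = PowerSeries.coeff n (PowerSeries.expand p hp (PowerSeries.map _ (F : 𝔖 p k)))
  rw [PowerSeries.coeff_expand, φPoly, Polynomial.coeff_coe,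
    Polynomial.coeff_expand (Fact.out : p.Prime).pos]
  simp

theorem natDegree_φPoly {F : (W p k)[X]} (hF : F.Monic) :
    (φPoly F).natDegree = p * F.natDegree := by
  rw [φPoly, Polynomial.natDegree_expand, hF.natDegree_map, mul_comm]

theorem IsEis.φPoly {F : (W p k)[X]} (hF : IsEis F) : IsEis (φPoly F) := by
  have hp := (Fact.out : p.Prime)
  have hmonic : (HodgePink.φPoly F).Monic := (hF.monic.map _).expand hp.pos
  refine ⟨hmonic, ?_, ?_⟩
  · rw [natDegree_φPoly hF.monic]
    exact Nat.mul_pos hp.pos hF.pos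
  · have hprime : (Ideal.span {(p : W p k)}) ≠ ⊤ := by
      rw [Ne, Ideal.span_singleton_eq_top]
      exact (WittVector.irreducible p).not_isUnit
    refine ⟨?_, ?_, ?_⟩
    · rw [hmonic.leadingCoeff]
      exact (Ideal.ne_top_iff_one _).1 hprime
    · intro n hn
      rw [natDegree_φPoly hF.monic] at hn
      rw [HodgePink.φPoly, Polynomial.coeff_expand hp.pos]
      split_ifs with h
      · obtain ⟨m, rfl⟩ := h
        have hm := hF.eis.mem (Nat.lt_of_mul_lt_mul_left hn)
        rw [Nat.mul_div_cancel_left _ hp.pos, Polynomial.coeff_map]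
        rw [Ideal.mem_span_singleton] at hm ⊢
        have := map_dvd (WittVector.frobenius : W p k →+* W p k) hm
        rwa [map_natCast] at this
      · exact zero_mem _
    · rw [HodgePink.φPoly, Polynomial.coeff_expand hp.pos, if_pos (dvd_zero p), Nat.zero_div,
        Polynomial.coeff_map]
      have h0 := hF.eis.notMem
      rw [Ideal.span_singleton_pow, Ideal.mem_span_singleton] at h0 ⊢
      intro h
      apply h0
      have := map_dvd (WittVector.frobeniusEquiv p k).symm h
      rw [map_pow, map_natCast] at this
      convert this
      exact ((WittVector.frobeniusEquiv p k).symm_apply_apply _).symm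

theorem IsEis.isDist {F : (W p k)[X]} (hF : IsEis F) : IsDist F.natDegree (F : 𝔖 p k) := by
  have h : ∀ n, ∃ c, PowerSeries.coeff n (F : 𝔖 p k) -
      PowerSeries.coeff n (PowerSeries.X ^ F.natDegree : 𝔖 p k) = (p : W p k) * c := by
    intro n
    rw [Polynomial.coeff_coe, PowerSeries.coeff_X_pow]
    rcases lt_trichotomy n F.natDegree with h | h | h
    · have := hF.eis.mem h
      rw [Ideal.mem_span_singleton] at this
      rwa [if_neg h.ne, sub_zero]
    · subst h
      exact ⟨0, by rw [if_pos rfl, hF.monic.coeff_natDegree, sub_self, mul_zero]⟩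
    · exact ⟨0, by rw [if_neg h.ne', Polynomial.coeff_eq_zero_of_natDegree_lt h, sub_zero,
        mul_zero]⟩
  choose c hc using h
  refine ⟨PowerSeries.mk c, ?_⟩
  rw [← sub_eq_iff_eq_add']
  ext1 n
  rw [map_sub, hc, ← map_natCast PowerSeries.C, PowerSeries.coeff_C_mul, PowerSeries.coeff_mk]

theorem IsEis.irreducible {F : (W p k)[X]} (hF : IsEis F) :
    Irreducible (F.map (algebraMap (W p k) (K₀ p k))) := by
  have hprime : (Ideal.span {(p : W p k)}).IsPrime :=
    (Ideal.span_singleton_prime (WittVector.irreducible p).ne_zero).2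
      (WittVector.irreducible p).prime
  exact (hF.monic.irreducible_iff_irreducible_map_fraction_map).1
    (hF.eis.irreducible hprime hF.monic.isPrimitive hF.pos)

theorem IsEis.isCoprime {F F' : (W p k)[X]} (hF : IsEis F) (hF' : IsEis F')
    (hne : F.natDegree ≠ F'.natDegree) :
    IsCoprime (F.map (algebraMap (W p k) (K₀ p k))) (F'.map (algebraMap (W p k) (K₀ p k))) := by
  rw [hF.irreducible.coprime_iff_not_dvd]
  intro h
  have h2 := Polynomial.natDegree_eq_of_degree_eq (Polynomial.degree_eq_degree_of_associated
    (hF.irreducible.associated_of_dvd hF'.irreducible h))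
  rw [hF.monic.natDegree_map, hF'.monic.natDegree_map] at h2
  exact hne h2

theorem coe_map_algebraMap (F : (W p k)[X]) :
    ((F.map (algebraMap (W p k) (K₀ p k)) : (K₀ p k)[X]) : 𝒜 p k) = ofS p k F := by
  ext n
  simp [ofS]

theorem φPoly_iterate_isEis {F : (W p k)[X]} (hF : IsEis F) (n : ℕ) :
    IsEis (φPoly^[n] F) ∧ (φPoly^[n] F).natDegree = p ^ n * F.natDegree := by
  induction n with
  | zero => exact ⟨hF, by simp⟩
  | succ n ih =>
    rw [Function.iterate_succ_apply']
    exact ⟨ih.1.φPoly, by rw [natDegree_φPoly ih.1.monic, ih.2, pow_succ', mul_assoc]⟩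

theorem coe_φPoly_iterate (F : (W p k)[X]) (n : ℕ) :
    ((φPoly^[n] F : (W p k)[X]) : 𝔖 p k) = (φ𝔖 p k)^[n] (F : 𝔖 p k) := by
  induction n with
  | zero => rfl
  | succ n ih => rw [Function.iterate_succ_apply', Function.iterate_succ_apply', coe_φPoly, ih]

end Polynomials

/-! ### The bound for the order of vanishing of solutions of Frobenius equations -/

section KeyInequality

variable {p : ℕ} [Fact p.Prime] {k : Type*} [Field k] [CharP k p] [PerfectRing k p]
  {E : (W p k)[X]}

theorem absK₀_ev₀_E (hE : IsEis E) : absK₀ p k (ev₀ p k (E𝒜 p k E)) = (p : ℝ)⁻¹ := by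
  have h0 : ev₀ p k (E𝒜 p k E) = algebraMap (W p k) (K₀ p k) (E.coeff 0) := by
    change PowerSeries.constantCoeff (PowerSeries.map _ (E : 𝔖 p k)) = _
    rw [← PowerSeries.coeff_zero_eq_constantCoeff_apply, PowerSeries.coeff_map,
      Polynomial.coeff_coe]
  have h1 := hE.eis.mem hE.pos
  have h2 := hE.eis.notMem
  rw [Ideal.span_singleton_pow, Ideal.mem_span_singleton] at h2
  rw [Ideal.mem_span_singleton] at h1
  obtain ⟨c, hc⟩ := h1
  have hc0 : c ≠ 0 := by
    rintro rfl
    rw [hc, mul_zero] at h2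
    exact h2 (dvd_zero _)
  obtain ⟨m, w, rfl⟩ := WittVector.exists_eq_pow_p_mul' c hc0
  have hm : m = 0 := by
    by_contra hm
    obtain ⟨m, rfl⟩ := Nat.exists_eq_add_one_of_ne_zero hm
    exact h2 ⟨(p : W p k) ^ m * w, by rw [hc]; ring⟩
  subst hm
  rw [h0, hc, map_mul, map_natCast, pow_zero, one_mul, absK₀_mul, absK₀_p, absK₀_unit, mul_one]

theorem ev₀_E_ne_zero (hE : IsEis E) : ev₀ p k (E𝒜 p k E) ≠ 0 := by
  rw [Ne, ← absK₀_eq_zero_iff p k, absK₀_ev₀_E hE]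
  exact inv_ne_zero (p_real_pos p).ne'

theorem absK₀_ev₀_φ𝒜_iterate (n : ℕ) (x : 𝒜 p k) :
    absK₀ p k (ev₀ p k ((φ𝒜 p k)^[n] x)) = absK₀ p k (ev₀ p k x) := by
  induction n with
  | zero => rfl
  | succ n ih => rw [Function.iterate_succ_apply', ev₀_φ𝒜, absK₀_φK₀, ih]

theorem φ𝒜_iterate_E (n : ℕ) :
    (φ𝒜 p k)^[n] (E𝒜 p k E) = ofS p k ((φPoly^[n] E : (W p k)[X]) : 𝔖 p k) := by
  rw [E𝒜, E𝔖, φ𝒜_iterate_ofS, coe_φPoly_iterate]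

variable (E) in
/-- The product `E φ(E) ⋯ φ^{n-1}(E)`. -/
def eN (n : ℕ) : 𝒜 p k := ∏ i ∈ Finset.range n, (φ𝒜 p k)^[i] (E𝒜 p k E)

variable (E) in
/-- The product `E φ(E) ⋯ φ^{n-1}(E)`, as an element of `𝔖`. -/
def eN𝔖 (n : ℕ) : 𝔖 p k := ∏ i ∈ Finset.range n, ((φPoly^[i] E : (W p k)[X]) : 𝔖 p k)

theorem eN_eq (n : ℕ) : eN E n = ofS p k (eN𝔖 E n) := by
  rw [eN, eN𝔖, map_prod]
  exact Finset.prod_congr rfl fun i _ => φ𝒜_iterate_E i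

theorem isDist_eN (hE : IsEis E) (n : ℕ) :
    IsDist (∑ i ∈ Finset.range n, p ^ i * E.natDegree) (eN𝔖 E n) :=
  IsDist.prod _ fun i _ => by
    have h := φPoly_iterate_isEis hE i
    rw [← h.2]
    exact h.1.isDist

theorem absK₀_ev₀_eN (hE : IsEis E) (n : ℕ) :
    absK₀ p k (ev₀ p k (eN E n)) = (p : ℝ)⁻¹ ^ n := by
  rw [eN, map_prod, absK₀_prod]
  simp only [absK₀_ev₀_φ𝒜_iterate, absK₀_ev₀_E hE, Finset.prod_const, Finset.card_range]

/-- The polynomials `φⁱ(E)` are pairwise coprime in `K₀[u]`, being irreducible of distinct degrees: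
divisibility by all of the `φⁱ(E) ^ h` is divisibility by their product. -/
theorem exists_eq_eN_pow_mul (hE : IsEis E) {f : 𝒜 p k} (hf : f ∈ 𝒪 p k) (h n : ℕ)
    (hdiv : ∀ i < n, ∃ y ∈ 𝒪 p k, f = ((φ𝒜 p k)^[i] (E𝒜 p k E)) ^ h * y) :
    ∃ y ∈ 𝒪 p k, f = eN E n ^ h * y := by
  let P : ℕ → (K₀ p k)[X] := fun i => (φPoly^[i] E).map (algebraMap (W p k) (K₀ p k))
  let e : ℕ → 𝒪 p k := fun i => SpTo𝒪 p k (polyToSp p k (P i))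
  have he : ∀ i, (e i : 𝒜 p k) = (φ𝒜 p k)^[i] (E𝒜 p k E) := fun i => by
    rw [φ𝒜_iterate_E, ← coe_map_algebraMap]
    rfl
  have hcop : Pairwise (fun i j => IsCoprime (e i ^ h) (e j ^ h)) := fun i j hij => by
    refine IsCoprime.pow (IsCoprime.map (IsCoprime.map ?_ (polyToSp p k)) (SpTo𝒪 p k))
    have hi := φPoly_iterate_isEis hE i
    have hj := φPoly_iterate_isEis hE j
    refine hi.1.isCoprime hj.1 ?_
    rw [hi.2, hj.2]
    intro heq
    exact hij (Nat.pow_right_injective (Fact.out : p.Prime).two_le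
      (Nat.eq_of_mul_eq_mul_right hE.pos heq))
  have hd : (∏ i ∈ Finset.range n, e i ^ h) ∣ (⟨f, hf⟩ : 𝒪 p k) := by
    refine Finset.prod_dvd_of_coprime (fun i _ j _ hij => hcop hij) fun i hi => ?_
    obtain ⟨y, hy, hfy⟩ := hdiv i (Finset.mem_range.1 hi)
    refine ⟨⟨y, hy⟩, Subtype.ext ?_⟩
    change f = ((e i : 𝒜 p k)) ^ h * y
    rw [he, hfy]
  obtain ⟨y, hy⟩ := hd
  refine ⟨y, y.2, ?_⟩
  have h2 := congrArg (Subtype.val) hy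
  change f = ((∏ i ∈ Finset.range n, e i ^ h : 𝒪 p k) : 𝒜 p k) * y at h2
  rw [h2, Finset.prod_pow, eN, ← Finset.prod_congr rfl fun i _ => he i]
  congr 1
  push_cast
  rfl

/-- The inequality behind weak admissibility. A nonzero vector `f` of functions on the open disc
satisfies equations `aₙ f = p^{-C} Mₙ φⁿ(f)` with `Mₙ` integral and `|aₙ| = p^{-n ν}`. If `E ^ h`
divides `f`, then `h ≤ ν`. Indeed `f` is then divisible by `eₙ ^ h`, where `|eₙ(0)| = p^{-n}`, so
that its Gauss norm of radius `r^{1/pⁿ}` grows at least as `p^{n h}`; the equations show that it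
grows at most as `p^{n ν}`. -/
theorem le_of_E_pow_dvd (hE : IsEis E) {ι : Type*} [Fintype ι] (f : ι → 𝒜 p k)
    (hf : ∀ i, f i ∈ 𝒪 p k) (i₀ : ι) (hi₀ : ev₀ p k (f i₀) ≠ 0) (c : K₀ p k) (hc : c ≠ 0) (ν : ℤ)
    (a : ℕ → K₀ p k) (ha : ∀ n, absK₀ p k (a n) = (p : ℝ) ^ (-(n * ν)))
    (hM : ∀ n : ℕ, 1 ≤ n → ∃ M : ι → ι → 𝔖 p k, ∀ i,
      PowerSeries.C (c * a n) * f i = ∑ j, ofS p k (M i j) * (φ𝒜 p k)^[n] (f j))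
    (h : ℕ) (hdiv : ∀ i, ∃ y ∈ 𝒪 p k, f i = E𝒜 p k E ^ h * y) : (h : ℤ) ≤ ν := by
  have hp := p_real_pos p
  have hca : ∀ n, c * a n ≠ 0 := fun n => mul_ne_zero hc (by
    rw [Ne, ← absK₀_eq_zero_iff p k, ha]
    positivity)
  -- The equations propagate the divisibility by `E ^ h` to the divisibility by `φⁿ(E) ^ h`.
  have hdiv' : ∀ n i, ∃ y ∈ 𝒪 p k, f i = ((φ𝒜 p k)^[n] (E𝒜 p k E)) ^ h * y := by
    intro n i
    rcases Nat.eq_zero_or_pos n with rfl | hn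
    · exact hdiv i
    · obtain ⟨M, hM⟩ := hM n hn
      choose y hy hfy using hdiv
      refine ⟨PowerSeries.C (c * a n)⁻¹ * ∑ j, ofS p k (M i j) * (φ𝒜 p k)^[n] (y j),
        mul_mem ((𝒪 p k).algebraMap_mem _) (sum_mem fun j _ =>
          mul_mem (ofS_mem_𝒪 _) (φ𝒜_iterate_mem_𝒪 (hy j) n)), ?_⟩
      have h1 : ∀ j, (φ𝒜 p k)^[n] (f j) =
          ((φ𝒜 p k)^[n] (E𝒜 p k E)) ^ h * (φ𝒜 p k)^[n] (y j) := fun j => by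
        conv_lhs => rw [hfy j]
        rw [iterate_map_mul, iterate_map_pow]
      have h2 : f i = PowerSeries.C (c * a n)⁻¹ * (PowerSeries.C (c * a n) * f i) := by
        rw [← mul_assoc, ← map_mul, inv_mul_cancel₀ (hca n), map_one, one_mul]
      rw [h2, hM i, mul_left_comm, Finset.mul_sum (a := ((φ𝒜 p k)^[n] (E𝒜 p k E)) ^ h)]
      congr 1
      exact Finset.sum_congr rfl fun j _ => by rw [h1]; ring
  set e := E.natDegree with he
  obtain ⟨r₀, hr0, hr1, hr⟩ := exists_radius p (h * e)
  have hB : ∃ B, ∀ j, GaussLE r₀ B (f j) := by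
    choose B hB using fun j => mem_𝒪_iff.1 (hf j) r₀ hr0 hr1
    refine ⟨∑ j, B j, fun j => (hB j).mono ?_⟩
    exact Finset.single_le_sum (fun i _ => (hB i).nonneg) (Finset.mem_univ j)
  obtain ⟨B, hB⟩ := hB
  have hB0 : 0 ≤ B := (hB i₀).nonneg
  -- The comparison of the two growths, at the level `n`: the radius is `r = r₀ ^ (1 / pⁿ)`, so
  -- that `φⁿ(f)` is bounded by `B` at `r`, while `eₙ ^ h` has degree at most `h e pⁿ` and stays
  -- dominated by its leading term there.
  have main : ∀ n : ℕ, 1 ≤ n → absK₀ p k (ev₀ p k (f i₀)) * (p : ℝ) ^ (n * h) ≤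
      (absK₀ p k c)⁻¹ * B / r₀ ^ (h * e) * (p : ℝ) ^ (n * ν) := by
    intro n hn
    obtain ⟨g, hg, hfg⟩ := exists_eq_eN_pow_mul hE (hf i₀) h n fun i _ => hdiv' i i₀
    obtain ⟨M, hM⟩ := hM n hn
    have hpn : p ^ n ≠ 0 := pow_ne_zero _ (Fact.out : p.Prime).ne_zero
    obtain ⟨r, hrpos, hrlt, hrr⟩ : ∃ r : ℝ, 0 < r ∧ r < 1 ∧ r ^ p ^ n = r₀ := by
      refine ⟨r₀ ^ (((p ^ n : ℕ) : ℝ)⁻¹), Real.rpow_pos_of_pos hr0 _,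
        Real.rpow_lt_one hr0.le hr1 (by positivity), Real.rpow_inv_natCast_pow hr0.le hpn⟩
    have hd : r₀ ^ (h * e) ≤ r ^ (h * ∑ i ∈ Finset.range n, p ^ i * e) := by
      rw [← hrr, ← pow_mul]
      refine pow_le_pow_of_le_one hrpos.le hrlt.le ?_
      rw [← Finset.sum_mul]
      have : ∑ i ∈ Finset.range n, p ^ i ≤ p ^ n :=
        (Nat.geomSum_lt (Fact.out : p.Prime).two_le fun i hi => Finset.mem_range.1 hi).le
      calc _ ≤ h * (p ^ n * e) := by gcongr
        _ = _ := by ring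
    have h1 : GaussLE r B (PowerSeries.C (c * a n) * f i₀) := by
      rw [hM i₀]
      refine GaussLE.sum hrpos.le hB0 _ fun j _ => ?_
      have := (gaussLE_ofS hrpos.le hrlt.le (M i₀ j)).mul hrpos
        (GaussLE.φ𝒜_iterate n (x := f j) (C := B) (by rw [hrr]; exact hB j))
      rwa [one_mul] at this
    have h2 : GaussLE r ((absK₀ p k (c * a n))⁻¹ * B) (f i₀) := by
      have := h1.C_mul (c * a n)⁻¹
      rwa [← mul_assoc, ← map_mul, inv_mul_cancel₀ (hca n), map_one, one_mul, absK₀_inv] at this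
    rw [hfg, eN_eq, ← map_pow] at h2
    obtain ⟨C', hC'⟩ := mem_𝒪_iff.1 hg r hrpos hrlt
    have h3 := GaussLE.of_dist_mul ((isDist_eN hE n).pow h) hrpos hrlt.le (hr.trans_le hd) hC' h2 0
    rw [pow_zero, mul_one, PowerSeries.coeff_zero_eq_constantCoeff_apply] at h3
    have h4 : absK₀ p k (ev₀ p k (f i₀)) * (p : ℝ) ^ (n * h) = absK₀ p k (ev₀ p k g) := by
      rw [hfg, map_mul, map_pow, absK₀_mul, absK₀_pow, absK₀_ev₀_eN hE, inv_pow, inv_pow,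
        ← pow_mul]
      field_simp
    rw [h4]
    refine h3.trans ?_
    rw [absK₀_mul, ha, mul_inv, zpow_neg, inv_inv]
    calc (absK₀ p k c)⁻¹ * (p : ℝ) ^ (n * ν) * B / r ^ (h * ∑ i ∈ Finset.range n, p ^ i * e)
        ≤ (absK₀ p k c)⁻¹ * (p : ℝ) ^ (n * ν) * B / r₀ ^ (h * e) := by
          have := absK₀_nonneg p k c
          gcongr
      _ = _ := by ring
  by_contra hlt
  have hf0 := absK₀_pos p k hi₀
  set K := (absK₀ p k c)⁻¹ * B / r₀ ^ (h * e) with hK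
  have hK0 : 0 ≤ K := by
    have := absK₀_nonneg p k c
    positivity
  obtain ⟨n, hn⟩ := pow_unbounded_of_one_lt (K / absK₀ p k (ev₀ p k (f i₀))) (one_lt_p_real p)
  have h5 : (p : ℝ) ^ n ≤ (p : ℝ) ^ (n + 1) :=
    pow_le_pow_right₀ (one_lt_p_real p).le (Nat.le_succ n)
  have h6 := main (n + 1) (Nat.le_add_left 1 n)
  have h7 : (p : ℝ) ^ (((n + 1 : ℕ) : ℤ) * ν) * (p : ℝ) ^ (n + 1) ≤ (p : ℝ) ^ ((n + 1) * h) := by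
    rw [← zpow_natCast, ← zpow_natCast, ← zpow_add₀ hp.ne']
    refine zpow_le_zpow_right₀ (one_lt_p_real p).le ?_
    have : ν + 1 ≤ h := by omega
    push_cast
    nlinarith
  have h8 : 0 < (p : ℝ) ^ (((n + 1 : ℕ) : ℤ) * ν) := by positivity
  rw [div_lt_iff₀ hf0] at hn
  have h9 : absK₀ p k (ev₀ p k (f i₀)) * (p : ℝ) ^ (n + 1) ≤ K := by
    refine le_of_mul_le_mul_right ?_ h8
    calc _ = absK₀ p k (ev₀ p k (f i₀)) *
          ((p : ℝ) ^ (((n + 1 : ℕ) : ℤ) * ν) * (p : ℝ) ^ (n + 1)) := by ring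
      _ ≤ absK₀ p k (ev₀ p k (f i₀)) * (p : ℝ) ^ ((n + 1) * h) := by gcongr
      _ ≤ _ := h6
  nlinarith

end KeyInequality

/-! ### The `u`-adic topology and growth conditions -/

section Formal

variable {p : ℕ} [Fact p.Prime] {k : Type*} [Field k] [CharP k p] [PerfectRing k p]

theorem eq_zero_of_X_pow_dvd {x : 𝒜 p k}
    (h : ∀ n : ℕ, (PowerSeries.X : 𝒜 p k) ^ (n + 1) ∣ x) : x = 0 := by
  ext n
  rw [map_zero]
  exact PowerSeries.X_pow_dvd_iff.1 (h n) n (Nat.lt_succ_self n)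

theorem X_dvd_iff_ev₀ {x : 𝒜 p k} : (PowerSeries.X : 𝒜 p k) ∣ x ↔ ev₀ p k x = 0 :=
  PowerSeries.X_dvd_iff

/-- The `u`-adic completeness of `𝒜`, with the limit of a sequence read off from the diagonal. -/
theorem X_pow_dvd_diagonal_sub (x : ℕ → 𝒜 p k)
    (h : ∀ n, (PowerSeries.X : 𝒜 p k) ^ (n + 1) ∣ x (n + 1) - x n) (n : ℕ) :
    (PowerSeries.X : 𝒜 p k) ^ (n + 1) ∣
      (PowerSeries.mk fun i => PowerSeries.coeff i (x i)) - x n := by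
  have key : ∀ {i m : ℕ}, i ≤ m → (PowerSeries.X : 𝒜 p k) ^ (i + 1) ∣ x m - x i := by
    intro i m him
    induction m, him using Nat.le_induction with
    | base => simp
    | succ m him ih =>
      rw [← sub_add_sub_cancel]
      exact dvd_add ((pow_dvd_pow _ (by omega)).trans (h m)) ih
  rw [PowerSeries.X_pow_dvd_iff]
  intro i hi
  have h1 := PowerSeries.X_pow_dvd_iff.1 (key (Nat.lt_succ_iff.1 hi)) i (Nat.lt_succ_self i)
  rw [map_sub, PowerSeries.coeff_mk, ← neg_sub, ← map_sub, h1, neg_zero]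

theorem φ𝒜_X : φ𝒜 p k (PowerSeries.X : 𝒜 p k) = (PowerSeries.X : 𝒜 p k) ^ p := by
  change PowerSeries.expand p (Fact.out : p.Prime).ne_zero
    (PowerSeries.map _ PowerSeries.X) = _
  rw [PowerSeries.map_X, PowerSeries.expand_X]

theorem φ𝒜_C (c : K₀ p k) : φ𝒜 p k (PowerSeries.C c) = PowerSeries.C (φK₀ p k c) := by
  change PowerSeries.expand p (Fact.out : p.Prime).ne_zero
    (PowerSeries.map _ (PowerSeries.C c)) = _
  rw [PowerSeries.map_C, PowerSeries.expand_C]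

theorem X_pow_dvd_φ𝒜 {x : 𝒜 p k} {n : ℕ} (h : (PowerSeries.X : 𝒜 p k) ^ n ∣ x) :
    (PowerSeries.X : 𝒜 p k) ^ (p * n) ∣ φ𝒜 p k x := by
  have := map_dvd (φ𝒜 p k) h
  rwa [map_pow, φ𝒜_X, ← pow_mul] at this

theorem X_pow_dvd_φ𝒜_iterate {x : 𝒜 p k} (h : (PowerSeries.X : 𝒜 p k) ∣ x) (n : ℕ) :
    (PowerSeries.X : 𝒜 p k) ^ p ^ n ∣ (φ𝒜 p k)^[n] x := by
  induction n with
  | zero => simpa using h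
  | succ n ih =>
    rw [Function.iterate_succ_apply', pow_succ']
    exact X_pow_dvd_φ𝒜 ih

theorem X_pow_succ_dvd_φ𝒜 {x : 𝒜 p k} {n : ℕ} (h : (PowerSeries.X : 𝒜 p k) ^ (n + 1) ∣ x) :
    (PowerSeries.X : 𝒜 p k) ^ (n + 2) ∣ φ𝒜 p k x := by
  refine (pow_dvd_pow _ ?_).trans (X_pow_dvd_φ𝒜 h)
  nlinarith [(Fact.out : p.Prime).two_le]

theorem X_pow_dvd_φ𝒜_iterate_sub_one {x : 𝒜 p k} (h : ev₀ p k x = 1) (n : ℕ) :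
    (PowerSeries.X : 𝒜 p k) ^ p ^ n ∣ (φ𝒜 p k)^[n] x - 1 := by
  have := X_pow_dvd_φ𝒜_iterate (x := x - 1)
    (X_dvd_iff_ev₀.2 (by rw [map_sub, h, map_one, sub_self])) n
  rwa [iterate_map_sub, iterate_map_one] at this

theorem isUnit_of_ev₀ {x : 𝒜 p k} (h : ev₀ p k x ≠ 0) : IsUnit x :=
  PowerSeries.isUnit_iff_constantCoeff.2 (isUnit_iff_ne_zero.2 h)

/-- A power series lies in `𝒪` as soon as its coefficients have at most polynomial growth, in the
form: up to `u ^ (p ^ n)`, it is the quotient of an integral power series by a constant of absolute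
value at least `D⁻¹ p ^ (-n m)`. -/
theorem mem_𝒪_of_growth {x : 𝒜 p k} (D : ℝ) (m : ℕ)
    (h : ∀ n : ℕ, 1 ≤ n → ∃ (c : K₀ p k) (s : 𝔖 p k), c ≠ 0 ∧
      (absK₀ p k c)⁻¹ ≤ D * (p : ℝ) ^ (n * m) ∧
      (PowerSeries.X : 𝒜 p k) ^ p ^ n ∣ PowerSeries.C c * x - ofS p k s) :
    x ∈ 𝒪 p k := by
  have hp := p_real_pos p
  have hcoeff : ∀ n, 1 ≤ n → ∀ i < p ^ n,
      absK₀ p k (PowerSeries.coeff i x) ≤ D * (p : ℝ) ^ (n * m) := by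
    intro n hn i hi
    obtain ⟨c, s, hc, hcD, hd⟩ := h n hn
    have h1 := PowerSeries.X_pow_dvd_iff.1 hd i hi
    rw [map_sub, sub_eq_zero, PowerSeries.coeff_C_mul] at h1
    have h2 := gaussLE_ofS zero_le_one le_rfl s i
    rw [one_pow, mul_one, ← h1, absK₀_mul, ← le_inv_mul_iff₀ (absK₀_pos p k hc), mul_one] at h2
    exact h2.trans hcD
  have hD : 0 ≤ D := by
    have := (absK₀_nonneg p k _).trans (hcoeff 1 le_rfl 0 (by simp [(Fact.out : p.Prime).pos]))
    exact nonneg_of_mul_nonneg_left this (by positivity)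
  have hpoly : ∀ i : ℕ, absK₀ p k (PowerSeries.coeff i x) ≤
      D * (p : ℝ) ^ m * ((i + 1 : ℕ) : ℝ) ^ m := by
    intro i
    refine (hcoeff (Nat.log p i + 1) (Nat.le_add_left _ _) i
      (Nat.lt_pow_succ_log_self (Fact.out : p.Prime).one_lt i)).trans ?_
    rw [mul_assoc D]
    refine mul_le_mul_of_nonneg_left ?_ hD
    rw [Nat.succ_mul, pow_add, mul_comm, pow_mul]
    refine mul_le_mul_of_nonneg_left (pow_le_pow_left₀ (by positivity) ?_ m) (by positivity)
    rcases Nat.eq_zero_or_pos i with rfl | hi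
    · simp
    · exact_mod_cast (Nat.pow_log_le_self p hi.ne').trans (Nat.le_succ i)
  rw [mem_𝒪_iff]
  intro r h0 h1
  have ht := tendsto_pow_const_mul_const_pow_of_abs_lt_one m (by rwa [abs_of_pos h0] : |r| < 1)
  obtain ⟨B, hB⟩ := ht.bddAbove_range
  refine ⟨D * (p : ℝ) ^ m * B / r, fun i => ?_⟩
  have hBi : ((i + 1 : ℕ) : ℝ) ^ m * r ^ (i + 1) ≤ B := hB ⟨i + 1, rfl⟩
  rw [le_div_iff₀ h0]
  calc _ ≤ D * (p : ℝ) ^ m * ((i + 1 : ℕ) : ℝ) ^ m * r ^ i * r := by gcongr; exact hpoly i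
    _ = D * (p : ℝ) ^ m * (((i + 1 : ℕ) : ℝ) ^ m * r ^ (i + 1)) := by ring
    _ ≤ _ := by gcongr

end Formal

/-! ### The function `λ` -/

section Lambda

variable {p : ℕ} [Fact p.Prime] {k : Type*} [Field k] [CharP k p] [PerfectRing k p]
  {E : (W p k)[X]}

/-- The two properties that characterize `λ`: it has constant term `1`, and
`E(0) λ = E φ(λ)`. -/
theorem lam_spec (hE : IsEis E) : ev₀ p k (lam p k E) = 1 ∧
    PowerSeries.C (ev₀ p k (E𝒜 p k E)) * lam p k E = E𝒜 p k E * φ𝒜 p k (lam p k E) := by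
  set e₁ : 𝒜 p k := PowerSeries.C (ev₀ p k (E𝒜 p k E))⁻¹ * E𝒜 p k E with he₁
  have hE0 := ev₀_E_ne_zero hE
  have he₁0 : ev₀ p k e₁ = 1 := by
    rw [he₁, map_mul, PowerSeries.constantCoeff_C, inv_mul_cancel₀ hE0]
  let P : ℕ → 𝒜 p k := fun n => ∏ i ∈ Finset.range n, (φ𝒜 p k)^[i] e₁
  have hP : ∀ n, P (n + 1) = e₁ * φ𝒜 p k (P n) := fun n => by
    simp only [P]
    rw [Finset.prod_range_succ', map_prod, mul_comm]
    simp only [Function.iterate_succ_apply', Function.iterate_zero, id]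
  have hlim : ∀ n, (PowerSeries.X : 𝒜 p k) ^ (n + 1) ∣ lam p k E - P (n + 1) := by
    refine X_pow_dvd_diagonal_sub (fun n => P (n + 1)) fun n => ?_
    have h1 : P (n + 1 + 1) - P (n + 1) = P (n + 1) * ((φ𝒜 p k)^[n + 1] e₁ - 1) := by
      simp only [P]
      rw [Finset.prod_range_succ _ (n + 1)]
      ring
    change _ ∣ P (n + 1 + 1) - P (n + 1)
    rw [h1]
    refine dvd_mul_of_dvd_right ((pow_dvd_pow _ ?_).trans
      (X_pow_dvd_φ𝒜_iterate_sub_one he₁0 (n + 1))) _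
    exact (Nat.lt_pow_self (Fact.out : p.Prime).one_lt).le
  have h0 : ev₀ p k (lam p k E) = 1 := by
    have h1 := hlim 0
    rw [zero_add, pow_one, X_dvd_iff_ev₀, map_sub, sub_eq_zero] at h1
    rw [h1, hP]
    simp [P, he₁0]
  refine ⟨h0, ?_⟩
  have h1 : lam p k E - e₁ * φ𝒜 p k (lam p k E) = 0 := by
    refine eq_zero_of_X_pow_dvd fun n => ?_
    have h2 : lam p k E - e₁ * φ𝒜 p k (lam p k E) = (lam p k E - P (n + 1 + 1)) -
        e₁ * φ𝒜 p k (lam p k E - P (n + 1)) := by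
      rw [map_sub, hP (n + 1)]
      ring
    rw [h2]
    refine dvd_sub ((pow_dvd_pow _ (by omega)).trans (hlim (n + 1))) (dvd_mul_of_dvd_right ?_ _)
    exact (pow_dvd_pow _ (by omega)).trans (X_pow_succ_dvd_φ𝒜 (hlim n))
  rw [sub_eq_zero] at h1
  conv_lhs => rw [h1, he₁]
  rw [← mul_assoc, ← mul_assoc, ← map_mul, mul_inv_cancel₀ hE0, map_one, one_mul]

theorem eN_succ (n : ℕ) : eN E (n + 1) = eN E n * (φ𝒜 p k)^[n] (E𝒜 p k E) :=
  Finset.prod_range_succ _ _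

theorem ev₀_φ𝒜_iterate (n : ℕ) (x : 𝒜 p k) : (φ𝒜 p k)^[n] (PowerSeries.C (ev₀ p k x)) =
    PowerSeries.C (ev₀ p k ((φ𝒜 p k)^[n] x)) := by
  induction n with
  | zero => rfl
  | succ n ih => rw [Function.iterate_succ_apply', ih, φ𝒜_C, Function.iterate_succ_apply', ev₀_φ𝒜]

theorem lam_iterate (hE : IsEis E) (n : ℕ) : PowerSeries.C (ev₀ p k (eN E n)) * lam p k E =
    eN E n * (φ𝒜 p k)^[n] (lam p k E) := by
  induction n with
  | zero => simp [eN]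
  | succ n ih =>
    have h := congrArg (φ𝒜 p k)^[n] (lam_spec hE).2
    rw [iterate_map_mul, iterate_map_mul, ev₀_φ𝒜_iterate, ← Function.iterate_succ_apply] at h
    rw [eN_succ, map_mul, map_mul, mul_right_comm, ih, mul_assoc, mul_assoc, ← h]
    ring

theorem ev₀_eN_ne_zero (hE : IsEis E) (n : ℕ) : ev₀ p k (eN E n) ≠ 0 := by
  rw [Ne, ← absK₀_eq_zero_iff p k, absK₀_ev₀_eN hE]
  exact pow_ne_zero _ (inv_ne_zero (p_real_pos p).ne')

theorem lam_mem_𝒪 (hE : IsEis E) : lam p k E ∈ 𝒪 p k := by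
  refine mem_𝒪_of_growth 1 1 fun n _ => ⟨ev₀ p k (eN E n), eN𝔖 E n, ev₀_eN_ne_zero hE n, ?_, ?_⟩
  · rw [absK₀_ev₀_eN hE, mul_one, one_mul, inv_pow, inv_inv]
  · rw [lam_iterate hE, eN_eq]
    have h := X_pow_dvd_φ𝒜_iterate_sub_one (lam_spec hE).1 n
    have h2 : ofS p k (eN𝔖 E n) * (φ𝒜 p k)^[n] (lam p k E) - ofS p k (eN𝔖 E n) =
        ofS p k (eN𝔖 E n) * ((φ𝒜 p k)^[n] (lam p k E) - 1) := by ring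
    rw [h2]
    exact dvd_mul_of_dvd_right h _

/-- The function `φ(λ)` does not vanish at the zeros of `E`. Otherwise `E ^ 2` divides `λ`, against
the general inequality, applied to `λ` itself. -/
theorem not_E_dvd_φ_lam (hE : IsEis E) :
    ¬ ∃ y ∈ 𝒪 p k, φ𝒜 p k (lam p k E) = E𝒜 p k E * y := by
  rintro ⟨y, hy, hφ⟩
  have hl := lam_spec hE
  have h := le_of_E_pow_dvd hE (fun _ : Unit => lam p k E) (fun _ => lam_mem_𝒪 hE) ()
    (by rw [hl.1]; exact one_ne_zero) 1 one_ne_zero 1 (fun n => ev₀ p k (eN E n))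
    (fun n => by rw [absK₀_ev₀_eN hE, mul_one, zpow_neg, zpow_natCast, inv_pow])
    (fun n _ => ⟨fun _ _ => eN𝔖 E n, fun _ => by
      rw [one_mul, lam_iterate hE, eN_eq]; simp⟩) 2
    (fun _ => ⟨PowerSeries.C (ev₀ p k (E𝒜 p k E))⁻¹ * y,
      mul_mem ((𝒪 p k).algebraMap_mem _) hy, by
        have h1 : lam p k E = PowerSeries.C (ev₀ p k (E𝒜 p k E))⁻¹ *
            (PowerSeries.C (ev₀ p k (E𝒜 p k E)) * lam p k E) := by
          rw [← mul_assoc, ← map_mul, inv_mul_cancel₀ (ev₀_E_ne_zero hE), map_one, one_mul]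
        rw [h1, hl.2, hφ]
        ring⟩)
  norm_num at h

end Lambda

/-! ### Completions at a principal maximal ideal -/

section PrincipalCompletion

/-- The completion of `R` with respect to the principal ideal `(a)`. -/
abbrev PCompl {R : Type*} [CommRing R] (a : R) : Type _ := AdicCompletion (Ideal.span {a}) R

variable {R : Type*} [CommRing R] [IsDomain R] {a : R}

theorem span_singleton_FG (a : R) : (Ideal.span {a}).FG := ⟨{a}, by simp⟩

theorem map_span_completion :
    (Ideal.span {a}).map (algebraMap R (PCompl a)) = Ideal.span {algebraMap R (PCompl a) a} := by
  rw [Ideal.map_span, Set.image_singleton]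

theorem isMaximal_span_completion (ha : (Ideal.span {a}).IsMaximal) :
    (Ideal.span {algebraMap R (PCompl a) a}).IsMaximal := by
  rw [← map_span_completion]
  exact AdicCompletion.isMaximal_map_of_le _ _ le_rfl (span_singleton_FG a)

theorem isAdicComplete_completion :
    IsAdicComplete (Ideal.span {algebraMap R (PCompl a) a}) (PCompl a) := by
  rw [← map_span_completion]
  exact AdicCompletion.isAdicComplete_self _ (span_singleton_FG a)

theorem isUnit_completion_iff (ha : (Ideal.span {a}).IsMaximal) {x : PCompl a} :
    IsUnit x ↔ ¬ (algebraMap R (PCompl a) a) ∣ x := by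
  have h1 := isMaximal_span_completion ha
  have h2 := isAdicComplete_completion (a := a)
  have h3 : IsLocalRing (PCompl a) :=
    isLocalRing_of_isAdicComplete_maximal (Ideal.span {algebraMap R (PCompl a) a})
  rw [← Ideal.mem_span_singleton, IsLocalRing.eq_maximalIdeal h1, IsLocalRing.mem_maximalIdeal,
    mem_nonunits_iff, not_not]

theorem completion_eq_zero {x : PCompl a} (h : ∀ n, (algebraMap R (PCompl a) a) ^ n ∣ x) :
    x = 0 := by
  have h2 := isAdicComplete_completion (a := a)
  refine IsHausdorff.haus (I := Ideal.span {algebraMap R (PCompl a) a}) h2.toIsHausdorff x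
    fun n => ?_
  rw [SModEq.zero, smul_eq_mul, Ideal.mul_top, Ideal.span_singleton_pow, Ideal.mem_span_singleton]
  exact h n

theorem evalₐ_algebraMap (n : ℕ) (x : R) :
    AdicCompletion.evalₐ (Ideal.span {a}) n (algebraMap R (PCompl a) x) =
      Ideal.Quotient.mk _ x := AlgHom.commutes _ x

theorem mk_eq_zero_iff_pow_dvd {n : ℕ} {x : R} :
    Ideal.Quotient.mk (Ideal.span {a} ^ n) x = 0 ↔ a ^ n ∣ x := by
  rw [Ideal.Quotient.eq_zero_iff_mem, Ideal.span_singleton_pow, Ideal.mem_span_singleton]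

theorem completion_mul_eq_zero (ha0 : a ≠ 0) {x : PCompl a}
    (h : algebraMap R (PCompl a) a * x = 0) : x = 0 := by
  refine AdicCompletion.ext_evalₐ fun n => ?_
  obtain ⟨z, rfl⟩ := AdicCompletion.mk_surjective _ _ x
  have h1 := congrArg (AdicCompletion.evalₐ (Ideal.span {a}) (n + 1)) h
  rw [map_mul, map_zero, evalₐ_algebraMap, AdicCompletion.evalₐ_mk, ← map_mul,
    mk_eq_zero_iff_pow_dvd, pow_succ', mul_dvd_mul_iff_left ha0] at h1
  rw [map_zero, AdicCompletion.evalₐ_mk,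
    ← AdicCompletion.Ideal.mk_eq_mk _ (Nat.le_succ n) z]
  exact mk_eq_zero_iff_pow_dvd.2 h1

theorem exists_eq_pow_mul_completion (ha : (Ideal.span {a}).IsMaximal) {x : PCompl a} (hx : x ≠ 0) :
    ∃ (n : ℕ) (w : (PCompl a)ˣ), x = (algebraMap R (PCompl a) a) ^ n * w := by
  classical
  have h : ∃ n, ¬ (algebraMap R (PCompl a) a) ^ n ∣ x := by
    by_contra! h
    exact hx (completion_eq_zero h)
  have hn0 : Nat.find h ≠ 0 := fun h0 => by
    have := Nat.find_spec h
    rw [h0, pow_zero] at this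
    exact this (one_dvd _)
  obtain ⟨n, hn⟩ := Nat.exists_eq_add_one_of_ne_zero hn0
  have h1 : (algebraMap R (PCompl a) a) ^ n ∣ x := by
    by_contra h1
    exact Nat.find_min h (by omega) h1
  obtain ⟨y, rfl⟩ := h1
  have hy : IsUnit y := (isUnit_completion_iff ha).2 fun hy => by
    have := Nat.find_spec h
    rw [hn, pow_succ] at this
    exact this (mul_dvd_mul_left _ hy)
  exact ⟨n, hy.unit, by simp⟩

theorem nontrivial_completion (ha : (Ideal.span {a}).IsMaximal) : Nontrivial (PCompl a) :=
  ⟨0, 1, fun h => (isMaximal_span_completion ha).ne_top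
    ((Ideal.eq_top_iff_one _).2 (h ▸ zero_mem _))⟩

theorem completion_pow_ne_zero (ha : (Ideal.span {a}).IsMaximal) (ha0 : a ≠ 0) (n : ℕ) :
    (algebraMap R (PCompl a) a) ^ n ≠ 0 := by
  have := nontrivial_completion ha
  induction n with
  | zero => simp
  | succ n ih =>
    rw [pow_succ']
    exact fun h => ih (completion_mul_eq_zero ha0 h)

theorem isDomain_completion (ha : (Ideal.span {a}).IsMaximal) (ha0 : a ≠ 0) :
    IsDomain (PCompl a) := by
  have := nontrivial_completion ha
  have : NoZeroDivisors (PCompl a) := ⟨fun {x y} hxy => by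
    by_contra! h
    obtain ⟨n, w, hw⟩ := exists_eq_pow_mul_completion ha h.1
    obtain ⟨m, v, hv⟩ := exists_eq_pow_mul_completion ha h.2
    refine completion_pow_ne_zero ha ha0 (n + m) ?_
    have h1 : (algebraMap R (PCompl a) a) ^ (n + m) * ((w * v : (PCompl a)ˣ) : (PCompl a)) = 0 := by
      rw [← hxy, hw, hv]
      push_cast
      ring
    rwa [Units.mul_left_eq_zero] at h1⟩
  exact NoZeroDivisors.to_isDomain _

/-- The completion of a domain at a principal maximal ideal `(a)`, with `a ≠ 0`, is a discrete
valuation ring with uniformizer `a`. -/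
theorem isDVR_completion [IsDomain (PCompl a)] (ha : (Ideal.span {a}).IsMaximal) (ha0 : a ≠ 0) :
    IsDiscreteValuationRing (PCompl a) := by
  have hne : (algebraMap R (PCompl a) a) ≠ 0 := by simpa using completion_pow_ne_zero ha ha0 1
  refine IsDiscreteValuationRing.ofHasUnitMulPowIrreducibleFactorization
    ⟨(algebraMap R (PCompl a) a), ?_, fun {x} hx => ?_⟩
  · exact ((Ideal.span_singleton_prime hne).1 (isMaximal_span_completion ha).isPrime).irreducible
  · obtain ⟨n, w, h⟩ := exists_eq_pow_mul_completion ha hx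
    exact ⟨n, w, h.symm⟩

variable {L : Type*} [CommRing L] [Algebra (PCompl a) L]
  [IsLocalization.Away (algebraMap R (PCompl a) a) L]

theorem isFractionRing_completion (ha : (Ideal.span {a}).IsMaximal) (ha0 : a ≠ 0) :
    IsFractionRing (PCompl a) L := by
  have := isDomain_completion ha ha0
  refine IsLocalization.of_le_of_exists_dvd (Submonoid.powers (algebraMap R (PCompl a) a)) _ ?_ ?_
  · rintro _ ⟨n, rfl⟩
    exact mem_nonZeroDivisors_of_ne_zero (completion_pow_ne_zero ha ha0 n)
  · intro x hx
    obtain ⟨n, w, rfl⟩ := exists_eq_pow_mul_completion ha (nonZeroDivisors.ne_zero hx)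
    exact ⟨_, ⟨n, rfl⟩, (Units.mul_right_dvd).2 dvd_rfl⟩

theorem exists_eq_zpow_mul_completion (ha : (Ideal.span {a}).IsMaximal) (π : Lˣ)
    (hπ : (π : L) = algebraMap (PCompl a) L (algebraMap R (PCompl a) a)) {x : L} (hx : x ≠ 0) :
    ∃ (n : ℤ) (w : (PCompl a)ˣ), x = ((π ^ n : Lˣ) : L) * algebraMap (PCompl a) L w := by
  obtain ⟨m, b, hb⟩ := IsLocalization.Away.surj (algebraMap R (PCompl a) a) x
  have hm : algebraMap (PCompl a) L (algebraMap R (PCompl a) a) ^ m = ((π ^ m : Lˣ) : L) := by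
    rw [Units.val_pow_eq_pow_val, hπ]
  rw [hm] at hb
  have hb0 : b ≠ 0 := by
    rintro rfl
    rw [map_zero, Units.mul_left_eq_zero] at hb
    exact hx hb
  obtain ⟨n, w, rfl⟩ := exists_eq_pow_mul_completion ha hb0
  refine ⟨n - m, w, ?_⟩
  rw [zpow_sub, zpow_natCast, zpow_natCast, Units.val_mul, mul_right_comm,
    Units.eq_mul_inv_iff_mul_eq, hb, map_mul, map_pow, Units.val_pow_eq_pow_val, hπ]

end PrincipalCompletion

/-! ### Morphisms that are isomorphisms modulo the powers of an element -/

section ComparisonOfCompletions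

variable {R S : Type*} [CommRing R] [CommRing S] (i : R →+* S) (a : R)

/-- The morphism `R / aⁿ → S / aⁿ` induced by `i : R → S`. -/
def quotPowMap (n : ℕ) : R ⧸ Ideal.span {a} ^ n →+* S ⧸ Ideal.span {i a ^ n} :=
  Ideal.quotientMap _ i (by
    rw [Ideal.span_singleton_pow, Ideal.span_le, Set.singleton_subset_iff, SetLike.mem_coe,
      Ideal.mem_comap, map_pow]
    exact Ideal.mem_span_singleton_self _)

theorem quotPowMap_mk (n : ℕ) (x : R) :
    quotPowMap i a n (Ideal.Quotient.mk _ x) = Ideal.Quotient.mk _ (i x) :=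
  Ideal.quotientMap_mk

/-- The morphism `i : R → S` induces isomorphisms `R / aⁿ → S / aⁿ`, for all `n`. -/
structure IsPowIso : Prop where
  inj : ∀ n x, i a ^ n ∣ i x → a ^ n ∣ x
  surj : ∀ n y, ∃ x, i a ^ n ∣ y - i x

variable {i a}

theorem IsPowIso.bijective (h : IsPowIso i a) (n : ℕ) : Function.Bijective (quotPowMap i a n) := by
  constructor
  · rw [injective_iff_map_eq_zero]
    intro x hx
    obtain ⟨x, rfl⟩ := Ideal.Quotient.mk_surjective x
    rw [quotPowMap_mk, Ideal.Quotient.eq_zero_iff_mem, Ideal.mem_span_singleton] at hx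
    rw [Ideal.Quotient.eq_zero_iff_mem, Ideal.span_singleton_pow, Ideal.mem_span_singleton]
    exact h.inj n x hx
  · intro x
    obtain ⟨x, rfl⟩ := Ideal.Quotient.mk_surjective x
    obtain ⟨q, hq⟩ := h.surj n x
    refine ⟨Ideal.Quotient.mk _ q, ?_⟩
    rw [quotPowMap_mk, eq_comm, Ideal.Quotient.eq, Ideal.mem_span_singleton]
    exact hq

/-- The projection `S → S / aⁿ = R / aⁿ`. -/
def IsPowIso.proj (h : IsPowIso i a) (n : ℕ) : S →+* R ⧸ Ideal.span {a} ^ n :=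
  (RingEquiv.ofBijective _ (h.bijective n)).symm.toRingHom.comp (Ideal.Quotient.mk _)

theorem IsPowIso.proj_eq_iff (h : IsPowIso i a) {n : ℕ} {y : S} {x : R} :
    h.proj n y = Ideal.Quotient.mk _ x ↔ i a ^ n ∣ y - i x := by
  change (RingEquiv.ofBijective _ (h.bijective n)).symm (Ideal.Quotient.mk _ y) = _ ↔ _
  rw [RingEquiv.symm_apply_eq, RingEquiv.ofBijective_apply, quotPowMap_mk, Ideal.Quotient.eq,
    Ideal.mem_span_singleton]

theorem IsPowIso.factorPow_comp_proj (h : IsPowIso i a) {m n : ℕ} (hmn : m ≤ n) :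
    (Ideal.Quotient.factorPow (Ideal.span {a}) hmn).comp (h.proj n) = h.proj m := by
  ext x
  obtain ⟨q, hq⟩ := Ideal.Quotient.mk_surjective (h.proj n x)
  rw [RingHom.comp_apply, ← hq]
  symm
  exact h.proj_eq_iff.2 ((pow_dvd_pow _ hmn).trans (h.proj_eq_iff.1 hq.symm))

/-- The morphism from `S` to the `a`-adic completion of `R`. -/
def IsPowIso.toCompletion (h : IsPowIso i a) : S →+* PCompl a :=
  AdicCompletion.liftRingHom _ h.proj h.factorPow_comp_proj

theorem IsPowIso.evalₐ_toCompletion (h : IsPowIso i a) (n : ℕ) (y : S) :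
    AdicCompletion.evalₐ (Ideal.span {a}) n (h.toCompletion y) = h.proj n y :=
  AdicCompletion.evalₐ_liftRingHom _ h.proj h.factorPow_comp_proj n y

theorem IsPowIso.toCompletion_apply (h : IsPowIso i a) (x : R) :
    h.toCompletion (i x) = algebraMap R _ x := by
  refine AdicCompletion.ext_evalₐ fun n => ?_
  rw [h.evalₐ_toCompletion]
  refine (h.proj_eq_iff.2 ?_).trans (AlgHom.commutes _ x).symm
  rw [sub_self]
  exact dvd_zero _

theorem IsPowIso.pow_dvd_toCompletion_iff (h : IsPowIso i a) {n : ℕ} {y : S} :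
    algebraMap R (PCompl a) a ^ n ∣ h.toCompletion y ↔ i a ^ n ∣ y := by
  constructor
  · rintro ⟨z, hz⟩
    have h1 := congrArg (AdicCompletion.evalₐ (Ideal.span {a}) n) hz
    have h0 : AdicCompletion.evalₐ (Ideal.span {a}) n
        (algebraMap R (PCompl a) (a ^ n)) = 0 := by
      refine (AlgHom.commutes _ _).trans ?_
      change Ideal.Quotient.mk _ (a ^ n) = 0
      rw [Ideal.Quotient.eq_zero_iff_mem, Ideal.span_singleton_pow]
      exact Ideal.mem_span_singleton_self _
    rw [h.evalₐ_toCompletion, map_mul, ← map_pow, h0, zero_mul,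
      ← map_zero (Ideal.Quotient.mk _), h.proj_eq_iff, map_zero, sub_zero] at h1
    exact h1
  · intro h1
    have := map_dvd h.toCompletion h1
    rwa [map_pow, h.toCompletion_apply] at this

/-- A morphism from `S` to the `a`-adic completion of `R` is determined by its values on `R`. -/
theorem IsPowIso.eq_toCompletion (h : IsPowIso i a) [IsDomain R] {L : Type*} [CommRing L]
    {β : PCompl a →+* L} (hβ : Function.Injective β) (f : S →+* L)
    (hR : ∀ x, f (i x) = β (algebraMap R (PCompl a) x)) (hS : ∀ y, f y ∈ β.range) (y : S) :
    f y = β (h.toCompletion y) := by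
  choose z hz using hS
  rw [← hz y]
  congr 1
  rw [← sub_eq_zero]
  refine completion_eq_zero fun n => ?_
  obtain ⟨x, t, hx⟩ := h.surj n y
  rw [sub_eq_iff_eq_add'] at hx
  have hzy : z y = algebraMap R (PCompl a) x + algebraMap R (PCompl a) a ^ n * z t := by
    refine hβ ?_
    rw [hz, hx, map_add, map_mul, map_pow, hR, hR, map_add, map_mul, map_pow, hz]
  refine ⟨z t - h.toCompletion t, ?_⟩
  rw [hzy]
  conv_lhs => rw [hx]
  rw [map_add, map_mul, map_pow, h.toCompletion_apply, h.toCompletion_apply]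
  ring

end ComparisonOfCompletions

/-! ### The completion of `𝔖[1/p]` at `E` and its relation to `𝒪` -/

section Completion

variable {p : ℕ} [Fact p.Prime] {k : Type*} [Field k] [CharP k p] [PerfectRing k p]
  {E : (W p k)[X]}

variable (p k E) in
/-- `E`, as an element of `𝒪`. -/
def E𝒪 : 𝒪 p k := SpTo𝒪 p k (ESp p k E)

theorem ESp_eq : ESp p k E = polyToSp p k (E.map (algebraMap (W p k) (K₀ p k))) :=
  Subtype.ext (by rw [coe_polyToSp, coe_map_algebraMap]; rfl)

theorem ESp_ne_zero (hE : IsEis E) : ESp p k E ≠ 0 := fun h => ev₀_E_ne_zero hE (by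
  have : E𝒜 p k E = 0 := congrArg Subtype.val h
  rw [this, map_zero])

theorem E𝒪_pow_dvd_iff {n : ℕ} {x : 𝒪 p k} :
    E𝒪 p k E ^ n ∣ x ↔ ∃ y ∈ 𝒪 p k, (x : 𝒜 p k) = E𝒜 p k E ^ n * y := by
  constructor
  · rintro ⟨y, rfl⟩
    exact ⟨y, y.2, rfl⟩
  · rintro ⟨y, hy, h⟩
    exact ⟨⟨y, hy⟩, Subtype.ext h⟩

/-- Modulo `E ^ n`, every element of `𝒪` is a polynomial. -/
theorem exists_eq_add_E𝒪_pow_mul (hE : IsEis E) (x : 𝒪 p k) (n : ℕ) :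
    ∃ (q : (K₀ p k)[X]) (y : 𝒪 p k), q.degree < (n * E.natDegree : ℕ) ∧
      x = SpTo𝒪 p k (polyToSp p k q) + E𝒪 p k E ^ n * y := by
  obtain ⟨q, y, hy, hq, h⟩ := exists_division (hE.isDist.pow n) x.2
  refine ⟨q, ⟨y, hy⟩, hq, Subtype.ext ?_⟩
  rw [h, map_pow]
  rfl

theorem ESp_pow_dvd_of_E𝒪_pow_dvd (hE : IsEis E) {x : Sp p k} {n : ℕ}
    (h : E𝒪 p k E ^ n ∣ SpTo𝒪 p k x) : ESp p k E ^ n ∣ x := by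
  obtain ⟨y, hy, hxy⟩ := E𝒪_pow_dvd_iff.1 h
  have hxy : (x : 𝒜 p k) = E𝒜 p k E ^ n * y := hxy
  have hy' : y ∈ Sp p k := mem_Sp_of_dist_mul (hE.isDist.pow n) hy (by
    rw [map_pow]
    exact hxy ▸ x.2)
  exact ⟨⟨y, hy'⟩, Subtype.ext hxy⟩

/-- The inclusion of `𝔖[1/p]` in `𝒪` is an isomorphism modulo all the powers of `E`. -/
theorem isPowIso_SpTo𝒪 (hE : IsEis E) : IsPowIso (SpTo𝒪 p k) (ESp p k E) where
  inj _ _ h := ESp_pow_dvd_of_E𝒪_pow_dvd hE h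
  surj n x := by
    obtain ⟨q, y, -, hxy⟩ := exists_eq_add_E𝒪_pow_mul hE x n
    refine ⟨polyToSp p k q, y, ?_⟩
    rw [sub_eq_iff_eq_add']
    exact hxy

/-- As `φ(λ)` is not divisible by `E` in `𝒪`, the element `E` is not a unit. -/
theorem not_isUnit_ESp (hE : IsEis E) : ¬ IsUnit (ESp p k E) := by
  intro h
  have h1 : E𝒪 p k E ∣ ⟨φ𝒜 p k (lam p k E), φ𝒜_mem_𝒪 (lam_mem_𝒪 hE)⟩ :=
    (h.map (SpTo𝒪 p k)).dvd
  rw [← pow_one (E𝒪 p k E)] at h1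
  obtain ⟨y, hy, h2⟩ := E𝒪_pow_dvd_iff.1 h1
  exact not_E_dvd_φ_lam hE ⟨y, hy, by rw [pow_one] at h2; exact h2⟩

/-- The quotient of `𝔖[1/p]` by `E` is the field `K₀[u] / E`. -/
theorem isMaximal_span_ESp (hE : IsEis E) : (Ideal.span {ESp p k E}).IsMaximal := by
  rw [Ideal.isMaximal_iff]
  refine ⟨?_, fun J x hJ hx hxJ => ?_⟩
  · rw [← Ideal.ne_top_iff_one, Ne, Ideal.span_singleton_eq_top]
    exact not_isUnit_ESp hE
  obtain ⟨q, y, hq, hxy⟩ := exists_eq_add_E𝒪_pow_mul hE (SpTo𝒪 p k x) 1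
  have hdvd : ESp p k E ∣ x - polyToSp p k q := by
    rw [← pow_one (ESp p k E)]
    refine ESp_pow_dvd_of_E𝒪_pow_dvd hE ⟨y, ?_⟩
    rw [map_sub, hxy, add_sub_cancel_left]
  have hEJ : ESp p k E ∈ J := hJ (Ideal.mem_span_singleton_self _)
  have hqJ : polyToSp p k q ∈ J := by
    have := J.sub_mem hxJ (J.mem_of_dvd hdvd hEJ)
    rwa [sub_sub_cancel] at this
  have hq0 : q ≠ 0 := by
    rintro rfl
    rw [map_zero, sub_zero] at hdvd
    exact hx (Ideal.mem_span_singleton.2 hdvd)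
  have hcop : IsCoprime (E.map (algebraMap (W p k) (K₀ p k))) q := by
    rw [hE.irreducible.coprime_iff_not_dvd]
    intro h
    have h1 := Polynomial.natDegree_le_of_dvd h hq0
    rw [hE.monic.natDegree_map] at h1
    rw [one_mul, Polynomial.degree_eq_natDegree hq0, Nat.cast_lt] at hq
    omega
  obtain ⟨a, b, hab⟩ := hcop.map (polyToSp p k)
  rw [← hab, ← ESp_eq]
  exact J.add_mem (J.mul_mem_left _ hEJ) (J.mul_mem_left _ hqJ)

variable (p k E) in
/-- `E`, as an element of `\widehat 𝔖`. -/
def EShat : Shat p k E := algebraMap (Sp p k) (Shat p k E) (ESp p k E)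

theorem isUnit_Shat_iff (hE : IsEis E) {x : Shat p k E} : IsUnit x ↔ ¬ EShat p k E ∣ x :=
  @isUnit_completion_iff (Sp p k) _ _ (ESp p k E) (isMaximal_span_ESp hE) x

theorem isDomain_Shat (hE : IsEis E) : IsDomain (Shat p k E) :=
  @isDomain_completion (Sp p k) _ _ (ESp p k E) (isMaximal_span_ESp hE) (ESp_ne_zero hE)

theorem isPrincipalIdealRing_Shat (hE : IsEis E) : IsPrincipalIdealRing (Shat p k E) := by
  have := isDomain_Shat hE
  have := @isDVR_completion (Sp p k) _ _ (ESp p k E) _ (isMaximal_span_ESp hE) (ESp_ne_zero hE)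
  exact IsDiscreteValuationRing.toIsPrincipalIdealRing

theorem isFractionRing_ShatE (hE : IsEis E) : IsFractionRing (Shat p k E) (ShatE p k E) :=
  @isFractionRing_completion (Sp p k) _ _ (ESp p k E) (ShatE p k E) _ _ _ (isMaximal_span_ESp hE)
    (ESp_ne_zero hE)

theorem algebraMap_ShatE_injective (hE : IsEis E) :
    Function.Injective (algebraMap (Shat p k E) (ShatE p k E)) := by
  have := isFractionRing_ShatE hE
  exact IsFractionRing.injective _ _

theorem coe_EShatE : (EShatE p k E : ShatE p k E) =
    algebraMap (Shat p k E) (ShatE p k E) (EShat p k E) := rfl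

/-- Every nonzero element of `\widehat 𝔖[1/E]` is a power of `E` times a unit of
`\widehat 𝔖`. -/
theorem exists_eq_EShatE_zpow_mul (hE : IsEis E) {x : ShatE p k E} (hx : x ≠ 0) :
    ∃ (n : ℤ) (w : (Shat p k E)ˣ), x = ((EShatE p k E ^ n : (ShatE p k E)ˣ) : ShatE p k E) *
      algebraMap (Shat p k E) (ShatE p k E) w :=
  @exists_eq_zpow_mul_completion (Sp p k) _ _ (ESp p k E) (ShatE p k E) _ _ _
    (isMaximal_span_ESp hE) (EShatE p k E) coe_EShatE x hx

end Completion

/-! ### The canonical morphism -/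

section Canonical

variable {p : ℕ} [Fact p.Prime] {k : Type*} [Field k] [CharP k p] [PerfectRing k p]
  {E : (W p k)[X]}

/-- The canonical morphism `𝒪 → \widehat 𝔖`. -/
def 𝒪ToShat (hE : IsEis E) : 𝒪 p k →+* Shat p k E := (isPowIso_SpTo𝒪 hE).toCompletion

theorem 𝒪ToShat_SpTo𝒪 (hE : IsEis E) (x : Sp p k) :
    𝒪ToShat hE (SpTo𝒪 p k x) = algebraMap (Sp p k) (Shat p k E) x :=
  (isPowIso_SpTo𝒪 hE).toCompletion_apply x

theorem 𝒪ToShat_E𝒪 (hE : IsEis E) : 𝒪ToShat hE (E𝒪 p k E) = EShat p k E := 𝒪ToShat_SpTo𝒪 hE _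

theorem EShat_pow_dvd_𝒪ToShat_iff (hE : IsEis E) {n : ℕ} {x : 𝒪 p k} :
    EShat p k E ^ n ∣ 𝒪ToShat hE x ↔ E𝒪 p k E ^ n ∣ x :=
  (isPowIso_SpTo𝒪 hE).pow_dvd_toCompletion_iff

variable (p k E) in
/-- The function `λ`, as an element of `𝒪`. -/
def lam𝒪 (hE : IsEis E) : 𝒪 p k := ⟨lam p k E, lam_mem_𝒪 hE⟩

/-- In `\widehat 𝔖`, the function `λ` is `E` times a unit. -/
theorem exists_𝒪ToShat_lam (hE : IsEis E) :
    ∃ w : (Shat p k E)ˣ, 𝒪ToShat hE (lam𝒪 p k E hE) = EShat p k E * w := by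
  have hE0 := ev₀_E_ne_zero hE
  have h1 : IsUnit (𝒪ToShat hE ⟨φ𝒜 p k (lam p k E), φ𝒜_mem_𝒪 (lam_mem_𝒪 hE)⟩) := by
    rw [isUnit_Shat_iff hE, ← pow_one (EShat p k E), EShat_pow_dvd_𝒪ToShat_iff, E𝒪_pow_dvd_iff,
      pow_one]
    exact not_E_dvd_φ_lam hE
  have h2 : IsUnit (𝒪ToShat hE (algebraMap (K₀ p k) (𝒪 p k) (ev₀ p k (E𝒜 p k E))⁻¹)) :=
    ((isUnit_iff_ne_zero.2 (inv_ne_zero hE0)).map (algebraMap (K₀ p k) (𝒪 p k))).map _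
  refine ⟨h1.unit * h2.unit, ?_⟩
  rw [Units.val_mul, IsUnit.unit_spec, IsUnit.unit_spec, ← 𝒪ToShat_E𝒪 hE, ← map_mul, ← map_mul]
  congr 1
  refine Subtype.ext ?_
  change lam p k E = E𝒜 p k E * (φ𝒜 p k (lam p k E) * PowerSeries.C (ev₀ p k (E𝒜 p k E))⁻¹)
  rw [← mul_assoc, ← (lam_spec hE).2, mul_right_comm, ← map_mul, mul_inv_cancel₀ hE0, map_one,
    one_mul]

theorem lam_mul_inv (hE : IsEis E) : lam p k E * (lam p k E)⁻¹ = 1 :=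
  PowerSeries.mul_inv_cancel _ (by
    have := (lam_spec hE).1
    rw [this]
    exact one_ne_zero)

theorem lam_inv_mem : (lam p k E)⁻¹ ∈ 𝒪lam p k E :=
  (le_sup_right : _ ≤ 𝒪lam p k E) (Algebra.self_mem_adjoin_singleton _ _)

theorem exists_lam_pow_mul_mem (hE : IsEis E) {x : 𝒜 p k} (hx : x ∈ 𝒪lam p k E) :
    ∃ n : ℕ, lam p k E ^ n * x ∈ 𝒪 p k := by
  have hl := lam_mem_𝒪 hE
  let S : Subalgebra (K₀ p k) (𝒜 p k) :=
    { carrier := {x | ∃ n : ℕ, lam p k E ^ n * x ∈ 𝒪 p k}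
      mul_mem' := by
        rintro x y ⟨n, hn⟩ ⟨m, hm⟩
        refine ⟨n + m, ?_⟩
        have := mul_mem hn hm
        rwa [mul_mul_mul_comm, ← pow_add] at this
      add_mem' := by
        rintro x y ⟨n, hn⟩ ⟨m, hm⟩
        refine ⟨n + m, ?_⟩
        have := add_mem (mul_mem (pow_mem hl m) hn) (mul_mem (pow_mem hl n) hm)
        rwa [← mul_assoc, ← mul_assoc, ← pow_add, ← pow_add, add_comm m n, ← mul_add] at this
      algebraMap_mem' := fun c => ⟨0, by
        rw [pow_zero, one_mul]
        exact (𝒪 p k).algebraMap_mem c⟩ }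
  have hS : 𝒪lam p k E ≤ S := by
    refine sup_le (fun x hx => ⟨0, by rwa [pow_zero, one_mul]⟩) (Algebra.adjoin_le ?_)
    rw [Set.singleton_subset_iff]
    refine ⟨1, ?_⟩
    rw [pow_one, lam_mul_inv hE]
    exact one_mem _
  exact hS hx

theorem 𝒪To𝒪lam_injective : Function.Injective (𝒪To𝒪lam p k E) := fun _ _ h =>
  Subtype.ext (congrArg (fun z : 𝒪lam p k E => (z : 𝒜 p k)) h)

theorem isUnit_lam (hE : IsEis E) : IsUnit (𝒪To𝒪lam p k E (lam𝒪 p k E hE)) :=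
  IsUnit.of_mul_eq_one ⟨_, lam_inv_mem⟩ (Subtype.ext (lam_mul_inv hE))

theorem exists_mul_lam_pow (hE : IsEis E) (x : 𝒪lam p k E) :
    ∃ (n : ℕ) (y : 𝒪 p k),
      x * 𝒪To𝒪lam p k E (lam𝒪 p k E hE) ^ n = 𝒪To𝒪lam p k E y := by
  obtain ⟨n, hn⟩ := exists_lam_pow_mul_mem hE x.2
  refine ⟨n, ⟨_, hn⟩, Subtype.ext ?_⟩
  exact mul_comm _ _

theorem isLocalization_𝒪lam (hE : IsEis E) :
    @IsLocalization.Away _ _ (lam𝒪 p k E hE) (𝒪lam p k E) _ (𝒪To𝒪lam p k E).toAlgebra := by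
  let := (𝒪To𝒪lam p k E).toAlgebra
  refine IsLocalization.Away.mk _ (isUnit_lam hE) (exists_mul_lam_pow hE) fun a b hab => ?_
  exact ⟨0, by rw [𝒪To𝒪lam_injective hab]⟩

theorem exists_canonical (hE : IsEis E) : ∃ ι : 𝒪lam p k E →+* ShatE p k E,
    ∀ x, ι (𝒪To𝒪lam p k E x) = algebraMap (Shat p k E) (ShatE p k E) (𝒪ToShat hE x) := by
  let := (𝒪To𝒪lam p k E).toAlgebra
  have := isLocalization_𝒪lam hE
  have hu : IsUnit (((algebraMap (Shat p k E) (ShatE p k E)).comp (𝒪ToShat hE))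
      (lam𝒪 p k E hE)) := by
    obtain ⟨w, hw⟩ := exists_𝒪ToShat_lam hE
    rw [RingHom.comp_apply, hw, map_mul, ← coe_EShatE]
    exact (EShatE p k E).isUnit.mul (w.isUnit.map _)
  exact ⟨IsLocalization.Away.lift (lam𝒪 p k E hE) hu,
    fun x => IsLocalization.Away.lift_eq (lam𝒪 p k E hE) hu x⟩

theorem IsCanonical.apply_𝒪 (hE : IsEis E) {ι : 𝒪lam p k E →+* ShatE p k E}
    (hι : IsCanonical p k E ι) (x : 𝒪 p k) :
    ι (𝒪To𝒪lam p k E x) = algebraMap (Shat p k E) (ShatE p k E) (𝒪ToShat hE x) := by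
  exact @IsPowIso.eq_toCompletion (Sp p k) (𝒪 p k) _ _ (SpTo𝒪 p k) (ESp p k E)
    (isPowIso_SpTo𝒪 hE) _ (ShatE p k E) _ (algebraMap (Shat p k E) (ShatE p k E))
    (algebraMap_ShatE_injective hE) (ι.comp (𝒪To𝒪lam p k E)) hι.extends_Sp hι.maps_𝒪 x

theorem existsUnique_canonical (hE : IsEis E) : ∃! ι, IsCanonical p k E ι := by
  obtain ⟨ι, hι⟩ := exists_canonical hE
  refine ⟨ι, ⟨fun x => ?_, fun x => ⟨_, (hι x).symm⟩⟩, fun ι' hι' => ?_⟩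
  · refine (hι (SpTo𝒪 p k x)).trans ?_
    rw [𝒪ToShat_SpTo𝒪]
    rfl
  · ext x
    obtain ⟨n, y, hxy⟩ := exists_mul_lam_pow hE x
    have h1 := congrArg ι hxy
    have h2 := congrArg ι' hxy
    rw [map_mul, map_pow, hι] at h1
    rw [map_mul, map_pow, hι'.apply_𝒪 hE, hι'.apply_𝒪 hE] at h2
    rw [hι, ← h2] at h1
    refine (((isUnit_lam hE).map ι).pow n).mul_right_cancel ?_
    rw [hι]
    exact h1.symm

end Canonical

/-! ### Frobenius equations over `𝒜` -/

section FormalSolution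

variable {p : ℕ} [Fact p.Prime] {k : Type*} [Field k] [CharP k p] [PerfectRing k p]
  {ι ι' : Type*} [Fintype ι] [DecidableEq ι] [Fintype ι'] [DecidableEq ι']

variable (p k) in
/-- The constant term of a power series, as a power series. -/
def cst : 𝒜 p k →+* 𝒜 p k := (PowerSeries.C).comp (ev₀ p k)

theorem cst_apply (x : 𝒜 p k) : cst p k x = PowerSeries.C (ev₀ p k x) := rfl

theorem X_dvd_sub_cst (x : 𝒜 p k) : (PowerSeries.X : 𝒜 p k) ∣ x - cst p k x := by
  rw [X_dvd_iff_ev₀, map_sub, cst_apply, PowerSeries.constantCoeff_C, sub_self]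

theorem X_dvd_sub_iff {x y : 𝒜 p k} : (PowerSeries.X : 𝒜 p k) ∣ x - y ↔
    cst p k x = cst p k y := by
  rw [X_dvd_iff_ev₀, map_sub, sub_eq_zero, cst_apply, cst_apply]
  exact (PowerSeries.C_injective.eq_iff).symm

theorem map_cst_one {m : Type*} [DecidableEq m] :
    (1 : Matrix m m (𝒜 p k)).map (cst p k) = 1 :=
  Matrix.map_one _ (map_zero _) (map_one _)

theorem cst_one_apply {m : Type*} [DecidableEq m] (i j : m) :
    cst p k ((1 : Matrix m m (𝒜 p k)) i j) = (1 : Matrix m m (𝒜 p k)) i j :=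
  congrFun (congrFun map_cst_one i) j

theorem dvd_mul_apply {R : Type*} [CommRing R] {l m n : Type*} [Fintype m] {a : R}
    {M : Matrix l m R} {N : Matrix m n R} (h : ∀ i j, a ∣ N i j) (i : l) (j : n) :
    a ∣ (M * N) i j := by
  rw [Matrix.mul_apply]
  exact Finset.dvd_sum fun x _ => dvd_mul_of_dvd_right (h _ _) _

theorem dvd_mul_apply' {R : Type*} [CommRing R] {l m n : Type*} [Fintype m] {a : R}
    {M : Matrix l m R} {N : Matrix m n R} (h : ∀ i j, a ∣ M i j) (i : l) (j : n) :
    a ∣ (M * N) i j := by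
  rw [Matrix.mul_apply]
  exact Finset.dvd_sum fun x _ => dvd_mul_of_dvd_left (h _ _) _

theorem eq_of_X_pow_dvd_matrix {m n : Type*} {M N : Matrix m n (𝒜 p k)}
    (h : ∀ (l : ℕ) i j, (PowerSeries.X : 𝒜 p k) ^ (l + 1) ∣ (M - N) i j) : M = N := by
  ext1 i j
  exact sub_eq_zero.1 (eq_zero_of_X_pow_dvd fun l => h l i j)

/-- The operator `X ↦ T φ(X) S` on matrices is contracting for the `u`-adic topology. -/
theorem X_pow_succ_dvd_frobenius_operator {T S : Matrix ι ι (𝒜 p k)} {M N : Matrix ι ι (𝒜 p k)}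
    {l : ℕ} (h : ∀ i j, (PowerSeries.X : 𝒜 p k) ^ (l + 1) ∣ (M - N) i j) (i j : ι) :
    (PowerSeries.X : 𝒜 p k) ^ (l + 2) ∣
      (T * M.map (φ𝒜 p k) * S - T * N.map (φ𝒜 p k) * S) i j := by
  rw [← Matrix.sub_mul, ← Matrix.mul_sub]
  refine dvd_mul_apply' (dvd_mul_apply fun i j => ?_) i j
  have := X_pow_succ_dvd_φ𝒜 (h i j)
  rwa [Matrix.sub_apply, map_sub] at this

/-- The equation `X T(0) = T φ(X)` has at most one solution that is congruent to `1`. -/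
theorem formal_solution_unique {T S : Matrix ι ι (𝒜 p k)} (hS : T.map (cst p k) * S = 1)
    {M N : Matrix ι ι (𝒜 p k)} (hM1 : M.map (cst p k) = 1) (hN1 : N.map (cst p k) = 1)
    (hM : M * T.map (cst p k) = T * M.map (φ𝒜 p k))
    (hN : N * T.map (cst p k) = T * N.map (φ𝒜 p k)) : M = N := by
  have hfix : ∀ {M : Matrix ι ι (𝒜 p k)}, M * T.map (cst p k) = T * M.map (φ𝒜 p k) →
      M = T * M.map (φ𝒜 p k) * S := fun {M} h => by
    rw [← h, Matrix.mul_assoc, hS, Matrix.mul_one]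
  refine eq_of_X_pow_dvd_matrix fun l => ?_
  induction l with
  | zero =>
    intro i j
    rw [zero_add, pow_one, Matrix.sub_apply, X_dvd_sub_iff]
    exact congrFun (congrFun (hM1.trans hN1.symm) i) j
  | succ l ih =>
    intro i j
    rw [hfix hM, hfix hN]
    exact X_pow_succ_dvd_frobenius_operator ih i j

/-- The equation `X T(0) = T φ(X)` has a solution that is congruent to `1`: the `u`-adic limit of
the iterates of `X ↦ T φ(X) T(0)⁻¹` on the matrix `1`. -/
theorem exists_formal_solution {T S : Matrix ι ι (𝒜 p k)} (hS : T.map (cst p k) * S = 1) :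
    ∃ M : Matrix ι ι (𝒜 p k), M.map (cst p k) = 1 ∧
      M * T.map (cst p k) = T * M.map (φ𝒜 p k) := by
  let Ψ : Matrix ι ι (𝒜 p k) → Matrix ι ι (𝒜 p k) := fun M => T * M.map (φ𝒜 p k) * S
  let Y : ℕ → Matrix ι ι (𝒜 p k) := fun n => Ψ^[n] 1
  have hY : ∀ n, Y (n + 1) = Ψ (Y n) := fun n => Function.iterate_succ_apply' _ _ _
  have hstep : ∀ n i j, (PowerSeries.X : 𝒜 p k) ^ (n + 1) ∣ (Y (n + 1) - Y n) i j := by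
    intro n
    induction n with
    | zero =>
      intro i j
      have h1 : Y (0 + 1) - Y 0 = (T - T.map (cst p k)) * S := by
        rw [Matrix.sub_mul, hS, hY]
        simp only [Y, Ψ, Function.iterate_zero, id]
        rw [Matrix.map_one _ (map_zero _) (map_one _), Matrix.mul_one]
      rw [h1, zero_add, pow_one]
      exact dvd_mul_apply' (fun i j => X_dvd_sub_cst _) i j
    | succ n ih =>
      intro i j
      rw [hY (n + 1), hY n]
      rw [hY n] at ih
      exact X_pow_succ_dvd_frobenius_operator ih i j
  let M : Matrix ι ι (𝒜 p k) := fun i j => PowerSeries.mk fun n => PowerSeries.coeff n (Y n i j)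
  have hM : ∀ n i j, (PowerSeries.X : 𝒜 p k) ^ (n + 1) ∣ (M - Y n) i j := fun n i j =>
    X_pow_dvd_diagonal_sub (fun n => Y n i j) (fun n => hstep n i j) n
  have hfix : M = Ψ M := by
    refine eq_of_X_pow_dvd_matrix fun n i j => ?_
    have h1 : M - Ψ M = (M - Y (n + 1)) - (Ψ M - Ψ (Y n)) := by rw [hY]; abel
    rw [h1, Matrix.sub_apply]
    exact dvd_sub ((pow_dvd_pow _ (by omega)).trans (hM (n + 1) i j))
      ((pow_dvd_pow _ (by omega)).trans (X_pow_succ_dvd_frobenius_operator (hM n) i j))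
  refine ⟨M, ?_, ?_⟩
  · ext1 i j
    have h1 := hM 0 i j
    rw [zero_add, pow_one, Matrix.sub_apply, X_dvd_sub_iff] at h1
    rw [Matrix.map_apply, h1]
    exact cst_one_apply i j
  · have hS' : S * T.map (cst p k) = 1 := mul_eq_one_comm.1 hS
    conv_lhs => rw [hfix]
    rw [Matrix.mul_assoc, hS', Matrix.mul_one]

/-- The product `T φ(T) ⋯ φ^{n-1}(T)`. -/
def Tprod (T : Matrix ι ι (𝒜 p k)) (n : ℕ) : Matrix ι ι (𝒜 p k) :=
  ((List.range n).map fun i => T.map (φ𝒜 p k)^[i]).prod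

theorem Tprod_zero (T : Matrix ι ι (𝒜 p k)) : Tprod T 0 = 1 := rfl

theorem Tprod_succ (T : Matrix ι ι (𝒜 p k)) (n : ℕ) :
    Tprod T (n + 1) = Tprod T n * T.map (φ𝒜 p k)^[n] := by
  simp [Tprod, List.range_succ]

theorem map_iterate_mul {l m n : Type*} [Fintype m] (i : ℕ) (M : Matrix l m (𝒜 p k))
    (N : Matrix m n (𝒜 p k)) : (M * N).map (φ𝒜 p k)^[i] =
      M.map (φ𝒜 p k)^[i] * N.map (φ𝒜 p k)^[i] := by
  rw [← RingHom.coe_pow]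
  exact Matrix.map_mul

/-- The iteration of an equation `Y S = T φ(Y)`. -/
theorem mul_Tprod {T : Matrix ι ι (𝒜 p k)} {S : Matrix ι' ι' (𝒜 p k)} {Y : Matrix ι ι' (𝒜 p k)}
    (h : Y * S = T * Y.map (φ𝒜 p k)) (n : ℕ) :
    Y * Tprod S n = Tprod T n * Y.map (φ𝒜 p k)^[n] := by
  induction n with
  | zero =>
    rw [Tprod_zero, Tprod_zero, Matrix.mul_one, Matrix.one_mul]
    ext; rfl
  | succ n ih =>
    have h1 := congrArg (fun M => Matrix.map M (φ𝒜 p k)^[n]) h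
    simp only [map_iterate_mul] at h1
    rw [Tprod_succ, Tprod_succ, ← Matrix.mul_assoc, ih, Matrix.mul_assoc, h1, Matrix.mul_assoc,
      Matrix.map_map, ← Function.iterate_succ]

theorem Tprod_smul (c : 𝒜 p k) (T : Matrix ι ι (𝒜 p k)) (n : ℕ) :
    Tprod (c • T) n = (∏ i ∈ Finset.range n, (φ𝒜 p k)^[i] c) • Tprod T n := by
  induction n with
  | zero => simp [Tprod_zero]
  | succ n ih =>
    have h1 : (c • T).map (φ𝒜 p k)^[n] = (φ𝒜 p k)^[n] c • T.map (φ𝒜 p k)^[n] := by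
      ext1 i j
      simp [iterate_map_mul]
    rw [Tprod_succ, ih, h1, Tprod_succ, Finset.prod_range_succ, Matrix.smul_mul, Matrix.mul_smul,
      smul_smul]

theorem cst_φ𝒜_iterate (n : ℕ) (x : 𝒜 p k) :
    (φ𝒜 p k)^[n] (cst p k x) = cst p k ((φ𝒜 p k)^[n] x) := ev₀_φ𝒜_iterate n x

theorem Tprod_cst (T : Matrix ι ι (𝒜 p k)) (n : ℕ) :
    Tprod (T.map (cst p k)) n = (Tprod T n).map (cst p k) := by
  induction n with
  | zero => rw [Tprod_zero, Tprod_zero, Matrix.map_one _ (map_zero _) (map_one _)]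
  | succ n ih =>
    rw [Tprod_succ, Tprod_succ, Matrix.map_mul, ih]
    congr 1
    ext1 i j
    exact cst_φ𝒜_iterate n _

theorem det_map_iterate (T : Matrix ι ι (𝒜 p k)) (n : ℕ) :
    (T.map (φ𝒜 p k)^[n]).det = (φ𝒜 p k)^[n] T.det := by
  rw [← RingHom.coe_pow, RingHom.map_det]
  rfl

theorem absK₀_ev₀_det_Tprod (T : Matrix ι ι (𝒜 p k)) (n : ℕ) :
    absK₀ p k (ev₀ p k (Tprod T n).det) = absK₀ p k (ev₀ p k T.det) ^ n := by
  induction n with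
  | zero => simp [Tprod_zero, absK₀_one]
  | succ n ih =>
    rw [Tprod_succ, Matrix.det_mul, map_mul, absK₀_mul, ih, det_map_iterate,
      absK₀_ev₀_φ𝒜_iterate, pow_succ]

theorem det_map_cst (T : Matrix ι ι (𝒜 p k)) :
    (T.map (cst p k)).det = PowerSeries.C (ev₀ p k T.det) := by
  rw [← cst_apply, RingHom.map_det]
  rfl

end FormalSolution

/-! ### Solutions under the condition (PIM) -/

section Bounds

variable {p : ℕ} [Fact p.Prime] {k : Type*} [Field k] [CharP k p] [PerfectRing k p]
  {E : (W p k)[X]} {r : ℕ}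

variable (E) in
/-- The condition (PIM) for a matrix `T` and the amplitude `[0, m]`: up to the denominator
`p ^ C`, the product `Tₙ = T φ(T) ⋯ φ^{n-1}(T)` is integral, and `eₙ ^ m` times its inverse is
integral, where `eₙ = E φ(E) ⋯ φ^{n-1}(E)`. -/
def PIM₀ (T : Matrix (Fin r) (Fin r) (𝒜 p k)) (C m : ℕ) : Prop :=
  ∀ n : ℕ, 1 ≤ n → ∃ Q Q' : Matrix (Fin r) (Fin r) (𝔖 p k),
    (p : 𝒜 p k) ^ C • Tprod T n = Q.map (ofS p k) ∧
    Tprod T n * Q'.map (ofS p k) = ((p : 𝒜 p k) ^ C * eN E n ^ m) • 1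

theorem p_pow_eq_C (C : ℕ) : (p : 𝒜 p k) ^ C = PowerSeries.C ((p : K₀ p k) ^ C) := by
  rw [map_pow, map_natCast]

theorem absK₀_p_pow (C : ℕ) : absK₀ p k ((p : K₀ p k) ^ C) = (p : ℝ)⁻¹ ^ C := by
  rw [absK₀_pow, absK₀_p]

theorem Tprod_one (T : Matrix (Fin r) (Fin r) (𝒜 p k)) : Tprod T 1 = T := by
  rw [Tprod_succ, Tprod_zero, Matrix.one_mul]
  ext; rfl

theorem PIM₀.ev₀_det_ne_zero (hE : IsEis E) {T : Matrix (Fin r) (Fin r) (𝒜 p k)} {C m : ℕ}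
    (h : PIM₀ E T C m) : ev₀ p k T.det ≠ 0 := by
  obtain ⟨Q, Q', -, h2⟩ := h 1 le_rfl
  have h3 := congrArg (fun M => ev₀ p k (Matrix.det M)) h2
  simp only [Tprod_one, Matrix.det_mul, Matrix.det_smul, Matrix.det_one, mul_one, map_mul,
    map_pow] at h3
  intro h0
  rw [h0, zero_mul] at h3
  refine pow_ne_zero _ (mul_ne_zero (pow_ne_zero _ ?_)
    (pow_ne_zero _ (ev₀_eN_ne_zero hE 1))) h3.symm
  rw [map_natCast]
  exact p_ne_zero p k

theorem exists_inverse_cst {T : Matrix (Fin r) (Fin r) (𝒜 p k)} (h : ev₀ p k T.det ≠ 0) :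
    ∃ S, T.map (cst p k) * S = 1 := by
  refine ⟨(T.map (cst p k))⁻¹, Matrix.mul_nonsing_inv _ ?_⟩
  rw [det_map_cst]
  exact (isUnit_iff_ne_zero.2 h).map _

variable {T Y : Matrix (Fin r) (Fin r) (𝒜 p k)} {C m : ℕ}

theorem X_pow_dvd_iterate_sub_one (hY1 : Y.map (cst p k) = 1) (n : ℕ) (i j : Fin r) :
    (PowerSeries.X : 𝒜 p k) ^ p ^ n ∣ (Y.map (φ𝒜 p k)^[n] - 1) i j := by
  have h0 : (PowerSeries.X : 𝒜 p k) ∣ Y i j - (1 : Matrix (Fin r) (Fin r) (𝒜 p k)) i j := by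
    rw [X_dvd_sub_iff, cst_one_apply]
    exact congrFun (congrFun hY1 i) j
  have h1 := X_pow_dvd_φ𝒜_iterate h0 n
  have h2 : (φ𝒜 p k)^[n] ((1 : Matrix (Fin r) (Fin r) (𝒜 p k)) i j) =
      (1 : Matrix (Fin r) (Fin r) (𝒜 p k)) i j := by
    rw [Matrix.one_apply]
    split_ifs
    · exact iterate_map_one _ _
    · exact iterate_map_zero _ _
  rwa [iterate_map_sub, h2] at h1

/-- The coefficients of the comparison matrix have polynomial growth: modulo `u ^ (p ^ n)` it is
the product `Tₙ Tₙ(0)⁻¹`, which (PIM) bounds. -/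
theorem PIM₀.mem_𝒪 (hE : IsEis E) (h : PIM₀ E T C m) (hY1 : Y.map (cst p k) = 1)
    (hY : Y * T.map (cst p k) = T * Y.map (φ𝒜 p k)) (i j : Fin r) : Y i j ∈ 𝒪 p k := by
  refine mem_𝒪_of_growth (((p : ℝ) ^ C) ^ 2) m fun n hn => ?_
  obtain ⟨Q, Q', h1, h2⟩ := h n hn
  let Q₀ : Matrix (Fin r) (Fin r) (𝔖 p k) :=
    Q'.map ((PowerSeries.C : W p k →+* 𝔖 p k).comp (PowerSeries.constantCoeff : 𝔖 p k →+* W p k))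
  have hQ₀ : (Q'.map (ofS p k)).map (cst p k) = Q₀.map (ofS p k) := by
    ext1 i j
    change PowerSeries.C (PowerSeries.constantCoeff
        (PowerSeries.map (algebraMap (W p k) (K₀ p k)) (Q' i j))) =
      PowerSeries.map (algebraMap (W p k) (K₀ p k))
        (PowerSeries.C (PowerSeries.constantCoeff (Q' i j)))
    rw [PowerSeries.map_C]
    refine congrArg _ ?_
    rw [← PowerSeries.coeff_zero_eq_constantCoeff_apply, PowerSeries.coeff_map,
      PowerSeries.coeff_zero_eq_constantCoeff_apply]
  have h3 := congrArg (fun M => Matrix.map M (cst p k)) h2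
  simp only [Matrix.map_mul, hQ₀] at h3
  have h4 := mul_Tprod hY n
  rw [Tprod_cst] at h4
  set c : K₀ p k := (p : K₀ p k) ^ C * ((p : K₀ p k) ^ C * ev₀ p k (eN E n) ^ m) with hc
  have hcst : (((p : 𝒜 p k) ^ C * eN E n ^ m) • (1 : Matrix (Fin r) (Fin r) (𝒜 p k))).map
      (cst p k) = PowerSeries.C ((p : K₀ p k) ^ C * ev₀ p k (eN E n) ^ m) • 1 := by
    ext1 i j
    rw [Matrix.map_apply, Matrix.smul_apply, Matrix.smul_apply, smul_eq_mul, smul_eq_mul, map_mul,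
      cst_one_apply, p_pow_eq_C, cst_apply, map_mul,
      PowerSeries.constantCoeff_C, map_pow]
  rw [hcst] at h3
  have h5 : PowerSeries.C c • Y = Q.map (ofS p k) * Y.map (φ𝒜 p k)^[n] * Q₀.map (ofS p k) := by
    rw [← h1, Matrix.smul_mul, ← h4, Matrix.smul_mul, Matrix.mul_assoc, h3, Matrix.mul_smul,
      Matrix.mul_one, smul_smul, p_pow_eq_C, ← map_mul]
  refine ⟨c, (Q * Q₀) i j, ?_, ?_, ?_⟩
  · exact mul_ne_zero (pow_ne_zero _ (p_ne_zero p k)) (mul_ne_zero (pow_ne_zero _ (p_ne_zero p k))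
      (pow_ne_zero _ (ev₀_eN_ne_zero hE n)))
  · have := p_real_pos p
    rw [hc, absK₀_mul, absK₀_mul, absK₀_pow _ _ (ev₀ p k _), absK₀_ev₀_eN hE, absK₀_p_pow,
      ← pow_mul, mul_inv, mul_inv, inv_pow, inv_inv, inv_pow, inv_inv]
    exact le_of_eq (by ring)
  · have h6 : PowerSeries.C c * Y i j - ofS p k ((Q * Q₀) i j) =
        (Q.map (ofS p k) * (Y.map (φ𝒜 p k)^[n] - 1) * Q₀.map (ofS p k)) i j := by
      rw [Matrix.mul_sub, Matrix.sub_mul, ← h5, Matrix.mul_one, ← Matrix.map_mul]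
      rfl
    rw [h6]
    exact dvd_mul_apply' (dvd_mul_apply (X_pow_dvd_iterate_sub_one hY1 n)) i j

theorem ev₀_det_eq_one (hY1 : Y.map (cst p k) = 1) : ev₀ p k Y.det = 1 := by
  have := congrArg Matrix.det hY1
  rw [det_map_cst, Matrix.det_one, ← map_one PowerSeries.C] at this
  exact PowerSeries.C_injective this

theorem det_mem_𝒪 {d : ℕ} {M : Matrix (Fin d) (Fin d) (𝒜 p k)} (h : ∀ i j, M i j ∈ 𝒪 p k) :
    M.det ∈ 𝒪 p k := by
  rw [Matrix.det_apply]
  exact sum_mem fun σ _ => by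
    rw [Units.smul_def]
    exact zsmul_mem (prod_mem fun i _ => h _ _) _

/-- The order of vanishing of `det Y` at the zeros of `E` is at most the valuation of `det T(0)`. -/
theorem PIM₀.le_of_dvd_det (hE : IsEis E) (h : PIM₀ E T C m) (hY1 : Y.map (cst p k) = 1)
    (hY : Y * T.map (cst p k) = T * Y.map (φ𝒜 p k)) {ν : ℤ}
    (hν : absK₀ p k (ev₀ p k T.det) = (p : ℝ) ^ (-ν)) {l : ℕ}
    (hl : ∃ y ∈ 𝒪 p k, Y.det = E𝒜 p k E ^ l * y) : (l : ℤ) ≤ ν := by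
  refine le_of_E_pow_dvd hE (fun _ : Unit => Y.det) (fun _ => det_mem_𝒪 (h.mem_𝒪 hE hY1 hY)) ()
    (by rw [ev₀_det_eq_one hY1]; exact one_ne_zero) (((p : K₀ p k) ^ C) ^ r)
    (pow_ne_zero _ (pow_ne_zero _ (p_ne_zero p k))) ν (fun n => ev₀ p k (Tprod T n).det)
    (fun n => ?_) (fun n hn => ?_) l (fun _ => hl)
  · rw [absK₀_ev₀_det_Tprod, hν, ← zpow_natCast, ← zpow_mul]
    congr 1
    ring
  · obtain ⟨Q, Q', h1, h2⟩ := h n hn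
    refine ⟨fun _ _ => Q.det, fun _ => ?_⟩
    have h3 := congrArg Matrix.det (mul_Tprod hY n)
    rw [Tprod_cst, Matrix.det_mul, Matrix.det_mul, det_map_cst, det_map_iterate] at h3
    have h4 := congrArg Matrix.det h1
    rw [Matrix.det_smul, Fintype.card_fin, p_pow_eq_C] at h4
    have h5 : (Q.map (ofS p k)).det = ofS p k Q.det := (RingHom.map_det _ _).symm
    rw [Finset.univ_unique, Finset.sum_singleton, ← h5, ← h4, map_mul, map_pow, mul_assoc,
      mul_comm (PowerSeries.C _) Y.det, h3]
    ring

/-- The function `λ ^ (r m) / det Y` belongs to `𝒪` and satisfies the dual inequality: (PIM)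
bounds the inverses of the products `Tₙ` by `eₙ ^ m`, and `λ` satisfies `eₙ(0) λ = eₙ φⁿ(λ)`. -/
theorem PIM₀.exists_dual (hE : IsEis E) (h : PIM₀ E T C m) (hY1 : Y.map (cst p k) = 1)
    (hY : Y * T.map (cst p k) = T * Y.map (φ𝒜 p k)) {ν : ℤ}
    (hν : absK₀ p k (ev₀ p k T.det) = (p : ℝ) ^ (-ν)) :
    ∃ δ ∈ 𝒪 p k, Y.det * δ = lam p k E ^ (r * m) ∧
      ∀ l : ℕ, (∃ y ∈ 𝒪 p k, δ = E𝒜 p k E ^ l * y) → (l : ℤ) ≤ r * m - ν := by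
  have hdet1 := ev₀_det_eq_one hY1
  have hp := p_real_pos p
  have hu : IsUnit Y.det := isUnit_of_ev₀ (by rw [hdet1]; exact one_ne_zero)
  obtain ⟨δ, hδ⟩ : ∃ δ, Y.det * δ = lam p k E ^ (r * m) :=
    ⟨Ring.inverse Y.det * lam p k E ^ (r * m), Ring.mul_inverse_cancel_left _ _ hu⟩
  have hlam := lam_spec hE
  have hδ1 : ev₀ p k δ = 1 := by
    have := congrArg (ev₀ p k) hδ
    rwa [map_mul, hdet1, one_mul, map_pow, hlam.1, one_pow] at this
  have hdet0 := h.ev₀_det_ne_zero hE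
  have hdetn : ∀ n, ev₀ p k (Tprod T n).det ≠ 0 := fun n => by
    rw [Ne, ← absK₀_eq_zero_iff p k, absK₀_ev₀_det_Tprod]
    exact pow_ne_zero _ (absK₀_ne_zero p k hdet0)
  let a : ℕ → K₀ p k := fun n => ev₀ p k (eN E n) ^ (r * m) / ev₀ p k (Tprod T n).det
  let c : K₀ p k := ((p : K₀ p k) ^ C) ^ r
  have hc : c ≠ 0 := pow_ne_zero _ (pow_ne_zero _ (p_ne_zero p k))
  have ha : ∀ n, absK₀ p k (a n) = (p : ℝ) ^ (-(n * (r * m - ν))) := fun n => by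
    simp only [a]
    rw [div_eq_mul_inv, absK₀_mul, absK₀_inv, absK₀_pow, absK₀_ev₀_eN hE, absK₀_ev₀_det_Tprod, hν,
      inv_pow, inv_pow, ← zpow_natCast, ← zpow_natCast, ← zpow_natCast, ← zpow_mul, ← zpow_mul,
      ← zpow_neg, ← zpow_neg, ← zpow_add₀ hp.ne']
    congr 1
    push_cast
    ring
  have hM : ∀ n : ℕ, 1 ≤ n → ∃ s : 𝔖 p k,
      PowerSeries.C (c * a n) * δ = ofS p k s * (φ𝒜 p k)^[n] δ := fun n hn => by
    obtain ⟨Q, Q', h1, h2⟩ := h n hn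
    refine ⟨Q'.det, ?_⟩
    have h3 := congrArg Matrix.det (mul_Tprod hY n)
    rw [Tprod_cst, Matrix.det_mul, Matrix.det_mul, det_map_cst, det_map_iterate] at h3
    have h4 := congrArg Matrix.det h2
    rw [Matrix.det_mul, Matrix.det_smul, Fintype.card_fin, Matrix.det_one, mul_one, mul_pow,
      p_pow_eq_C, ← map_pow] at h4
    have h5 : (Q'.map (ofS p k)).det = ofS p k Q'.det := (RingHom.map_det _ _).symm
    rw [h5] at h4
    have h6 := congrArg (φ𝒜 p k)^[n] hδ
    rw [iterate_map_mul, iterate_map_pow] at h6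
    have h7 := congrArg (fun x => x ^ (r * m)) (lam_iterate hE n)
    simp only [mul_pow, ← map_pow PowerSeries.C] at h7
    have hu' : IsUnit (Y.det * (φ𝒜 p k)^[n] Y.det * PowerSeries.C (ev₀ p k (Tprod T n).det)) := by
      refine (hu.mul ?_).mul ((isUnit_iff_ne_zero.2 (hdetn n)).map _)
      rw [← RingHom.coe_pow]
      exact hu.map _
    refine hu'.mul_left_cancel ?_
    have h8 : PowerSeries.C (ev₀ p k (Tprod T n).det) * PowerSeries.C (c * a n) =
        PowerSeries.C c * PowerSeries.C (ev₀ p k (eN E n) ^ (r * m)) := by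
      rw [← map_mul, ← map_mul]
      congr 1
      simp only [a]
      field_simp [hdetn n]
    have h9 : (eN E n ^ m) ^ r = eN E n ^ (r * m) := by rw [← pow_mul, mul_comm]
    rw [h9] at h4
    calc _ = (φ𝒜 p k)^[n] Y.det * (PowerSeries.C (ev₀ p k (Tprod T n).det) *
          PowerSeries.C (c * a n)) * (Y.det * δ) := by ring
      _ = (φ𝒜 p k)^[n] Y.det * (PowerSeries.C c * (PowerSeries.C (ev₀ p k (eN E n) ^ (r * m)) *
          lam p k E ^ (r * m))) := by rw [h8, hδ]; ring
      _ = (Tprod T n).det * (φ𝒜 p k)^[n] Y.det * ofS p k Q'.det *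
          ((φ𝒜 p k)^[n] (lam p k E)) ^ (r * m) := by
        rw [h7]
        have h4' : (Tprod T n).det * ofS p k Q'.det = PowerSeries.C c * eN E n ^ (r * m) := h4
        linear_combination (-(φ𝒜 p k)^[n] Y.det * ((φ𝒜 p k)^[n] (lam p k E)) ^ (r * m)) * h4'
      _ = _ := by
        rw [← h3, ← h6]
        ring
  have hδO : δ ∈ 𝒪 p k := by
    refine mem_𝒪_of_growth (((p : ℝ) ^ C) ^ r) (r * m - ν).toNat fun n hn => ?_
    obtain ⟨s, hs⟩ := hM n hn
    have han : a n ≠ 0 := by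
      rw [Ne, ← absK₀_eq_zero_iff p k, ha]
      positivity
    refine ⟨c * a n, s, mul_ne_zero hc han, ?_, ?_⟩
    · rw [absK₀_mul, ha, mul_inv, zpow_neg, inv_inv]
      simp only [c]
      rw [absK₀_pow, absK₀_p_pow, inv_pow, inv_pow, inv_inv]
      refine mul_le_mul_of_nonneg_left ?_ (by positivity)
      rw [← zpow_natCast]
      refine zpow_le_zpow_right₀ (one_lt_p_real p).le ?_
      push_cast
      exact mul_le_mul_of_nonneg_left (Int.self_le_toNat _) (by positivity)
    · have : PowerSeries.C (c * a n) * δ - ofS p k s = ofS p k s * ((φ𝒜 p k)^[n] δ - 1) := by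
        rw [hs]; ring
      rw [this]
      exact dvd_mul_of_dvd_right (X_pow_dvd_φ𝒜_iterate_sub_one hδ1 n) _
  refine ⟨δ, hδO, hδ, fun l hl => ?_⟩
  exact le_of_E_pow_dvd hE (fun _ : Unit => δ) (fun _ => hδO) ()
    (by rw [hδ1]; exact one_ne_zero) c hc _ a ha (fun n hn => by
      obtain ⟨s, hs⟩ := hM n hn
      exact ⟨fun _ _ => s, fun _ => by simpa using hs⟩) l (fun _ => hl)

end Bounds

/-! ### Minors of the solution -/

section Minors

/-- The expansion of the maximal minors of a product, with repetitions among the rows allowed. -/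
theorem det_submatrix_mul {R ι κ : Type*} [CommRing R] [Fintype ι] [DecidableEq ι] {d : ℕ}
    (M : Matrix κ ι R) (G : Matrix ι (Fin d) R) (I : Fin d → κ) :
    ((M * G).submatrix I id).det =
      ∑ J : Fin d → ι, (∏ i, M (I i) (J i)) * (G.submatrix J id).det := by
  have h1 : (M * G).submatrix I id = fun i => ∑ j, M (I i) j • G j := by
    ext i l
    simp [Matrix.mul_apply, Finset.sum_apply]
  have h2 := (Matrix.detRowAlternating (R := R) (n := Fin d)).toMultilinearMap.map_sum
    (fun i j => M (I i) j • G j)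
  rw [h1]
  refine h2.trans (Finset.sum_congr rfl fun J _ => ?_)
  exact (Matrix.detRowAlternating (R := R) (n := Fin d)).toMultilinearMap.map_smul_univ
    (fun i => M (I i) (J i)) (fun i => G (J i))

variable {p : ℕ} [Fact p.Prime] {k : Type*} [Field k] [CharP k p] [PerfectRing k p]
  {E : (W p k)[X]} {r : ℕ} {T Y : Matrix (Fin r) (Fin r) (𝒜 p k)} {C m : ℕ}

theorem map_cst_map_C {l n : Type*} (B : Matrix l n (K₀ p k)) :
    (B.map PowerSeries.C).map (cst p k) = B.map PowerSeries.C := by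
  ext1 i j
  rw [Matrix.map_apply, Matrix.map_apply, cst_apply, PowerSeries.constantCoeff_C]

/-- The inequality for a sub-`φ`-module with basis the columns of `B`: the common order of
vanishing at the zeros of `E` of the maximal minors of `Y B` is at most the valuation of the
determinant of the matrix `P` of its Frobenius. -/
theorem PIM₀.le_of_dvd_minors (hE : IsEis E) (h : PIM₀ E T C m) (hY1 : Y.map (cst p k) = 1)
    (hY : Y * T.map (cst p k) = T * Y.map (φ𝒜 p k)) {d : ℕ}
    {B : Matrix (Fin r) (Fin d) (K₀ p k)} {L : Matrix (Fin d) (Fin r) (K₀ p k)} (hL : L * B = 1)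
    {P : Matrix (Fin d) (Fin d) (K₀ p k)}
    (hB : T.map (cst p k) * (B.map PowerSeries.C).map (φ𝒜 p k) =
      B.map PowerSeries.C * P.map PowerSeries.C)
    {ν : ℤ} (hν : absK₀ p k P.det = (p : ℝ) ^ (-ν)) {l : ℕ}
    (hl : ∀ I : Fin d → Fin r, ∃ y ∈ 𝒪 p k,
      ((Y * B.map PowerSeries.C).submatrix I id).det = E𝒜 p k E ^ l * y) : (l : ℤ) ≤ ν := by
  set G : Matrix (Fin r) (Fin d) (𝒜 p k) := Y * B.map PowerSeries.C with hG
  set P' : Matrix (Fin d) (Fin d) (𝒜 p k) := P.map PowerSeries.C with hP'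
  have hG1 : G * P' = T * G.map (φ𝒜 p k) := by
    rw [hG, Matrix.mul_assoc, ← hB, ← Matrix.mul_assoc, hY, Matrix.mul_assoc, Matrix.map_mul]
  have hGO : ∀ i j, G i j ∈ 𝒪 p k := fun i j => by
    rw [hG, Matrix.mul_apply]
    exact sum_mem fun x _ => mul_mem (h.mem_𝒪 hE hY1 hY _ _) ((𝒪 p k).algebraMap_mem _)
  have hdetP' : P'.det = PowerSeries.C P.det := (RingHom.map_det _ _).symm
  have hdetP : ∀ n, (Tprod P' n).det = PowerSeries.C (ev₀ p k (Tprod P' n).det) := fun n => by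
    have h1 := Tprod_cst P' n
    rw [hP', map_cst_map_C, ← hP'] at h1
    exact (congrArg Matrix.det h1).trans (det_map_cst _)
  -- a minor of `G` that does not vanish modulo `u`
  obtain ⟨J, hJ⟩ : ∃ J : Fin d → Fin r, ev₀ p k (G.submatrix J id).det ≠ 0 := by
    by_contra! h0
    have h1 := det_submatrix_mul L B id
    have h2 : ∀ J : Fin d → Fin r, (B.submatrix J id).det = 0 := fun J => by
      rw [← h0 J, RingHom.map_det]
      congr 1
      ext1 i j
      have h3 : G.map (cst p k) = B.map PowerSeries.C := by
        rw [hG, Matrix.map_mul, hY1, Matrix.one_mul, map_cst_map_C]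
      exact (PowerSeries.C_injective (congrFun (congrFun h3 (J i)) j)).symm
    rw [hL] at h1
    simp only [h2, mul_zero, Finset.sum_const_zero, Matrix.submatrix_id_id, Matrix.det_one] at h1
    exact one_ne_zero h1
  refine le_of_E_pow_dvd hE (fun I : Fin d → Fin r => (G.submatrix I id).det)
    (fun I => det_mem_𝒪 fun i j => hGO _ _) J hJ (((p : K₀ p k) ^ C) ^ d)
    (pow_ne_zero _ (pow_ne_zero _ (p_ne_zero p k))) ν (fun n => ev₀ p k (Tprod P' n).det)
    (fun n => ?_) (fun n hn => ?_) l hl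
  · rw [absK₀_ev₀_det_Tprod, hdetP', PowerSeries.constantCoeff_C, hν, ← zpow_natCast, ← zpow_mul]
    congr 1
    ring
  · obtain ⟨Q, Q', h1, h2⟩ := h n hn
    refine ⟨fun I J => ∏ i, Q (I i) (J i), fun I => ?_⟩
    have h3 : (p : 𝒜 p k) ^ C • (G * Tprod P' n) = Q.map (ofS p k) * G.map (φ𝒜 p k)^[n] := by
      rw [mul_Tprod hG1, ← h1, Matrix.smul_mul]
    have h4 := congrArg (fun M => (Matrix.submatrix M I id).det) h3
    simp only [det_submatrix_mul (Q.map (ofS p k))] at h4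
    have h5 : ((p : 𝒜 p k) ^ C • (G * Tprod P' n)).submatrix I id =
        (p : 𝒜 p k) ^ C • (G.submatrix I id * Tprod P' n) := by
      ext i j
      simp [Matrix.mul_apply]
    rw [h5, Matrix.det_smul, Matrix.det_mul, Fintype.card_fin, p_pow_eq_C, hdetP] at h4
    rw [map_mul, map_pow, mul_assoc, mul_comm (PowerSeries.C _) (Matrix.det _), h4]
    refine Finset.sum_congr rfl fun J _ => ?_
    rw [map_prod]
    congr 1
    rw [← det_map_iterate]
    rfl

end Minors

/-! ### Twisting by powers of `E` and `λ` -/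

section Twist

variable {p : ℕ} [Fact p.Prime] {k : Type*} [Field k] [CharP k p] [PerfectRing k p]
  {E : (W p k)[X]}

theorem mul_inv_of_ev₀_ne_zero {x : 𝒜 p k} (hx : ev₀ p k x ≠ 0) : x * x⁻¹ = 1 :=
  PowerSeries.mul_inv_cancel x hx

theorem zpow𝒜_eq (u : (𝒜 p k)ˣ) (n : ℤ) : zpow𝒜 p k u n = ((u ^ n : (𝒜 p k)ˣ) : 𝒜 p k) := by
  have hu : ev₀ p k (u : 𝒜 p k) ≠ 0 := (u.isUnit.map (ev₀ p k)).ne_zero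
  have hinv : (u : 𝒜 p k)⁻¹ = ((u⁻¹ : (𝒜 p k)ˣ) : 𝒜 p k) :=
    u.isUnit.mul_left_cancel ((mul_inv_of_ev₀_ne_zero hu).trans u.mul_inv.symm)
  cases n with
  | ofNat n => simp [zpow𝒜]
  | negSucc n => rw [zpow𝒜, hinv, zpow_negSucc, ← inv_pow, Units.val_pow_eq_pow_val]

variable {x y : 𝒜 p k}

theorem exists_unit (hx : ev₀ p k x ≠ 0) : ∃ u : (𝒜 p k)ˣ, (u : 𝒜 p k) = x :=
  isUnit_of_ev₀ hx

theorem zpow𝒜_add (hx : ev₀ p k x ≠ 0) (m n : ℤ) :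
    zpow𝒜 p k x (m + n) = zpow𝒜 p k x m * zpow𝒜 p k x n := by
  obtain ⟨u, rfl⟩ := exists_unit hx
  rw [zpow𝒜_eq, zpow𝒜_eq, zpow𝒜_eq, zpow_add, Units.val_mul]

theorem zpow𝒜_zero (x : 𝒜 p k) : zpow𝒜 p k x 0 = 1 := pow_zero x

theorem zpow𝒜_natCast (x : 𝒜 p k) (n : ℕ) : zpow𝒜 p k x n = x ^ n := rfl

theorem zpow𝒜_mul_neg (hx : ev₀ p k x ≠ 0) (n : ℤ) : zpow𝒜 p k x n * zpow𝒜 p k x (-n) = 1 := by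
  rw [← zpow𝒜_add hx, add_neg_cancel, zpow𝒜_zero]

theorem mul_zpow𝒜 (hx : ev₀ p k x ≠ 0) (hy : ev₀ p k y ≠ 0) (n : ℤ) :
    zpow𝒜 p k (x * y) n = zpow𝒜 p k x n * zpow𝒜 p k y n := by
  obtain ⟨u, rfl⟩ := exists_unit hx
  obtain ⟨v, rfl⟩ := exists_unit hy
  rw [← Units.val_mul, zpow𝒜_eq, zpow𝒜_eq, zpow𝒜_eq, mul_zpow, Units.val_mul]

theorem map_zpow𝒜 (σ : 𝒜 p k →+* 𝒜 p k) (hx : ev₀ p k x ≠ 0) (n : ℤ) :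
    σ (zpow𝒜 p k x n) = zpow𝒜 p k (σ x) n := by
  obtain ⟨u, rfl⟩ := exists_unit hx
  have : (σ u) = ((Units.map σ.toMonoidHom u : (𝒜 p k)ˣ) : 𝒜 p k) := rfl
  rw [zpow𝒜_eq, this, zpow𝒜_eq, ← map_zpow]
  rfl

theorem prod_φ𝒜_iterate_zpow𝒜 (hE : IsEis E) (z : ℤ) (n : ℕ) :
    ∏ i ∈ Finset.range n, (φ𝒜 p k)^[i] (zpow𝒜 p k (E𝒜 p k E) z) = zpow𝒜 p k (eN E n) z := by
  induction n with
  | zero =>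
    have h1 : ((1 : (𝒜 p k)ˣ) : 𝒜 p k) = 1 := rfl
    rw [Finset.prod_range_zero, eN, Finset.prod_range_zero, ← h1, zpow𝒜_eq, one_zpow]
  | succ n ih =>
    have h0 := ev₀_E_ne_zero hE
    have h1 : ev₀ p k ((φ𝒜 p k)^[n] (E𝒜 p k E)) ≠ 0 := by
      rw [Ne, ← absK₀_eq_zero_iff p k, absK₀_ev₀_φ𝒜_iterate]
      exact absK₀_ne_zero p k h0
    rw [Finset.prod_range_succ, ih, eN_succ, mul_zpow𝒜 (ev₀_eN_ne_zero hE n) h1]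
    congr 1
    rw [← RingHom.coe_pow]
    exact map_zpow𝒜 _ h0 z

/-- Multiplication by `E⁻ˢ` turns the amplitude `[s, t]` into `[0, t - s]`. -/
theorem PIM₀_twist (hE : IsEis E) {r C : ℕ} {T : Matrix (Fin r) (Fin r) (𝒜 p k)} {s t : ℤ}
    (hst : s ≤ t)
    (h : ∀ n : ℕ, 1 ≤ n → ∃ Q Q' : Matrix (Fin r) (Fin r) (𝔖 p k),
      (p : 𝒜 p k) ^ C • Tprod T n = zpow𝒜 p k (eN E n) s • Q.map (ofS p k) ∧
      Tprod T n * Q'.map (ofS p k) = ((p : 𝒜 p k) ^ C * zpow𝒜 p k (eN E n) t) • 1) :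
    PIM₀ E (zpow𝒜 p k (E𝒜 p k E) (-s) • T) C (t - s).toNat := by
  obtain ⟨m, hm⟩ := Int.eq_ofNat_of_zero_le (sub_nonneg.2 hst)
  obtain rfl : t = s + m := by omega
  intro n hn
  obtain ⟨Q, Q', h1, h2⟩ := h n hn
  have he := ev₀_eN_ne_zero hE n
  refine ⟨Q, Q', ?_, ?_⟩
  · rw [Tprod_smul, prod_φ𝒜_iterate_zpow𝒜 hE, smul_comm, h1, smul_smul, mul_comm,
      zpow𝒜_mul_neg he, one_smul]
  · rw [Tprod_smul, prod_φ𝒜_iterate_zpow𝒜 hE, Matrix.smul_mul, h2, smul_smul, hm,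
      Int.toNat_natCast, mul_left_comm, ← zpow𝒜_add he, neg_add_cancel_left, zpow𝒜_natCast]

/-- The equation `E(0) λ = E φ(λ)` turns a solution for the twist `E⁻ˢ T` into one for `T`. -/
theorem comparison_untwist (hE : IsEis E) {r : ℕ} {T Y : Matrix (Fin r) (Fin r) (𝒜 p k)} {s : ℤ}
    (hY1 : Y.map (cst p k) = 1)
    (hY : Y * (zpow𝒜 p k (E𝒜 p k E) (-s) • T).map (cst p k) =
      (zpow𝒜 p k (E𝒜 p k E) (-s) • T) * Y.map (φ𝒜 p k)) :
    (zpow𝒜 p k (lam p k E) s • Y).map (cst p k) = 1 ∧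
      (zpow𝒜 p k (lam p k E) s • Y) * T.map (cst p k) =
        T * (zpow𝒜 p k (lam p k E) s • Y).map (φ𝒜 p k) := by
  have hE0 := ev₀_E_ne_zero hE
  obtain ⟨hl1, hl2⟩ := lam_spec hE
  have hl0 : ev₀ p k (lam p k E) ≠ 0 := by rw [hl1]; exact one_ne_zero
  have hfl0 : ev₀ p k (φ𝒜 p k (lam p k E)) ≠ 0 := by
    rw [ev₀_φ𝒜, hl1, map_one]; exact one_ne_zero
  have hC0 : ev₀ p k (PowerSeries.C (ev₀ p k (E𝒜 p k E))) ≠ 0 := by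
    rwa [PowerSeries.constantCoeff_C]
  have hsmul : ∀ (σ : 𝒜 p k →+* 𝒜 p k) (c : 𝒜 p k) (M : Matrix (Fin r) (Fin r) (𝒜 p k)),
      (c • M).map σ = σ c • M.map σ := fun σ c M => by
    ext1 i j
    exact map_mul σ _ _
  constructor
  · have h1 : cst p k (lam p k E) = ((1 : (𝒜 p k)ˣ) : 𝒜 p k) := by
      rw [cst_apply, hl1, map_one]; rfl
    rw [hsmul, hY1, map_zpow𝒜 _ hl0, h1, zpow𝒜_eq, one_zpow, Units.val_one, one_smul]
  · rw [hsmul, map_zpow𝒜 _ hE0, cst_apply, Matrix.mul_smul, Matrix.smul_mul] at hY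
    have h3 : zpow𝒜 p k (PowerSeries.C (ev₀ p k (E𝒜 p k E))) s * zpow𝒜 p k (lam p k E) s =
        zpow𝒜 p k (E𝒜 p k E) s * zpow𝒜 p k (φ𝒜 p k (lam p k E)) s := by
      rw [← mul_zpow𝒜 hC0 hl0, hl2, mul_zpow𝒜 hE0 hfl0]
    have h2 : zpow𝒜 p k (lam p k E) s • (Y * T.map (cst p k)) =
        zpow𝒜 p k (φ𝒜 p k (lam p k E)) s • (T * Y.map (φ𝒜 p k)) := by
      have h4 := zpow𝒜_mul_neg hC0 s
      have h5 := zpow𝒜_mul_neg hE0 s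
      calc _ = (zpow𝒜 p k (PowerSeries.C (ev₀ p k (E𝒜 p k E))) s * zpow𝒜 p k (lam p k E) s) •
            zpow𝒜 p k (PowerSeries.C (ev₀ p k (E𝒜 p k E))) (-s) • (Y * T.map (cst p k)) := by
            rw [smul_smul, mul_right_comm, h4, one_mul]
        _ = _ := by rw [hY, h3, smul_smul, mul_right_comm, h5, one_mul]
    rw [Matrix.smul_mul, h2, hsmul, map_zpow𝒜 _ hl0, Matrix.mul_smul]

theorem absK₀_ev₀_zpow_E (hE : IsEis E) (s : ℤ) :
    absK₀ p k (ev₀ p k (zpow𝒜 p k (E𝒜 p k E) (-s))) = (p : ℝ) ^ s := by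
  obtain ⟨u, hu⟩ := exists_unit (ev₀_E_ne_zero hE)
  have h1 : ev₀ p k (zpow𝒜 p k (E𝒜 p k E) (-s)) = ev₀ p k (E𝒜 p k E) ^ (-s) := by
    rw [← hu, zpow𝒜_eq]
    have h2 : ev₀ p k (u : 𝒜 p k) = ((Units.map (ev₀ p k).toMonoidHom u : (K₀ p k)ˣ) : K₀ p k) :=
      rfl
    rw [h2, ← Units.val_zpow_eq_zpow_val, ← map_zpow]
    rfl
  rw [h1, absK₀_zpow, absK₀_ev₀_E hE, inv_zpow', neg_neg]

theorem absK₀_ev₀_det_twist (hE : IsEis E) {r : ℕ} {T : Matrix (Fin r) (Fin r) (𝒜 p k)} (s : ℤ)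
    {n : ℤ} (hn : absK₀ p k (ev₀ p k T.det) = (p : ℝ) ^ (-n)) :
    absK₀ p k (ev₀ p k (zpow𝒜 p k (E𝒜 p k E) (-s) • T).det) = (p : ℝ) ^ (-(n - r * s)) := by
  rw [Matrix.det_smul, Fintype.card_fin, map_mul, map_pow, absK₀_mul, absK₀_pow,
    absK₀_ev₀_zpow_E hE, hn, ← zpow_natCast, ← zpow_mul, ← zpow_add₀ (p_real_pos p).ne']
  congr 1
  ring

/-- The twist of the equation that relates a basis of a sub-`φ`-module to the matrix of its
Frobenius. -/
theorem twist_cst_mul {r d : ℕ} {T : Matrix (Fin r) (Fin r) (𝒜 p k)}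
    {T₀ : Matrix (Fin r) (Fin r) (K₀ p k)} (hT : T.map (cst p k) = T₀.map PowerSeries.C)
    {B : Matrix (Fin r) (Fin d) (K₀ p k)} {P : Matrix (Fin d) (Fin d) (K₀ p k)}
    (h : T₀ * B.map (φK₀ p k) = B * P) (x : 𝒜 p k) :
    (x • T).map (cst p k) * (B.map PowerSeries.C).map (φ𝒜 p k) =
      B.map PowerSeries.C * (ev₀ p k x • P).map PowerSeries.C := by
  have h1 : (x • T).map (cst p k) = (ev₀ p k x • T₀).map PowerSeries.C := by
    ext1 i j
    have h2 := congrFun (congrFun hT i) j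
    rw [Matrix.map_apply, Matrix.map_apply] at h2
    rw [Matrix.map_apply, Matrix.map_apply, Matrix.smul_apply, Matrix.smul_apply, smul_eq_mul,
      smul_eq_mul, map_mul, map_mul, h2, cst_apply]
  have h3 : (B.map PowerSeries.C).map (φ𝒜 p k) = (B.map (φK₀ p k)).map PowerSeries.C :=
    Matrix.ext fun _ _ => φ𝒜_C _
  rw [h1, h3, ← Matrix.map_mul, ← Matrix.map_mul, Matrix.smul_mul, h, Matrix.mul_smul]

end Twist

/-! ### Lattices over a principal ideal domain -/

section Lattices

theorem isTorsionFree_fractionRing (R K : Type*) [CommRing R] [IsDomain R] [CommRing K]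
    [Algebra R K] [IsFractionRing R K] : Module.IsTorsionFree R K := by
  have : FaithfulSMul R K :=
    (faithfulSMul_iff_algebraMap_injective R K).2 (IsFractionRing.injective R K)
  have : IsDomain K := IsFractionRing.isDomain R
  exact .trans_faithfulSMul R K K

variable {R K V W : Type*} [CommRing R] [IsDomain R] [IsPrincipalIdealRing R] [CommRing K]
  [Algebra R K] [IsFractionRing R K] [AddCommGroup V] [Module R V] [Module K V]
  [IsScalarTower R K V] [AddCommGroup W] [Module R W] [Module K W] [IsScalarTower R K W]

/-- Over the fraction field of a principal ideal domain, the inverse image of a lattice by an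
injective linear map is a lattice. -/
theorem exists_basis_comap {r d : ℕ} (n : Module.Basis (Fin r) K W) (v : Module.Basis (Fin d) K V)
    {f : V →ₗ[K] W} (hf : Function.Injective f) :
    ∃ c : Module.Basis (Fin d) K V,
      (Submodule.span R (Set.range n)).comap (f.restrictScalars R) =
        Submodule.span R (Set.range c) := by
  have : Nontrivial K := (IsFractionRing.injective R K).nontrivial
  have := isTorsionFree_fractionRing R K
  set L := Submodule.span R (Set.range n) with hL
  set M := L.comap (f.restrictScalars R) with hM
  let g : M →ₗ[R] L := (f.restrictScalars R).restrict fun x hx => hx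
  have hg : Function.Injective g := fun x y h => Subtype.ext (hf (congrArg Subtype.val h))
  obtain ⟨m, bm⟩ := Submodule.basisOfPid (n.restrictScalars R) (LinearMap.range g)
  let cM : Module.Basis (Fin m) R M := bm.map (LinearEquiv.ofInjective g hg).symm
  have hli : LinearIndependent K fun i => (cM i : V) := by
    rw [← LinearIndependent.iff_fractionRing R K]
    exact cM.linearIndependent.map' M.subtype (Submodule.ker_subtype M)
  have hmem : ∀ x ∈ M, x ∈ Submodule.span R (Set.range fun i => (cM i : V)) := fun x hx => by
    have h1 : (⟨x, hx⟩ : M) ∈ Submodule.span R (Set.range cM) := cM.mem_span _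
    have h2 := Submodule.mem_map_of_mem (f := M.subtype) h1
    rwa [Submodule.map_span, ← Set.range_comp] at h2
  have hsp : ⊤ ≤ Submodule.span K (Set.range fun i => (cM i : V)) := by
    rw [← v.span_eq, Submodule.span_le]
    rintro _ ⟨j, rfl⟩
    obtain ⟨a, ha⟩ := IsLocalization.exist_integer_multiples_of_finite (nonZeroDivisors R)
      (fun i => n.repr (f (v j)) i)
    have h1 : (a : R) • v j ∈ M := by
      change f.restrictScalars R ((a : R) • v j) ∈ L
      rw [map_smul, LinearMap.restrictScalars_apply, ← n.sum_repr (f (v j)), Finset.smul_sum]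
      refine sum_mem fun i _ => ?_
      obtain ⟨y, hy⟩ := ha i
      rw [← smul_assoc, ← hy, algebraMap_smul]
      exact Submodule.smul_mem _ _ (Submodule.subset_span ⟨i, rfl⟩)
    have h2 := Submodule.span_le_restrictScalars R K _ (hmem _ h1)
    rw [Submodule.restrictScalars_mem, ← algebraMap_smul K] at h2
    have hu : IsUnit (algebraMap R K a) := IsLocalization.map_units K a
    obtain ⟨u, hu⟩ := hu
    rw [← hu] at h2
    have h3 := Submodule.smul_mem _ ((u⁻¹ : Kˣ) : K) h2
    rwa [smul_smul, Units.inv_mul, one_smul] at h3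
  let c := Module.Basis.mk hli hsp
  have hmd : m = d := by
    have := Module.finrank_eq_card_basis c
    rw [Module.finrank_eq_card_basis v] at this
    simpa using this.symm
  subst hmd
  refine ⟨c, le_antisymm (fun x hx => ?_) (Submodule.span_le.2 ?_)⟩
  · simpa only [c, Module.Basis.coe_mk] using hmem x hx
  · rintro _ ⟨i, rfl⟩
    simp only [c, Module.Basis.mk_apply]
    exact (cM i).2

/-- `x` is `e ^ n` times a unit of `R`; for `R` a discrete valuation ring with uniformizer `e`, this
says that `x` has order `n`. -/
def HasOrder (R : Type*) {K : Type*} [CommRing R] [CommRing K] [Algebra R K] (e : Kˣ) (x : K)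
    (n : ℤ) : Prop :=
  ∃ w : Rˣ, x = ((e ^ n : Kˣ) : K) * algebraMap R K w

end Lattices

section Order

variable {R K : Type*} [CommRing R] [CommRing K] [Algebra R K] {e : Kˣ} {x y : K} {m n : ℤ}

theorem HasOrder.mul (hx : HasOrder R e x m) (hy : HasOrder R e y n) :
    HasOrder R e (x * y) (m + n) := by
  obtain ⟨v, rfl⟩ := hx
  obtain ⟨w, rfl⟩ := hy
  refine ⟨v * w, ?_⟩
  rw [zpow_add, Units.val_mul, Units.val_mul, map_mul]
  ring

theorem hasOrder_zpow (n : ℤ) : HasOrder R e ((e ^ n : Kˣ) : K) n := ⟨1, by simp⟩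

theorem HasOrder.zpow {u : Kˣ} (hu : HasOrder R e (u : K) m) (n : ℤ) :
    HasOrder R e ((u ^ n : Kˣ) : K) (m * n) := by
  obtain ⟨w, hw⟩ := hu
  refine ⟨w ^ n, ?_⟩
  have h1 : u = e ^ m * Units.map (algebraMap R K).toMonoidHom w := Units.ext hw
  rw [h1, mul_zpow, ← zpow_mul, ← map_zpow]
  rfl

theorem HasOrder.isUnit (hx : HasOrder R e x m) : IsUnit x := by
  obtain ⟨w, rfl⟩ := hx
  exact (Units.isUnit _).mul (w.isUnit.map _)

theorem HasOrder.of_mul_eq_one (hx : HasOrder R e x m) (h : x * y = 1) : HasOrder R e y (-m) := by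
  obtain ⟨w, rfl⟩ := hx
  refine ⟨w⁻¹, ?_⟩
  have h1 : (((e ^ m : Kˣ) : K) * algebraMap R K w) *
      (((e ^ (-m) : Kˣ) : K) * algebraMap R K (w⁻¹ : Rˣ)) = 1 := by
    rw [mul_mul_mul_comm, ← Units.val_mul, ← zpow_add, ← map_mul, Units.mul_inv]
    simp
  exact ((Units.isUnit _).mul (w.isUnit.map (algebraMap R K))).mul_left_cancel (h.trans h1.symm)

end Order

/-! ### Bases of extensions of scalars -/

section ExtBasis

variable {A B M : Type*} [CommRing A] [CommRing B] (σ : A →+* B) [AddCommGroup M] [Module A M]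
  {ι : Type*}

/-- The basis `1 ⊗ b i` of `B ⊗_{A, σ} M`. -/
def Ext.basis (b : Module.Basis ι A M) : Module.Basis ι B (Ext σ M) :=
  letI : Algebra A B := σ.toAlgebra
  Algebra.TensorProduct.basis B b

theorem Ext.basis_apply (b : Module.Basis ι A M) (i : ι) : Ext.basis σ b i = Ext.mk σ (b i) :=
  letI : Algebra A B := σ.toAlgebra
  Algebra.TensorProduct.basis_apply b i

/-- Two additive maps that are semilinear for the same morphism agree if they do on a basis. -/
theorem eq_of_eq_on_basis {P : Type*} [AddCommGroup P] [Module B P] (b : Module.Basis ι A M)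
    {f g : M → P} (hf : ∀ x y, f (x + y) = f x + f y) (hg : ∀ x y, g (x + y) = g x + g y)
    (hf' : ∀ (a : A) x, f (a • x) = σ a • f x) (hg' : ∀ (a : A) x, g (a • x) = σ a • g x)
    (h : ∀ i, f (b i) = g (b i)) : f = g := by
  let F : M →ₛₗ[σ] P := { toFun := f, map_add' := hf, map_smul' := hf' }
  let G : M →ₛₗ[σ] P := { toFun := g, map_add' := hg, map_smul' := hg' }
  have : F = G := b.ext h
  exact congrArg (fun F : M →ₛₗ[σ] P => (F : M → P)) this

variable {σ}

theorem Ext.linearization_mk {P : Type*} [AddCommGroup P] [Module B P] (f : M →ₛₗ[σ] P) (m : M) :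
    Ext.linearization σ f (Ext.mk σ m) = f m := Ext.lift_mk _ _ _ _ _

theorem Ext.map_mk {M' : Type*} [AddCommGroup M'] [Module A M'] (f : M →ₗ[A] M') (m : M) :
    Ext.map σ f (Ext.mk σ m) = Ext.mk σ (f m) := Ext.linearization_mk _ _

theorem Ext.push_mk {C : Type*} [CommRing C] (τ : B →+* C) (ρ : A →+* C)
    (h : ∀ a, τ (σ a) = ρ a) (m : M) :
    Ext.push σ τ ρ h (Ext.mk σ m) = Ext.mk ρ m := Ext.lift_mk _ _ _ _ _

theorem Ext.push_sum {C κ : Type*} [CommRing C] [Fintype κ] (τ : B →+* C) (ρ : A →+* C)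
    (h : ∀ a, τ (σ a) = ρ a) (x : κ → B) (m : κ → M) :
    Ext.push σ τ ρ h (∑ i, x i • Ext.mk σ (m i)) = ∑ i, τ (x i) • Ext.mk ρ (m i) := by
  rw [map_sum]
  exact Finset.sum_congr rfl fun i _ => by rw [LinearMap.map_smulₛₗ, Ext.push_mk]

end ExtBasis

/-! ### The comparison map in terms of matrices -/

section Comparison

variable {p : ℕ} [Fact p.Prime] {k : Type*} [Field k] [CharP k p] [PerfectRing k p]
  {E : (W p k)[X]} {N : Type*} [AddCommGroup N] [Module (Sp p k) N]
  {φN : N →ₛₗ[φSpE p k E] InvE p k E N} {r : ℕ} {b : Module.Basis (Fin r) (Sp p k) N}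
  {T : Matrix (Fin r) (Fin r) (SpE p k E)}

variable (T) in
/-- The matrix of `φ_D`. -/
def T₀ : Matrix (Fin r) (Fin r) (K₀ p k) := T.map ((ev₀ p k).comp (SpETo𝒜 p k E))

variable (T) in
/-- The matrix of `φ_N`, with coefficients in `𝒜`. -/
def T𝒜 : Matrix (Fin r) (Fin r) (𝒜 p k) := T.map (SpETo𝒜 p k E)

theorem T𝒜_map_cst : (T𝒜 T).map (cst p k) = (T₀ T).map PowerSeries.C := rfl

theorem phiD_mk (h : ∀ a, ((ev₀ p k).comp (SpETo𝒜 p k E)) (SpToSpE p k E a) = SpTo₀ p k a)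
    (n : N) : phiD E φN (Ext.mk (SpTo₀ p k) n) =
      Ext.push (SpToSpE p k E) ((ev₀ p k).comp (SpETo𝒜 p k E)) (SpTo₀ p k) h (φN n) :=
  Ext.lift_mk _ _ _ _ _

theorem phiN𝒜_mk (h : ∀ a, SpETo𝒜 p k E (SpToSpE p k E a) = SpTo𝒜 p k a) (n : N) :
    phiN𝒜 E φN (Ext.mk (SpTo𝒜 p k) n) =
      Ext.push (SpToSpE p k E) (SpETo𝒜 p k E) (SpTo𝒜 p k) h (φN n) :=
  Ext.lift_mk _ _ _ _ _

theorem phiD_apply (hT : ∀ j, φN (b j) = ∑ i, T i j • Ext.mk (SpToSpE p k E) (b i)) (j : Fin r) :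
    phiD E φN (Ext.basis (SpTo₀ p k) b j) = ∑ i, T₀ T i j • Ext.basis (SpTo₀ p k) b i := by
  simp only [Ext.basis_apply]
  rw [phiD_mk fun _ => rfl, hT]
  exact Ext.push_sum _ _ _ _ _

theorem phiN𝒜_apply (hT : ∀ j, φN (b j) = ∑ i, T i j • Ext.mk (SpToSpE p k E) (b i)) (j : Fin r) :
    phiN𝒜 E φN (Ext.basis (SpTo𝒜 p k) b j) = ∑ i, T𝒜 T i j • Ext.basis (SpTo𝒜 p k) b i := by
  simp only [Ext.basis_apply]
  rw [phiN𝒜_mk fun _ => rfl, hT]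
  exact Ext.push_sum _ _ _ _ _

theorem basis_sum_inj {R P : Type*} [CommRing R] [AddCommGroup P] [Module R P]
    (c : Module.Basis (Fin r) R P) {x y : Fin r → R} :
    ∑ i, x i • c i = ∑ i, y i • c i ↔ x = y := by
  refine ⟨fun h => ?_, fun h => by rw [h]⟩
  have := congrArg c.equivFun h
  rwa [← c.equivFun_symm_apply, ← c.equivFun_symm_apply, LinearEquiv.apply_symm_apply,
    LinearEquiv.apply_symm_apply] at this

theorem basis_sum_eq_basis {R P : Type*} [CommRing R] [AddCommGroup P] [Module R P]
    (c : Module.Basis (Fin r) R P) {x : Fin r → R} {j : Fin r} :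
    ∑ i, x i • c i = c j ↔ ∀ i, x i = (1 : Matrix (Fin r) (Fin r) R) i j := by
  have h : c j = ∑ i, (1 : Matrix (Fin r) (Fin r) R) i j • c i := by simp [Matrix.one_apply]
  rw [h, basis_sum_inj, funext_iff]

theorem forall_eq_iff_matrix_eq {A B M P : Type*} [CommRing A] [CommRing B] {σ : A →+* B}
    [AddCommGroup M] [Module A M] [AddCommGroup P] [Module B P] (d : Module.Basis (Fin r) A M)
    (c : Module.Basis (Fin r) B P) {f g : M → P} {X Y : Matrix (Fin r) (Fin r) B}
    (hf : ∀ x y, f (x + y) = f x + f y) (hg : ∀ x y, g (x + y) = g x + g y)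
    (hf' : ∀ (a : A) x, f (a • x) = σ a • f x) (hg' : ∀ (a : A) x, g (a • x) = σ a • g x)
    (hX : ∀ j, f (d j) = ∑ i, X i j • c i) (hY : ∀ j, g (d j) = ∑ i, Y i j • c i) :
    (∀ y, f y = g y) ↔ X = Y := by
  constructor
  · intro h
    ext1 i j
    exact congrFun ((basis_sum_inj c).1 ((hX j).symm.trans ((h (d j)).trans (hY j)))) i
  · intro h
    exact congrFun (eq_of_eq_on_basis σ d hf hg hf' hg' fun j => by rw [hX, hY, h])

/-- The first condition on `ξ`, in terms of its matrix `X`. -/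
theorem mod_u_iff {ξ : D𝒪lam p k E N →ₗ[𝒪lam p k E] N𝒪lam p k E N}
    {X : Matrix (Fin r) (Fin r) (𝒪lam p k E)}
    (hX : ∀ j, ξ (Ext.mk _ (Ext.basis (SpTo₀ p k) b j)) =
      ∑ i, X i j • Ext.mk (SpTo𝒪lam p k E) (b i))
    (h₀ : ∀ a, ((ev₀ p k).comp (𝒪lamTo𝒜 p k E)) (SpTo𝒪lam p k E a) = SpTo₀ p k a) :
    (∀ y : Dmod p k N,
      Ext.push (SpTo𝒪lam p k E) ((ev₀ p k).comp (𝒪lamTo𝒜 p k E)) (SpTo₀ p k) h₀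
        (ξ (Ext.mk _ y)) = y) ↔ (X.map (𝒪lamTo𝒜 p k E)).map (cst p k) = 1 := by
  have h4 : ∀ j, Ext.push (SpTo𝒪lam p k E) ((ev₀ p k).comp (𝒪lamTo𝒜 p k E)) (SpTo₀ p k) h₀
      (ξ (Ext.mk _ (Ext.basis (SpTo₀ p k) b j))) = Ext.basis (SpTo₀ p k) b j ↔
      ∀ i, ev₀ p k (𝒪lamTo𝒜 p k E (X i j)) = (1 : Matrix (Fin r) (Fin r) (K₀ p k)) i j :=
    fun j => by
      rw [hX, Ext.push_sum]
      simp only [← Ext.basis_apply]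
      exact basis_sum_eq_basis _
  have h5 : (∀ i j, ev₀ p k (𝒪lamTo𝒜 p k E (X i j)) =
      (1 : Matrix (Fin r) (Fin r) (K₀ p k)) i j) ↔
      (X.map (𝒪lamTo𝒜 p k E)).map (cst p k) = 1 := by
    have h6 : (1 : Matrix (Fin r) (Fin r) (𝒜 p k)) =
        (1 : Matrix (Fin r) (Fin r) (K₀ p k)).map PowerSeries.C :=
      (Matrix.map_one _ (map_zero _) (map_one _)).symm
    rw [h6]
    constructor
    · intro h
      ext1 i j
      exact congrArg PowerSeries.C (h i j)
    · intro h i j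
      exact PowerSeries.C_injective (congrFun (congrFun h i) j)
  rw [← h5]
  constructor
  · exact fun h i j => (h4 j).1 (h _) i
  · intro h y
    refine congrFun (eq_of_eq_on_basis (RingHom.id (K₀ p k)) (Ext.basis (SpTo₀ p k) b)
      (f := fun y => Ext.push (SpTo𝒪lam p k E) ((ev₀ p k).comp (𝒪lamTo𝒜 p k E)) (SpTo₀ p k) h₀
        (ξ (Ext.mk _ y))) (g := id) (fun x y => ?_) (fun x y => rfl)
      (fun a x => ?_) (fun a x => rfl) fun j => (h4 j).2 fun i => h i j) y
    · simp only [map_add]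
    · simp only [LinearMap.map_smulₛₗ, map_smul]
      refine congrArg (· • _) ?_
      exact PowerSeries.constantCoeff_C a

set_option maxHeartbeats 800000 in
/-- The second condition on `ξ`, in terms of its matrix `X`. -/
theorem comm_iff (hT : ∀ j, φN (b j) = ∑ i, T i j • Ext.mk (SpToSpE p k E) (b i))
    {ξ : D𝒪lam p k E N →ₗ[𝒪lam p k E] N𝒪lam p k E N}
    {X : Matrix (Fin r) (Fin r) (𝒪lam p k E)}
    (hX : ∀ j, ξ (Ext.mk _ (Ext.basis (SpTo₀ p k) b j)) =
      ∑ i, X i j • Ext.mk (SpTo𝒪lam p k E) (b i))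
    (h𝒜 : ∀ a, 𝒪lamTo𝒜 p k E (SpTo𝒪lam p k E a) = SpTo𝒜 p k a) :
    (∀ y : Dmod p k N,
      Ext.push (SpTo𝒪lam p k E) (𝒪lamTo𝒜 p k E) (SpTo𝒜 p k) h𝒜
        (ξ (Ext.mk _ (phiD E φN y))) =
      phiN𝒜 E φN (Ext.push (SpTo𝒪lam p k E) (𝒪lamTo𝒜 p k E) (SpTo𝒜 p k) h𝒜
        (ξ (Ext.mk _ y)))) ↔ X.map (𝒪lamTo𝒜 p k E) * (T𝒜 T).map (cst p k) =
        T𝒜 T * (X.map (𝒪lamTo𝒜 p k E)).map (φ𝒜 p k) := by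
  set d := Ext.basis (SpTo₀ p k) b with hd
  set X' := X.map (𝒪lamTo𝒜 p k E) with hX'
  have h4 : ∀ j, Ext.push (SpTo𝒪lam p k E) (𝒪lamTo𝒜 p k E) (SpTo𝒜 p k) h𝒜
      (ξ (Ext.mk _ (d j))) = ∑ i, X' i j • Ext.basis (SpTo𝒜 p k) b i := fun j => by
    rw [hX, Ext.push_sum]
    simp only [← Ext.basis_apply]
    rfl
  have h5 : ∀ j, Ext.push (SpTo𝒪lam p k E) (𝒪lamTo𝒜 p k E) (SpTo𝒜 p k) h𝒜
        (ξ (Ext.mk _ (phiD E φN (d j)))) =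
      ∑ i, (X' * (T𝒜 T).map (cst p k)) i j • Ext.basis (SpTo𝒜 p k) b i := fun j => by
    rw [hd, phiD_apply hT, ← hd]
    simp only [map_sum, LinearMap.map_smulₛₗ, h4, map_smul, Finset.smul_sum, smul_smul]
    rw [Finset.sum_comm]
    refine Finset.sum_congr rfl fun i _ => ?_
    rw [Matrix.mul_apply, Finset.sum_smul]
    exact Finset.sum_congr rfl fun l _ => by rw [mul_comm]; rfl
  have h6 : ∀ j, phiN𝒜 E φN (Ext.push (SpTo𝒪lam p k E) (𝒪lamTo𝒜 p k E) (SpTo𝒜 p k)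
        h𝒜 (ξ (Ext.mk _ (d j)))) =
      ∑ i, (T𝒜 T * X'.map (φ𝒜 p k)) i j • Ext.basis (SpTo𝒜 p k) b i := fun j => by
    rw [h4]
    simp only [map_sum, LinearMap.map_smulₛₗ, phiN𝒜_apply hT, Finset.smul_sum, smul_smul]
    rw [Finset.sum_comm]
    refine Finset.sum_congr rfl fun i _ => ?_
    rw [Matrix.mul_apply, Finset.sum_smul]
    exact Finset.sum_congr rfl fun l _ => by rw [mul_comm]; rfl
  refine forall_eq_iff_matrix_eq (σ := (PowerSeries.C).comp (φK₀ p k)) d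
    (Ext.basis (SpTo𝒜 p k) b)
    (f := fun y => Ext.push (SpTo𝒪lam p k E) (𝒪lamTo𝒜 p k E) (SpTo𝒜 p k) h𝒜
      (ξ (Ext.mk _ (phiD E φN y))))
    (g := fun y => phiN𝒜 E φN (Ext.push (SpTo𝒪lam p k E) (𝒪lamTo𝒜 p k E) (SpTo𝒜 p k) h𝒜
      (ξ (Ext.mk _ y)))) (fun x y => ?_) (fun x y => ?_) (fun a x => ?_) (fun a x => ?_) h5 h6
  · simp only [map_add]
  · simp only [map_add]
  · simp only [LinearMap.map_smulₛₗ, map_smul]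
    rfl
  · simp only [LinearMap.map_smulₛₗ, map_smul]
    refine congrArg (· • _) ?_
    exact φ𝒜_C a

end Comparison

section Comparison

variable {p : ℕ} [Fact p.Prime] {k : Type*} [Field k] [CharP k p] [PerfectRing k p]
  {E : (W p k)[X]} {N : Type*} [AddCommGroup N] [Module (Sp p k) N]
  {φN : N →ₛₗ[φSpE p k E] InvE p k E N} {r : ℕ} {b : Module.Basis (Fin r) (Sp p k) N}
  {T : Matrix (Fin r) (Fin r) (SpE p k E)}

variable (b) in
/-- `X` is the matrix of the linear map `ξ : D ⊗ 𝒪[1/λ] → N ⊗ 𝒪[1/λ]` in the bases given by a basis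
of `N`. -/
def IsMatrixOf (ξ : D𝒪lam p k E N →ₗ[𝒪lam p k E] N𝒪lam p k E N)
    (X : Matrix (Fin r) (Fin r) (𝒪lam p k E)) : Prop :=
  ∀ j, ξ (Ext.mk _ (Ext.basis (SpTo₀ p k) b j)) = ∑ i, X i j • Ext.mk (SpTo𝒪lam p k E) (b i)

theorem exists_isMatrixOf (ξ : D𝒪lam p k E N →ₗ[𝒪lam p k E] N𝒪lam p k E N) :
    ∃ X, IsMatrixOf b ξ X := by
  refine ⟨fun i j => (Ext.basis (SpTo𝒪lam p k E) b).repr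
    (ξ (Ext.mk _ (Ext.basis (SpTo₀ p k) b j))) i, fun j => ?_⟩
  have h := (Ext.basis (SpTo𝒪lam p k E) b).sum_repr (ξ (Ext.mk _ (Ext.basis (SpTo₀ p k) b j)))
  simp only [Ext.basis_apply (SpTo𝒪lam p k E)] at h
  exact h.symm

theorem exists_linearMap_isMatrixOf (X : Matrix (Fin r) (Fin r) (𝒪lam p k E)) :
    ∃ ξ : D𝒪lam p k E N →ₗ[𝒪lam p k E] N𝒪lam p k E N, IsMatrixOf b ξ X := by
  let dd := Ext.basis (algebraMap (K₀ p k) (𝒪lam p k E)) (Ext.basis (SpTo₀ p k) b)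
  refine ⟨dd.constr (𝒪lam p k E) fun j => ∑ i, X i j • Ext.mk (SpTo𝒪lam p k E) (b i),
    fun j => ?_⟩
  have h := dd.constr_basis (𝒪lam p k E)
    (fun j => ∑ i, X i j • Ext.mk (SpTo𝒪lam p k E) (b i)) j
  rw [Ext.basis_apply] at h
  exact h

theorem IsMatrixOf.ext {ξ ξ' : D𝒪lam p k E N →ₗ[𝒪lam p k E] N𝒪lam p k E N}
    {X : Matrix (Fin r) (Fin r) (𝒪lam p k E)} (h : IsMatrixOf b ξ X) (h' : IsMatrixOf b ξ' X) :
    ξ = ξ' := by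
  refine (Ext.basis (algebraMap (K₀ p k) (𝒪lam p k E)) (Ext.basis (SpTo₀ p k) b)).ext fun j => ?_
  rw [Ext.basis_apply]
  exact (h j).trans (h' j).symm

/-- In terms of bases, a comparison map is a matrix `X` over `𝒪[1/λ]` with `X ≡ 1` and
`X T(0) = T φ(X)`. -/
theorem IsMatrixOf.isComparison_iff
    (hT : ∀ j, φN (b j) = ∑ i, T i j • Ext.mk (SpToSpE p k E) (b i))
    {ξ : D𝒪lam p k E N →ₗ[𝒪lam p k E] N𝒪lam p k E N} {X : Matrix (Fin r) (Fin r) (𝒪lam p k E)}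
    (hX : IsMatrixOf b ξ X) :
    IsComparison E φN ξ ↔ (X.map (𝒪lamTo𝒜 p k E)).map (cst p k) = 1 ∧
      X.map (𝒪lamTo𝒜 p k E) * (T𝒜 T).map (cst p k) =
        T𝒜 T * (X.map (𝒪lamTo𝒜 p k E)).map (φ𝒜 p k) :=
  ⟨fun h => ⟨(mod_u_iff hX fun _ => rfl).1 h.1, (comm_iff hT hX fun _ => rfl).1 h.2⟩,
    fun h => ⟨(mod_u_iff hX fun _ => rfl).2 h.1, (comm_iff hT hX fun _ => rfl).2 h.2⟩⟩

theorem zpow𝒜_lam_mem (hE : IsEis E) (s : ℤ) : zpow𝒜 p k (lam p k E) s ∈ 𝒪lam p k E := by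
  have hl : lam p k E ∈ 𝒪lam p k E := (𝒪To𝒪lam p k E (lam𝒪 p k E hE)).2
  cases s with
  | ofNat n => exact pow_mem hl n
  | negSucc n => exact pow_mem lam_inv_mem (n + 1)

/-- The comparison map exists and is unique, and its matrix is `λ ^ s` times a matrix `Y` with
coefficients in `𝒪`, the solution of the equation for the twist `E⁻ˢ T`. -/
theorem existsUnique_comparison (hE : IsEis E)
    (hT : ∀ j, φN (b j) = ∑ i, T i j • Ext.mk (SpToSpE p k E) (b i)) {C m : ℕ} {s : ℤ}
    (h : PIM₀ E (zpow𝒜 p k (E𝒜 p k E) (-s) • T𝒜 T) C m) :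
    (∃! ξ, IsComparison E φN ξ) ∧ ∃ Y : Matrix (Fin r) (Fin r) (𝒜 p k), Y.map (cst p k) = 1 ∧
      Y * (zpow𝒜 p k (E𝒜 p k E) (-s) • T𝒜 T).map (cst p k) =
        (zpow𝒜 p k (E𝒜 p k E) (-s) • T𝒜 T) * Y.map (φ𝒜 p k) ∧
      ∀ ξ X, IsComparison E φN ξ → IsMatrixOf b ξ X →
        X.map (𝒪lamTo𝒜 p k E) = zpow𝒜 p k (lam p k E) s • Y := by
  have hdet : ev₀ p k (T𝒜 T).det ≠ 0 := fun h0 => by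
    have := h.ev₀_det_ne_zero hE
    rw [Matrix.det_smul, map_mul, h0, mul_zero] at this
    exact this rfl
  obtain ⟨S, hS⟩ := exists_inverse_cst (h.ev₀_det_ne_zero hE)
  obtain ⟨S', hS'⟩ := exists_inverse_cst hdet
  obtain ⟨Y, hY1, hY⟩ := exists_formal_solution hS
  obtain ⟨hX1, hX⟩ := comparison_untwist hE hY1 hY
  have huniq : ∀ ξ X, IsComparison E φN ξ → IsMatrixOf b ξ X →
      X.map (𝒪lamTo𝒜 p k E) = zpow𝒜 p k (lam p k E) s • Y := fun ξ X hξ hξX => by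
    obtain ⟨h1, h2⟩ := (hξX.isComparison_iff hT).1 hξ
    exact formal_solution_unique hS' h1 hX1 h2 hX
  refine ⟨?_, Y, hY1, hY, huniq⟩
  have hmem : ∀ i j, (zpow𝒜 p k (lam p k E) s • Y) i j ∈ 𝒪lam p k E := fun i j =>
    mul_mem (zpow𝒜_lam_mem hE s) (𝒪To𝒪lam p k E ⟨_, h.mem_𝒪 hE hY1 hY i j⟩).2
  let X : Matrix (Fin r) (Fin r) (𝒪lam p k E) := fun i j => ⟨_, hmem i j⟩
  have hXX : X.map (𝒪lamTo𝒜 p k E) = zpow𝒜 p k (lam p k E) s • Y := rfl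
  obtain ⟨ξ, hξ⟩ := exists_linearMap_isMatrixOf (N := N) (b := b) X
  refine ⟨ξ, (hξ.isComparison_iff hT).2 (by rw [hXX]; exact ⟨hX1, hX⟩), fun ξ' hξ' => ?_⟩
  obtain ⟨X', hX'⟩ := exists_isMatrixOf (b := b) ξ'
  have h1 : X' = X := by
    ext1 i j
    exact Subtype.ext (congrFun (congrFun (huniq ξ' X' hξ' hX') i) j)
  exact (h1 ▸ hX').ext hξ

end Comparison

/-! ### Inverse images of lattices in terms of matrices -/

section LinearAlgebra

variable {K V W : Type*} [CommRing K] [AddCommGroup V] [Module K V] [AddCommGroup W] [Module K W]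
  {r d : ℕ} {v : Module.Basis (Fin d) K V} {n : Module.Basis (Fin r) K W} {f : V →ₗ[K] W}
  {M : Matrix (Fin r) (Fin d) K}

theorem eq_toLin (hf : ∀ j, f (v j) = ∑ i, M i j • n i) : f = Matrix.toLin v n M :=
  v.ext fun j => by rw [hf, Matrix.toLin_self]

theorem injective_of_matrix (hf : ∀ j, f (v j) = ∑ i, M i j • n i)
    {L : Matrix (Fin d) (Fin r) K} (hL : L * M = 1) : Function.Injective f := by
  have h : (Matrix.toLin n v L).comp f = LinearMap.id := by
    rw [eq_toLin hf, ← Matrix.toLin_mul, hL, Matrix.toLin_one]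
  exact Function.LeftInverse.injective (g := Matrix.toLin n v L) fun x => LinearMap.congr_fun h x

theorem surjective_of_matrix (hf : ∀ j, f (v j) = ∑ i, M i j • n i)
    {P : Matrix (Fin d) (Fin r) K} (hP : M * P = 1) : Function.Surjective f := by
  have h : f.comp (Matrix.toLin n v P) = LinearMap.id := by
    rw [eq_toLin hf, ← Matrix.toLin_mul, hP, Matrix.toLin_one]
  exact Function.RightInverse.surjective (g := Matrix.toLin n v P) fun x =>
    LinearMap.congr_fun h x

/-- The inverse image of the lattice with basis `n`, by an isomorphism with matrix `M`, has a basis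
with matrix `M⁻¹`. -/
theorem exists_basis_comap_of_mul_eq_one {R : Type*} [CommRing R] [Algebra R K] [Module R V]
    [IsScalarTower R K V] [Module R W] [IsScalarTower R K W] {n : Module.Basis (Fin d) K W}
    {M P : Matrix (Fin d) (Fin d) K} (hf : ∀ j, f (v j) = ∑ i, M i j • n i) (hP : M * P = 1) :
    ∃ c : Module.Basis (Fin d) K V,
      (Submodule.span R (Set.range n)).comap (f.restrictScalars R) =
        Submodule.span R (Set.range c) ∧ ∀ j, c j = ∑ i, P i j • v i := by
  have hinj := injective_of_matrix hf (mul_eq_one_comm.1 hP)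
  let e : V ≃ₗ[K] W := LinearEquiv.ofBijective f ⟨hinj, surjective_of_matrix hf hP⟩
  have hc : ∀ j, f ((n.map e.symm) j) = n j := fun j => by
    rw [Module.Basis.map_apply]
    exact e.apply_symm_apply (n j)
  refine ⟨n.map e.symm, ?_, fun j => hinj ?_⟩
  · have h1 : Submodule.span R (Set.range n) =
        (Submodule.span R (Set.range (n.map e.symm))).map (f.restrictScalars R) := by
      rw [Submodule.map_span, ← Set.range_comp]
      congr 2
      exact funext fun j => (hc j).symm
    rw [h1]
    exact Submodule.comap_map_eq_of_injective (f := f.restrictScalars R) hinj _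
  · rw [hc, ← Matrix.toLin_self n v, eq_toLin hf, ← LinearMap.comp_apply, ← Matrix.toLin_mul, hP,
      Matrix.toLin_one, LinearMap.id_apply]

/-- The inverse image of the lattice with basis `n`, by an injective map with matrix `M`, has a
basis `c`; if `P` expresses it in the basis `v`, then `M P` has coefficients in `R`. -/
theorem exists_basis_comap_of_left_inverse {R : Type*} [CommRing R] [IsDomain R]
    [IsPrincipalIdealRing R] [Algebra R K] [IsFractionRing R K] [Module R V] [IsScalarTower R K V]
    [Module R W] [IsScalarTower R K W] (hf : ∀ j, f (v j) = ∑ i, M i j • n i)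
    {L : Matrix (Fin d) (Fin r) K} (hL : L * M = 1) :
    ∃ (c : Module.Basis (Fin d) K V) (P : Matrix (Fin d) (Fin d) K)
      (Z : Matrix (Fin r) (Fin d) R),
      (Submodule.span R (Set.range n)).comap (f.restrictScalars R) =
        Submodule.span R (Set.range c) ∧ (∀ j, c j = ∑ i, P i j • v i) ∧ IsUnit P.det ∧
      M * P = Z.map (algebraMap R K) := by
  obtain ⟨c, hc⟩ := exists_basis_comap (R := R) n v (injective_of_matrix hf hL)
  have hcP : ∀ j, c j = ∑ i, v.toMatrix c i j • v i := fun j =>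
    (v.sum_toMatrix_smul_self c j).symm
  have hZ : ∀ i j, ∃ z : R, (M * v.toMatrix c) i j = algebraMap R K z := fun i j => by
    have h1 : f (c j) ∈ Submodule.span R (Set.range n) := by
      have h2 : c j ∈ Submodule.span R (Set.range c) := Submodule.subset_span ⟨j, rfl⟩
      rw [← hc] at h2
      exact h2
    have : Nontrivial K := (IsFractionRing.injective R K).nontrivial
    have := isTorsionFree_fractionRing R K
    rw [n.mem_span_iff_repr_mem R] at h1
    obtain ⟨z, hz⟩ := h1 i
    refine ⟨z, ?_⟩
    have h3 : f (c j) = ∑ i, (M * v.toMatrix c) i j • n i := by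
      conv_lhs => rw [hcP j]
      rw [← Matrix.toLin_self v v, eq_toLin hf, ← LinearMap.comp_apply, ← Matrix.toLin_mul,
        Matrix.toLin_self]
    rw [hz, h3, ← n.equivFun_apply, ← n.equivFun_symm_apply, LinearEquiv.apply_symm_apply]
  choose Z hZ using hZ
  exact ⟨c, v.toMatrix c, Z, hc, hcP, by rw [← Module.Basis.det_apply]; exact v.isUnit_det c,
    Matrix.ext hZ⟩

/-- A matrix is invertible if its columns generate. -/
theorem isUnit_det_of_top_le_span {K V : Type*} [Field K] [AddCommGroup V] [Module K V] {d : ℕ}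
    (v : Module.Basis (Fin d) K V) {P : Matrix (Fin d) (Fin d) K}
    (h : ⊤ ≤ Submodule.span K (Set.range fun j => ∑ i, P i j • v i)) : IsUnit P.det := by
  have hfin : Module.Finite K V := Module.Finite.of_basis v
  have hli := linearIndependent_of_top_le_span_of_card_eq_finrank h
    (Module.finrank_eq_card_basis v).symm
  have h1 := (Module.Basis.is_basis_iff_det v).1 ⟨hli, top_le_iff.1 h⟩
  rw [Module.Basis.det_apply] at h1
  convert h1
  ext1 i j
  rw [Module.Basis.toMatrix_apply, ← v.equivFun_apply, ← v.equivFun_symm_apply,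
    LinearEquiv.apply_symm_apply]

end LinearAlgebra

/-! ### Orders -/

section Order

variable {R K : Type*} [CommRing R] [CommRing K] [Algebra R K] {e : Kˣ} {ε : R}

theorem HasOrder.of_mul {x y : K} {m n : ℤ} (hx : HasOrder R e x m) (h : HasOrder R e (x * y) n) :
    HasOrder R e y (n - m) := by
  obtain ⟨u, rfl⟩ := hx.isUnit
  have h1 := (hx.of_mul_eq_one u.mul_inv).mul h
  rwa [← mul_assoc, Units.inv_mul, one_mul, neg_add_eq_sub] at h1

theorem HasOrder.pow {x : K} {m : ℤ} (hx : HasOrder R e x m) (n : ℕ) :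
    HasOrder R e (x ^ n) (n * m) := by
  obtain ⟨u, rfl⟩ := hx.isUnit
  have h := hx.zpow n
  rwa [zpow_natCast, Units.val_pow_eq_pow_val, mul_comm] at h

theorem hasOrder_algebraMap {x : R} (hx : IsUnit x) : HasOrder R e (algebraMap R K x) 0 := by
  obtain ⟨w, rfl⟩ := hx
  exact ⟨w, by simp⟩

/-- If `x q = z` with `x`, `z` in `R` and `q` of order `-n`, then `x` is divisible by `ε ^ n`. -/
theorem pow_toNat_dvd (hinj : Function.Injective (algebraMap R K)) (he : (e : K) = algebraMap R K ε)
    {x z : R} {q : K} {n : ℤ} (hq : HasOrder R e q (-n))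
    (h : algebraMap R K x * q = algebraMap R K z) : ε ^ n.toNat ∣ x := by
  obtain hn | hn := le_or_gt n 0
  · rw [Int.toNat_of_nonpos hn, pow_zero]
    exact one_dvd x
  · obtain ⟨l, rfl⟩ := Int.eq_ofNat_of_zero_le hn.le
    obtain ⟨w, rfl⟩ := hq
    refine ⟨z * (w⁻¹ : Rˣ), hinj ?_⟩
    have h1 : algebraMap R K x = ((e ^ l : Kˣ) : K) *
        (algebraMap R K x * (((e ^ (-(l : ℤ)) : Kˣ) : K) * algebraMap R K w)) *
        algebraMap R K (w⁻¹ : Rˣ) := by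
      have h2 : ((e ^ l : Kˣ) : K) * ((e ^ (-(l : ℤ)) : Kˣ) : K) = 1 := by
        rw [← Units.val_mul, zpow_neg, zpow_natCast, mul_inv_cancel, Units.val_one]
      have h3 : algebraMap R K w * algebraMap R K (w⁻¹ : Rˣ) = 1 := by
        rw [← map_mul, Units.mul_inv, map_one]
      linear_combination (-algebraMap R K x * algebraMap R K w * algebraMap R K (w⁻¹ : Rˣ)) * h2 -
        algebraMap R K x * h3
    rw [h1, h, Int.toNat_natCast, map_mul, map_mul, map_pow, ← he, Units.val_pow_eq_pow_val]
    ring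

theorem HasOrder.pow_toNat_dvd (hinj : Function.Injective (algebraMap R K))
    (he : (e : K) = algebraMap R K ε) {x : R} {n : ℤ} (hx : HasOrder R e (algebraMap R K x) n) :
    ε ^ n.toNat ∣ x := by
  obtain ⟨w, hw⟩ := hx
  refine HodgePink.pow_toNat_dvd hinj he (hasOrder_zpow (-n)) (z := (w : R)) ?_
  rw [hw, mul_right_comm, ← Units.val_mul, ← zpow_add, add_neg_cancel, zpow_zero, Units.val_one,
    one_mul]

end Order

/-! ### Auxiliary computations with matrices -/

section Generic

/-- The maximal minors of `u f(G) κ(P') P`, when this matrix is the image of a matrix `Z`. -/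
theorem det_minor_eq {A F R K : Type*} [CommRing A] [CommRing F] [CommRing R] [CommRing K]
    {f : A →+* K} {κ : F →+* K} {g : R →+* K} {r d : ℕ} {G : Matrix (Fin r) (Fin d) A}
    {P' : Matrix (Fin d) (Fin d) F} {P : Matrix (Fin d) (Fin d) K} {Z : Matrix (Fin r) (Fin d) R}
    {u : K} (h : (u • G.map f) * P'.map κ * P = Z.map g) (I : Fin d → Fin r) :
    f (G.submatrix I id).det * (u ^ d * κ P'.det * P.det) = g (Z.submatrix I id).det := by
  have h3 : (u • (G.submatrix I id).map f) * P'.map κ * P = (Z.submatrix I id).map g :=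
    congrArg (fun M => Matrix.submatrix M I id) h
  have h4 := congrArg Matrix.det h3
  rw [Matrix.det_mul, Matrix.det_mul, Matrix.det_smul, Fintype.card_fin] at h4
  have h5 : ((G.submatrix I id).map f).det = f (G.submatrix I id).det := (RingHom.map_det _ _).symm
  have h6 : (P'.map κ).det = κ P'.det := (RingHom.map_det _ _).symm
  have h7 : ((Z.submatrix I id).map g).det = g (Z.submatrix I id).det := (RingHom.map_det _ _).symm
  rw [h5, h6, h7] at h4
  rw [← h4]
  ring

/-- The divisibility of the maximal minors of `Y B` that the integrality of `u Y B P' P` gives. -/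
theorem pow_toNat_dvd_minor {A F R K : Type*} [CommRing A] [CommRing F] [CommRing R] [CommRing K]
    [Algebra R K] {e : Kˣ} {ε : R} (hinj : Function.Injective (algebraMap R K))
    (he : (e : K) = algebraMap R K ε) {f : A →+* R} {κ : F →+* K} {j : F →+* A}
    (hκ : ∀ c, κ c = algebraMap R K (f (j c))) {r d : ℕ} {Y : Matrix (Fin r) (Fin r) A}
    {B : Matrix (Fin r) (Fin d) F} {P' : Matrix (Fin d) (Fin d) F} {P : Matrix (Fin d) (Fin d) K}
    {Z : Matrix (Fin r) (Fin d) R} {u : K} {s t : ℤ} (hu : HasOrder R e u s)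
    (hP' : HasOrder R e (κ P'.det) 0) (hP : HasOrder R e P.det (-t))
    (hZ : (u • (Y.map f).map (algebraMap R K)) * (B * P').map κ * P = Z.map (algebraMap R K))
    (I : Fin d → Fin r) :
    ε ^ (t - d * s).toNat ∣ f ((Y * B.map j).submatrix I id).det := by
  have hB : B.map κ = ((B.map j).map f).map (algebraMap R K) := Matrix.ext fun _ _ => hκ _
  rw [Matrix.map_mul, ← Matrix.mul_assoc, Matrix.smul_mul, hB, ← Matrix.map_mul,
    ← Matrix.map_mul] at hZ
  refine pow_toNat_dvd hinj he ?_ (det_minor_eq (f := (algebraMap R K).comp f) hZ I)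
  have h8 := ((hu.pow d).mul hP').mul hP
  have h9 : (d : ℤ) * s + 0 + -t = -(t - d * s) := by ring
  rwa [h9] at h8

theorem apply_semilinear_sum {A B V P W : Type*} [CommRing A] [CommRing B] {κ : A →+* B}
    [AddCommGroup V] [Module A V] [AddCommGroup P] [Module B P] [AddCommGroup W] [Module B W]
    (g : P →ₗ[B] W) (F : V →ₛₗ[κ] P) {r : ℕ}
    {v : Fin r → V} {n : Fin r → W} {M : Matrix (Fin r) (Fin r) B}
    (h : ∀ i, g (F (v i)) = ∑ l, M l i • n l) (a : Fin r → A) :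
    g (F (∑ i, a i • v i)) = ∑ l, (∑ i, M l i * κ (a i)) • n l := by
  rw [map_sum, map_sum]
  simp only [LinearMap.map_smulₛₗ, map_smul, h, Finset.smul_sum, smul_smul, Finset.sum_smul]
  rw [Finset.sum_comm]
  exact Finset.sum_congr rfl fun l _ => Finset.sum_congr rfl fun i _ => by rw [mul_comm]

theorem span_range_mk {A R K M : Type*} [CommRing A] [CommRing R] [CommRing K] [Algebra R K]
    [AddCommGroup M] [Module A M] {σ : A →+* K} {τ : A →+* R}
    (h : ∀ a, σ a = algebraMap R K (τ a)) {ι : Type*} [Fintype ι] (b : Module.Basis ι A M) :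
    Submodule.span R (Set.range (Ext.mk σ : M → _)) =
      Submodule.span R (Set.range (Ext.basis σ b)) := by
  refine le_antisymm (Submodule.span_le.2 ?_) (Submodule.span_mono ?_)
  · rintro _ ⟨n, rfl⟩
    rw [← b.sum_repr n, map_sum]
    refine sum_mem fun i _ => ?_
    rw [LinearMap.map_smulₛₗ, ← Ext.basis_apply, h, algebraMap_smul]
    exact Submodule.smul_mem _ _ (Submodule.subset_span ⟨i, rfl⟩)
  · rintro _ ⟨i, rfl⟩
    exact ⟨b i, (Ext.basis_apply _ _ _).symm⟩

end Generic

/-! ### Orders of determinants -/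

section Orders

variable {p : ℕ} [Fact p.Prime] {k : Type*} [Field k] [CharP k p] [PerfectRing k p]
  {E : (W p k)[X]} {r : ℕ}

theorem hasOrder_K₀ToShatE {c : K₀ p k} (hc : c ≠ 0) :
    HasOrder (Shat p k E) (EShatE p k E) (K₀ToShatE p k E c) 0 :=
  hasOrder_algebraMap (R := Shat p k E)
    (x := algebraMap (Sp p k) (Shat p k E) (algebraMap (K₀ p k) (Sp p k) c))
    (((isUnit_iff_ne_zero.2 hc).map (algebraMap (K₀ p k) (Sp p k))).map
      (algebraMap (Sp p k) (Shat p k E)))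

theorem exists_hasOrder (hE : IsEis E) {x : ShatE p k E} (hx : x ≠ 0) :
    ∃ n, HasOrder (Shat p k E) (EShatE p k E) x n :=
  exists_eq_EShatE_zpow_mul hE hx

theorem hasOrder_lam (hE : IsEis E) : HasOrder (Shat p k E) (EShatE p k E)
    (algebraMap (Shat p k E) (ShatE p k E) (𝒪ToShat hE (lam𝒪 p k E hE))) 1 := by
  obtain ⟨w, hw⟩ := exists_𝒪ToShat_lam hE
  refine ⟨w, ?_⟩
  rw [hw, map_mul, zpow_one, coe_EShatE]

/-- The image over `\widehat 𝔖[1/E]` of the matrix `λ ^ s Y`: the image of `λ ^ s` is an element `u`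
of order `s`. -/
theorem exists_smul_of_map_eq_zpow_lam_smul (hE : IsEis E) {ι : 𝒪lam p k E →+* ShatE p k E}
    (hι : IsCanonical p k E ι) {X : Matrix (Fin r) (Fin r) (𝒪lam p k E)}
    {Y : Matrix (Fin r) (Fin r) (𝒪 p k)} {s : ℤ}
    (hX : X.map (𝒪lamTo𝒜 p k E) = zpow𝒜 p k (lam p k E) s • Y.map (𝒪 p k).val) :
    ∃ u : ShatE p k E, HasOrder (Shat p k E) (EShatE p k E) u s ∧
      X.map ι = u • (Y.map (𝒪ToShat hE)).map (algebraMap (Shat p k E) (ShatE p k E)) := by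
  obtain ⟨v, hv⟩ := isUnit_lam hE
  have hv' : HasOrder (Shat p k E) (EShatE p k E)
      ((Units.map ι.toMonoidHom v : (ShatE p k E)ˣ) : ShatE p k E) 1 := by
    have h1 : ((Units.map ι.toMonoidHom v : (ShatE p k E)ˣ) : ShatE p k E) =
        ι (𝒪To𝒪lam p k E (lam𝒪 p k E hE)) := congrArg ι hv
    rw [h1, hι.apply_𝒪 hE]
    exact hasOrder_lam hE
  have hX' : X = ((v ^ s : (𝒪lam p k E)ˣ) : 𝒪lam p k E) • Y.map (𝒪To𝒪lam p k E) := by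
    ext1 i j
    refine Subtype.ext ?_
    have h1 := congrFun (congrFun hX i) j
    have h2 : lam p k E = ((Units.map (𝒪lamTo𝒜 p k E).toMonoidHom v : (𝒜 p k)ˣ) : 𝒜 p k) :=
      (congrArg (𝒪lamTo𝒜 p k E) hv).symm
    rw [h2, zpow𝒜_eq, ← map_zpow] at h1
    exact h1
  refine ⟨((Units.map ι.toMonoidHom v ^ s : (ShatE p k E)ˣ) : ShatE p k E), ?_, ?_⟩
  · have := hv'.zpow s
    rwa [one_mul] at this
  · rw [← map_zpow]
    ext1 i j
    rw [hX']
    refine (map_mul ι _ _).trans ?_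
    refine congrArg (_ * ·) ?_
    exact hι.apply_𝒪 hE (Y i j)

theorem EShat_pow_toNat_dvd_iff (hE : IsEis E) {n : ℤ} {x : 𝒪 p k} :
    EShat p k E ^ n.toNat ∣ 𝒪ToShat hE x ↔ ∃ y ∈ 𝒪 p k, (x : 𝒜 p k) = E𝒜 p k E ^ n.toNat * y := by
  rw [EShat_pow_dvd_𝒪ToShat_iff, E𝒪_pow_dvd_iff]

/-- The order of `det Y` at the point `E = 0` is the valuation of `det T(0)`: it is at most that,
and the same holds for the dual determinant `λ ^ (r m) / det Y`. -/
theorem PIM₀.hasOrder_det (hE : IsEis E) {T : Matrix (Fin r) (Fin r) (𝒜 p k)}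
    {Y : Matrix (Fin r) (Fin r) (𝒪 p k)} {C m : ℕ} (h : PIM₀ E T C m)
    (hY1 : (Y.map (𝒪 p k).val).map (cst p k) = 1)
    (hY : Y.map (𝒪 p k).val * T.map (cst p k) = T * (Y.map (𝒪 p k).val).map (φ𝒜 p k)) {ν : ℤ}
    (hν : absK₀ p k (ev₀ p k T.det) = (p : ℝ) ^ (-ν)) :
    HasOrder (Shat p k E) (EShatE p k E)
      (algebraMap (Shat p k E) (ShatE p k E) (𝒪ToShat hE Y.det)) ν := by
  have hdet : (Y.map (𝒪 p k).val).det = (Y.det : 𝒜 p k) :=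
    (RingHom.map_det (𝒪 p k).val.toRingHom Y).symm
  obtain ⟨δ, hδ, hδ1, hδ2⟩ := h.exists_dual hE hY1 hY hν
  have h1 : Y.det * ⟨δ, hδ⟩ = lam𝒪 p k E hE ^ (r * m) := by
    refine Subtype.ext ?_
    rw [hdet] at hδ1
    exact hδ1
  set x := algebraMap (Shat p k E) (ShatE p k E) (𝒪ToShat hE Y.det) with hx
  set y := algebraMap (Shat p k E) (ShatE p k E) (𝒪ToShat hE ⟨δ, hδ⟩) with hy
  have hxy : HasOrder (Shat p k E) (EShatE p k E) (x * y) ((r * m : ℕ) * 1) := by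
    rw [hx, hy, ← map_mul, ← map_mul, h1, map_pow, map_pow]
    exact (hasOrder_lam hE).pow (r * m)
  have hx0 : x ≠ 0 := by
    intro h0
    have : Nontrivial (ShatE p k E) :=
      have := isDomain_Shat hE
      (algebraMap_ShatE_injective hE).nontrivial
    have h2 := hxy.isUnit
    rw [h0, zero_mul] at h2
    exact not_isUnit_zero h2
  obtain ⟨a, ha⟩ := exists_hasOrder hE hx0
  have hb := ha.of_mul hxy
  have ha' := h.le_of_dvd_det hE hY1 hY hν (l := a.toNat) (by
    rw [hdet, ← EShat_pow_toNat_dvd_iff hE]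
    exact ha.pow_toNat_dvd (algebraMap_ShatE_injective hE) coe_EShatE)
  have hb' := hδ2 (((r * m : ℕ) : ℤ) * 1 - a).toNat
    ((EShat_pow_toNat_dvd_iff hE (x := ⟨δ, hδ⟩)).1
      (hb.pow_toNat_dvd (algebraMap_ShatE_injective hE) coe_EShatE))
  have h3 := Int.self_le_toNat a
  have h4 := Int.self_le_toNat (((r * m : ℕ) : ℤ) * 1 - a)
  have : a = ν := by
    push_cast at h4 hb'
    linarith
  rwa [this] at ha

/-- The inequality for a sub-`φ`-module, in terms of matrices: the columns of `B` are a basis, `P'`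
is the matrix of its Frobenius, `P` is the matrix of a basis of its Hodge–Pink structure. -/
theorem PIM₀.le_of_integral (hE : IsEis E) {T : Matrix (Fin r) (Fin r) (𝒜 p k)}
    {Y : Matrix (Fin r) (Fin r) (𝒪 p k)} {C m : ℕ} (h : PIM₀ E T C m)
    (hY1 : (Y.map (𝒪 p k).val).map (cst p k) = 1)
    (hY : Y.map (𝒪 p k).val * T.map (cst p k) = T * (Y.map (𝒪 p k).val).map (φ𝒜 p k)) {d : ℕ}
    {B : Matrix (Fin r) (Fin d) (K₀ p k)} {L : Matrix (Fin d) (Fin r) (K₀ p k)} (hL : L * B = 1)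
    {P' Q : Matrix (Fin d) (Fin d) (K₀ p k)}
    (hB : T.map (cst p k) * (B.map PowerSeries.C).map (φ𝒜 p k) =
      B.map PowerSeries.C * Q.map PowerSeries.C)
    {ν : ℤ} (hν : absK₀ p k Q.det = (p : ℝ) ^ (-ν)) (hP' : P'.det ≠ 0) {u : ShatE p k E} {s t : ℤ}
    (hu : HasOrder (Shat p k E) (EShatE p k E) u s) {P : Matrix (Fin d) (Fin d) (ShatE p k E)}
    (hP : HasOrder (Shat p k E) (EShatE p k E) P.det (-t)) {Z : Matrix (Fin r) (Fin d) (Shat p k E)}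
    (hZ : (u • (Y.map (𝒪ToShat hE)).map (algebraMap (Shat p k E) (ShatE p k E))) *
      (B * P').map (K₀ToShatE p k E) * P = Z.map (algebraMap (Shat p k E) (ShatE p k E))) :
    t - d * s ≤ ν := by
  let G : Matrix (Fin r) (Fin d) (𝒪 p k) := Y * B.map (algebraMap (K₀ p k) (𝒪 p k))
  have hκ : ∀ c, K₀ToShatE p k E c = algebraMap (Shat p k E) (ShatE p k E)
      (𝒪ToShat hE (algebraMap (K₀ p k) (𝒪 p k) c)) := fun c =>
    congrArg (algebraMap (Shat p k E) (ShatE p k E))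
      (𝒪ToShat_SpTo𝒪 hE (algebraMap (K₀ p k) (Sp p k) c)).symm
  have hmin : ∀ I : Fin d → Fin r,
      EShat p k E ^ (t - d * s).toNat ∣ 𝒪ToShat hE (G.submatrix I id).det :=
    pow_toNat_dvd_minor (algebraMap_ShatE_injective hE) coe_EShatE hκ hu
      (hasOrder_K₀ToShatE hP') hP hZ
  have hG : Y.map (𝒪 p k).val * B.map PowerSeries.C = G.map (𝒪 p k).val := by
    rw [Matrix.map_mul]
    rfl
  refine (Int.self_le_toNat _).trans (h.le_of_dvd_minors hE hY1 hY hL hB hν fun I => ?_)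
  have h1 := (EShat_pow_toNat_dvd_iff hE).1 (hmin I)
  rw [hG]
  have h2 : ((G.map (𝒪 p k).val).submatrix I id).det = ((G.submatrix I id).det : 𝒜 p k) :=
    (RingHom.map_det (𝒪 p k).val.toRingHom _).symm
  rw [h2]
  exact h1

end Orders

/-! ### The map `(ξ ⊗ 1) ∘ (φ_D ⊗ 1)` in terms of bases -/

section Module

variable {p : ℕ} [Fact p.Prime] {k : Type*} [Field k] [CharP k p] [PerfectRing k p]
  {E : (W p k)[X]} {N : Type*} [AddCommGroup N] [Module (Sp p k) N]
  {φN : N →ₛₗ[φSpE p k E] InvE p k E N} {r : ℕ} {b : Module.Basis (Fin r) (Sp p k) N}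
  {T : Matrix (Fin r) (Fin r) (SpE p k E)}

theorem phiDShat_mk (y : Dmod p k N) :
    phiDShat E φN (Ext.mk ((K₀ToShatE p k E).comp (φK₀ p k)) y) =
      Ext.mk (K₀ToShatE p k E) (phiD E φN y) :=
  Ext.linearization_mk _ _

theorem xiShat_mk {ι : 𝒪lam p k E →+* ShatE p k E} (hι : IsCanonical p k E ι)
    (ξ : D𝒪lam p k E N →ₗ[𝒪lam p k E] N𝒪lam p k E N) (y : Dmod p k N) :
    xiShat E ι hι ξ (Ext.mk (K₀ToShatE p k E) y) =
      Ext.push (SpTo𝒪lam p k E) ι (SpToShatE p k E) hι.extends_Sp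
        (ξ (Ext.mk (algebraMap (K₀ p k) (𝒪lam p k E)) y)) :=
  Ext.lift_mk _ _ _ _ _

theorem IsMatrixOf.xiShat_mk {ι : 𝒪lam p k E →+* ShatE p k E} (hι : IsCanonical p k E ι)
    {ξ : D𝒪lam p k E N →ₗ[𝒪lam p k E] N𝒪lam p k E N} {X : Matrix (Fin r) (Fin r) (𝒪lam p k E)}
    (hX : IsMatrixOf b ξ X) (i : Fin r) :
    xiShat E ι hι ξ (Ext.mk (K₀ToShatE p k E) (Ext.basis (SpTo₀ p k) b i)) =
      ∑ l, X.map ι l i • Ext.basis (SpToShatE p k E) b l := by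
  refine (HodgePink.xiShat_mk hι ξ _).trans ?_
  refine (congrArg _ (hX i)).trans ?_
  refine (Ext.push_sum ι (SpToShatE p k E) hι.extends_Sp (fun l => X l i) b).trans ?_
  exact Finset.sum_congr rfl fun l _ => congrArg _ (Ext.basis_apply _ _ _).symm

/-- The map `(ξ ⊗ 1) ∘ (φ_D ⊗ 1)` in terms of bases. -/
theorem IsMatrixOf.xiShat_phiDShat {ι : 𝒪lam p k E →+* ShatE p k E} (hι : IsCanonical p k E ι)
    {ξ : D𝒪lam p k E N →ₗ[𝒪lam p k E] N𝒪lam p k E N} {X : Matrix (Fin r) (Fin r) (𝒪lam p k E)}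
    (hX : IsMatrixOf b ξ X) {y : Dmod p k N} {a : Fin r → K₀ p k}
    (ha : phiD E φN y = ∑ i, a i • Ext.basis (SpTo₀ p k) b i) :
    (xiShat E ι hι ξ).comp (phiDShat E φN) (Ext.mk ((K₀ToShatE p k E).comp (φK₀ p k)) y) =
      ∑ l, (∑ i, X.map ι l i * K₀ToShatE p k E (a i)) • Ext.basis (SpToShatE p k E) b l := by
  refine (congrArg (xiShat E ι hι ξ)
    ((phiDShat_mk y).trans (congrArg (Ext.mk (K₀ToShatE p k E)) ha))).trans ?_
  have key := apply_semilinear_sum (V := Dmod p k N) (xiShat E ι hι ξ) (Ext.mk (K₀ToShatE p k E))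
    (v := Ext.basis (SpTo₀ p k) b) (n := Ext.basis (SpToShatE p k E) b) (M := X.map ι)
    (hX.xiShat_mk hι)
  exact key a

end Module

/-! ### Sub-`φ`-modules -/

section SubObject

variable {F D : Type*} [Field F] [AddCommGroup D] [Module F D] {σ : F →+* F} {r : ℕ}

/-- The matrices attached to a `φ`-stable subspace `D'` with `φ(^φ D') = D'`: the columns of `B` are
a basis of `D'`, and `P'` is the matrix of `φ` in this basis. -/
theorem exists_sub_matrices (dd : Module.Basis (Fin r) F D) (φD : D →ₛₗ[σ] D)
    {T : Matrix (Fin r) (Fin r) F} (hT : ∀ j, φD (dd j) = ∑ i, T i j • dd i) {D' : Submodule F D}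
    (φD' : D' →ₛₗ[σ] D') (hφ : ∀ x, (φD' x : D) = φD x)
    (hD' : Submodule.span F (φD '' D') = D') :
    ∃ (d : ℕ) (v : Module.Basis (Fin d) F D') (B : Matrix (Fin r) (Fin d) F)
      (L : Matrix (Fin d) (Fin r) F) (P' : Matrix (Fin d) (Fin d) F),
      (∀ j, φD' (v j) = ∑ i, P' i j • v i) ∧ (∀ j, φD (v j) = ∑ i, (B * P') i j • dd i) ∧
      L * B = 1 ∧ T * B.map σ = B * P' ∧ P'.det ≠ 0 := by
  have hfin : Module.Finite F D := Module.Finite.of_basis dd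
  let v := Module.finBasis F D'
  let B := LinearMap.toMatrix v dd D'.subtype
  have hB : ∀ j, (v j : D) = ∑ i, B i j • dd i := fun j => by
    simp only [B, LinearMap.toMatrix_apply]
    exact (dd.sum_repr _).symm
  let P' : Matrix _ _ F := fun i j => v.repr (φD' (v j)) i
  have hP' : ∀ j, φD' (v j) = ∑ i, P' i j • v i := fun j => (v.sum_repr _).symm
  obtain ⟨g, hg⟩ := LinearMap.exists_leftInverse_of_injective D'.subtype
    (Submodule.ker_subtype D')
  have hBP : ∀ j, φD (v j) = ∑ i, (B * P') i j • dd i := fun j => by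
    rw [← hφ, hP', ← Matrix.toLin_self v v, ← Matrix.toLin_self v dd, Matrix.toLin_mul v v dd,
      LinearMap.comp_apply, Matrix.toLin_toMatrix]
    rfl
  have hTB : ∀ j, φD (v j) = ∑ i, (T * B.map σ) i j • dd i := fun j => by
    rw [hB]
    exact apply_semilinear_sum LinearMap.id φD hT _
  refine ⟨_, v, B, LinearMap.toMatrix dd v g, P', hP', hBP, ?_, ?_, ?_⟩
  · rw [← LinearMap.toMatrix_comp, hg, LinearMap.toMatrix_id]
  · ext1 i j
    exact congrFun ((basis_sum_inj dd).1 ((hTB j).symm.trans (hBP j))) i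
  · refine (isUnit_det_of_top_le_span v fun x _ => ?_).ne_zero
    have h1 : Submodule.span F (φD '' D') ≤
        (Submodule.span F (Set.range fun j => ∑ i, P' i j • v i)).map D'.subtype := by
      rw [Submodule.span_le]
      rintro _ ⟨y, hy, rfl⟩
      refine ⟨φD' ⟨y, hy⟩, ?_, hφ _⟩
      rw [← v.sum_repr ⟨y, hy⟩, map_sum]
      refine sum_mem fun j _ => ?_
      rw [LinearMap.map_smulₛₗ, hP']
      exact Submodule.smul_mem _ _ (Submodule.subset_span ⟨j, rfl⟩)
    rw [hD'] at h1
    obtain ⟨y, hy, hyx⟩ := h1 x.2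
    rwa [← Subtype.ext hyx]

end SubObject

/-! ### Weak admissibility -/

section WeaklyAdmissible

variable {p : ℕ} [Fact p.Prime] {k : Type*} [Field k] [CharP k p] [PerfectRing k p]
  {E : (W p k)[X]} {N : Type*} [AddCommGroup N] [Module (Sp p k) N]
  {φN : N →ₛₗ[φSpE p k E] InvE p k E N} {r : ℕ} {b : Module.Basis (Fin r) (Sp p k) N}
  {T : Matrix (Fin r) (Fin r) (SpE p k E)} {ι : 𝒪lam p k E →+* ShatE p k E}
  {ξ : D𝒪lam p k E N →ₗ[𝒪lam p k E] N𝒪lam p k E N} {X : Matrix (Fin r) (Fin r) (𝒪lam p k E)}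

theorem isPhiModule_phiD (hT : ∀ j, φN (b j) = ∑ i, T i j • Ext.mk (SpToSpE p k E) (b i))
    (hdet : (T₀ T).det ≠ 0) : IsPhiModule (phiD E φN) := by
  have hf : ∀ j, Ext.linearization (φK₀ p k) (phiD E φN)
      (Ext.basis (φK₀ p k) (Ext.basis (SpTo₀ p k) b) j) =
      ∑ i, T₀ T i j • Ext.basis (SpTo₀ p k) b i := fun j => by
    rw [Ext.basis_apply (φK₀ p k), Ext.linearization_mk]
    exact phiD_apply hT j
  have hu : IsUnit (T₀ T).det := isUnit_iff_ne_zero.2 hdet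
  exact ⟨Module.Finite.of_basis (Ext.basis (SpTo₀ p k) b),
    injective_of_matrix hf (Matrix.nonsing_inv_mul _ hu),
    surjective_of_matrix hf (Matrix.mul_nonsing_inv _ hu)⟩

theorem VD_eq (hι : IsCanonical p k E ι) : VD E φN ι hι ξ =
    (Submodule.span (Shat p k E) (Set.range (Ext.basis (SpToShatE p k E) b))).comap
      (((xiShat E ι hι ξ).comp (phiDShat E φN)).restrictScalars (Shat p k E)) :=
  congrArg (Submodule.comap
      (((xiShat E ι hι ξ).comp (phiDShat E φN)).restrictScalars (Shat p k E)))
    (span_range_mk (σ := SpToShatE p k E) (τ := algebraMap (Sp p k) (Shat p k E))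
      (fun _ => rfl) b)

set_option maxHeartbeats 1000000 in
/-- If the determinant of the comparison map has order `n`, then `V_D` is a lattice with
`t_H = n`, as `det φ_D` is a nonzero constant, hence a unit of `\widehat 𝔖`. -/
theorem isHodgeNumber_VD (hT : ∀ j, φN (b j) = ∑ i, T i j • Ext.mk (SpToSpE p k E) (b i))
    (hdet : (T₀ T).det ≠ 0) (hι : IsCanonical p k E ι) (hX : IsMatrixOf b ξ X) {n : ℤ}
    (hn : HasOrder (Shat p k E) (EShatE p k E) (X.map ι).det n) :
    IsHodgePinkStructure p k (Dmod p k N) E (VD E φN ι hι ξ) ∧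
      IsHodgeNumber p k (Dmod p k N) E (VD E φN ι hι ξ) n := by
  have hf : ∀ j, (xiShat E ι hι ξ).comp (phiDShat E φN)
      (Ext.basis ((K₀ToShatE p k E).comp (φK₀ p k)) (Ext.basis (SpTo₀ p k) b) j) =
      ∑ i, (X.map ι * (T₀ T).map (K₀ToShatE p k E)) i j • Ext.basis (SpToShatE p k E) b i :=
    fun j => by
      refine (congrArg ((xiShat E ι hι ξ).comp (phiDShat E φN)) (Ext.basis_apply _ _ j)).trans ?_
      refine (hX.xiShat_phiDShat hι (phiD_apply hT j)).trans ?_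
      simp only [Matrix.mul_apply, Matrix.map_apply]
  have hord : HasOrder (Shat p k E) (EShatE p k E)
      (X.map ι * (T₀ T).map (K₀ToShatE p k E)).det n := by
    have h1 : ((T₀ T).map (K₀ToShatE p k E)).det = K₀ToShatE p k E (T₀ T).det :=
      (RingHom.map_det _ _).symm
    have h2 := hn.mul (hasOrder_K₀ToShatE hdet)
    rwa [← h1, ← Matrix.det_mul, add_zero] at h2
  have hP := Matrix.mul_nonsing_inv _ hord.isUnit
  obtain ⟨c, hc, hcP⟩ := exists_basis_comap_of_mul_eq_one (R := Shat p k E) hf hP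
  obtain ⟨w, hw⟩ := hord.of_mul_eq_one (by rw [← Matrix.det_mul, hP, Matrix.det_one])
  have hV := (VD_eq (φN := φN) (ξ := ξ) (b := b) hι).trans hc
  refine ⟨⟨r, c, hV⟩, r, Ext.basis (SpTo₀ p k) b, c, _, w, hV, fun j => ?_, hw⟩
  rw [hcP j]
  exact Finset.sum_congr rfl fun i _ => congrArg _ (Ext.basis_apply _ _ _)

end WeaklyAdmissible

section WeaklyAdmissible

variable {p : ℕ} [Fact p.Prime] {k : Type*} [Field k] [CharP k p] [PerfectRing k p]
  {E : (W p k)[X]} {N : Type*} [AddCommGroup N] [Module (Sp p k) N]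
  {φN : N →ₛₗ[φSpE p k E] InvE p k E N} {r : ℕ} {b : Module.Basis (Fin r) (Sp p k) N}
  {T : Matrix (Fin r) (Fin r) (SpE p k E)} {ι : 𝒪lam p k E →+* ShatE p k E}
  {ξ : D𝒪lam p k E N →ₗ[𝒪lam p k E] N𝒪lam p k E N} {X : Matrix (Fin r) (Fin r) (𝒪lam p k E)}

set_option maxHeartbeats 1000000 in
/-- The Hodge–Pink structure induced by `V_D` on a subspace, by means of bases: `Q` is the matrix
of `φ_D` on a basis `v` of the subspace. -/
theorem exists_basis_inducedHodgePink (hE : IsEis E) (hι : IsCanonical p k E ι)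
    (hX : IsMatrixOf b ξ X) {n : ℤ} (hn : HasOrder (Shat p k E) (EShatE p k E) (X.map ι).det n)
    {D' : Submodule (K₀ p k) (Dmod p k N)} {d : ℕ} (v : Module.Basis (Fin d) (K₀ p k) D')
    {Q : Matrix (Fin r) (Fin d) (K₀ p k)} {L : Matrix (Fin d) (Fin r) (K₀ p k)} (hL : L * Q = 1)
    (hQ : ∀ j, phiD E φN (v j) = ∑ i, Q i j • Ext.basis (SpTo₀ p k) b i) :
    ∃ (h : ℤ) (P : Matrix (Fin d) (Fin d) (ShatE p k E)) (Z : Matrix (Fin r) (Fin d) (Shat p k E)),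
      IsHodgeNumber p k D' E (inducedHodgePink E (VD E φN ι hι ξ) D') h ∧
      HasOrder (Shat p k E) (EShatE p k E) P.det (-h) ∧
      X.map ι * Q.map (K₀ToShatE p k E) * P =
        Z.map (algebraMap (Shat p k E) (ShatE p k E)) := by
  have := isDomain_Shat hE
  have := isPrincipalIdealRing_Shat hE
  have := isFractionRing_ShatE hE
  let f : PhiD p k D' E →ₗ[ShatE p k E] Ext (SpToShatE p k E) N :=
    ((xiShat E ι hι ξ).comp (phiDShat E φN)).comp
      (Ext.map ((K₀ToShatE p k E).comp (φK₀ p k)) D'.subtype)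
  have hf : ∀ j, f (Ext.basis ((K₀ToShatE p k E).comp (φK₀ p k)) v j) =
      ∑ i, (X.map ι * Q.map (K₀ToShatE p k E)) i j • Ext.basis (SpToShatE p k E) b i :=
    fun j => by
      refine (congrArg ((xiShat E ι hι ξ).comp (phiDShat E φN))
        ((congrArg _ (Ext.basis_apply _ _ j)).trans (Ext.map_mk _ _))).trans ?_
      refine (hX.xiShat_phiDShat hι (hQ j)).trans ?_
      simp only [Matrix.mul_apply, Matrix.map_apply]
  have hLM : (L.map (K₀ToShatE p k E) * (X.map ι)⁻¹) *
      (X.map ι * Q.map (K₀ToShatE p k E)) = 1 := by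
    rw [Matrix.mul_assoc, Matrix.nonsing_inv_mul_cancel_left _ _ hn.isUnit, ← Matrix.map_mul, hL]
    exact Matrix.map_one _ (map_zero _) (map_one _)
  obtain ⟨c, P, Z, hc, hcP, hP, hZ⟩ :=
    exists_basis_comap_of_left_inverse (R := Shat p k E) hf hLM
  have : Nontrivial (ShatE p k E) := (algebraMap_ShatE_injective hE).nontrivial
  obtain ⟨a, ha⟩ := exists_hasOrder hE hP.ne_zero
  have hV : inducedHodgePink E (VD E φN ι hι ξ) D' =
      Submodule.span (Shat p k E) (Set.range c) :=
    (congrArg (fun V => inducedHodgePink E V D') (VD_eq (b := b) hι)).trans hc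
  rw [← neg_neg a] at ha
  refine ⟨-a, P, Z, ?_, ha, hZ⟩
  obtain ⟨w, hw⟩ := ha
  refine ⟨d, v, c, P, w, hV, fun j => ?_, hw⟩
  rw [hcP j]
  exact Finset.sum_congr rfl fun i _ => congrArg _ (Ext.basis_apply _ _ _)

end WeaklyAdmissible

section WeaklyAdmissible

variable {p : ℕ} [Fact p.Prime] {k : Type*} [Field k] [CharP k p] [PerfectRing k p]
  {E : (W p k)[X]} {N : Type*} [AddCommGroup N] [Module (Sp p k) N]
  {φN : N →ₛₗ[φSpE p k E] InvE p k E N} {r : ℕ} {b : Module.Basis (Fin r) (Sp p k) N}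
  {T : Matrix (Fin r) (Fin r) (SpE p k E)} {ι : 𝒪lam p k E →+* ShatE p k E}
  {ξ : D𝒪lam p k E N →ₗ[𝒪lam p k E] N𝒪lam p k E N} {X : Matrix (Fin r) (Fin r) (𝒪lam p k E)}

theorem ev₀_det_T𝒜 : ev₀ p k (T𝒜 T).det = (T₀ T).det := RingHom.map_det _ _

theorem exists_matrix_𝒪 {Y : Matrix (Fin r) (Fin r) (𝒜 p k)} (hY : ∀ i j, Y i j ∈ 𝒪 p k) :
    ∃ Y' : Matrix (Fin r) (Fin r) (𝒪 p k), Y'.map (𝒪 p k).val = Y :=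
  ⟨fun i j => ⟨Y i j, hY i j⟩, rfl⟩

set_option maxHeartbeats 1000000 in
/-- Weak admissibility, for an amplitude `[s, t]`, in terms of a basis of `N`. By the twist the
image of the comparison matrix is `u Y` with `u` of order `s`; this adds `r s` to the order of its
determinant and to the valuation of `det φ_D`, and `d s` to those of a subobject of dimension `d`.
-/
theorem isWeaklyAdmissible_VD (hE : IsEis E)
    (hT : ∀ j, φN (b j) = ∑ i, T i j • Ext.mk (SpToSpE p k E) (b i)) {C m : ℕ} {s : ℤ}
    (h : PIM₀ E (zpow𝒜 p k (E𝒜 p k E) (-s) • T𝒜 T) C m) (hι : IsCanonical p k E ι)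
    (hξ : IsComparison E φN ξ) :
    IsHodgePinkModule E (phiD E φN) (VD E φN ι hι ξ) ∧
      IsWeaklyAdmissible E (phiD E φN) (VD E φN ι hι ξ) := by
  obtain ⟨-, Y, hY1, hY, hXY⟩ := existsUnique_comparison hE hT h
  obtain ⟨Y, rfl⟩ := exists_matrix_𝒪 (h.mem_𝒪 hE hY1 hY)
  obtain ⟨X, hX⟩ := exists_isMatrixOf (b := b) ξ
  obtain ⟨u, hu, hXu⟩ := exists_smul_of_map_eq_zpow_lam_smul hE hι (hXY ξ X hξ hX)
  have hdet : (T₀ T).det ≠ 0 := fun h0 => by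
    have := h.ev₀_det_ne_zero hE
    rw [Matrix.det_smul, map_mul, ev₀_det_T𝒜, h0, mul_zero] at this
    exact this rfl
  obtain ⟨n, w, hn⟩ := exists_zpow_mul_unit p k hdet
  -- the comparison map has determinant of order `n = t_N(D)`
  have hord : HasOrder (Shat p k E) (EShatE p k E) (X.map ι).det n := by
    have h1 := h.hasOrder_det hE hY1 hY (absK₀_ev₀_det_twist hE s (n := n)
      (by rw [ev₀_det_T𝒜, hn, absK₀_zpow_mul_unit]))
    have h2 : (X.map ι).det =
        u ^ r * algebraMap (Shat p k E) (ShatE p k E) (𝒪ToShat hE Y.det) := by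
      rw [hXu, Matrix.det_smul, Fintype.card_fin, RingHom.map_det, RingHom.map_det]
      rfl
    rw [h2]
    have h3 := (hu.pow r).mul h1
    rwa [add_sub_cancel] at h3
  obtain ⟨hHP, hH⟩ := isHodgeNumber_VD (φN := φN) hT hdet hι hX hord
  refine ⟨⟨isPhiModule_phiD hT hdet, hHP⟩, ⟨n, hH, r, Ext.basis (SpTo₀ p k) b, T₀ T, w,
    phiD_apply hT, hn⟩, fun D' hD' => ?_⟩
  have hstab : ∀ x ∈ D', phiD E φN x ∈ D' := fun _ hx =>
    hD' ▸ Submodule.subset_span (Set.mem_image_of_mem (phiD E φN) hx)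
  obtain ⟨d, v, B, L, P', hP', hBP, hL, hTB, hdet'⟩ := exists_sub_matrices
    (Ext.basis (SpTo₀ p k) b) (phiD E φN) (phiD_apply hT) (restrictPhi (phiD E φN) D' hstab)
    (fun _ => rfl) hD'
  have hL' : (P'⁻¹ * L) * (B * P') = 1 := by
    rw [Matrix.mul_assoc, ← Matrix.mul_assoc L, hL, Matrix.one_mul,
      Matrix.nonsing_inv_mul _ (isUnit_iff_ne_zero.2 hdet')]
  obtain ⟨t', P, Z, ht', hP, hZ⟩ := exists_basis_inducedHodgePink hE hι hX hord v hL' hBP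
  obtain ⟨n', w', hn'⟩ := exists_zpow_mul_unit p k hdet'
  refine ⟨t', n', ht', ⟨d, v, P', w', hP', hn'⟩, ?_⟩
  have hν : absK₀ p k (ev₀ p k (zpow𝒜 p k (E𝒜 p k E) (-s)) • P').det =
      (p : ℝ) ^ (-(n' - d * s)) := by
    rw [Matrix.det_smul, Fintype.card_fin, absK₀_mul, absK₀_pow, absK₀_ev₀_zpow_E hE, hn',
      absK₀_zpow_mul_unit, ← zpow_natCast, ← zpow_mul, ← zpow_add₀ (p_real_pos p).ne']
    congr 1
    ring
  rw [hXu] at hZ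
  have := h.le_of_integral hE hY1 hY hL (twist_cst_mul T𝒜_map_cst hTB _) hν hdet' hu hP hZ
  omega

end WeaklyAdmissible

end

end HodgePink

theorem proposition3p11 (p : ℕ) [Fact p.Prime] (k : Type*) [Field k] [CharP k p] [PerfectRing k p]
    (E : Polynomial (WittVector p k)) (hE_monic : E.Monic) (hE_deg : 0 < E.natDegree)
    (hE : E.IsEisensteinAt (Ideal.span {(p : WittVector p k)}))
    (N : Type*) [AddCommGroup N] [Module (HodgePink.Sp p k) N]
    (φN : N →ₛₗ[HodgePink.φSpE p k E] HodgePink.InvE p k E N)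
    (s t : ℤ) (hst : s ≤ t) (hN : HodgePink.IsPseudoIso E φN s t) :
    (∃! ι, HodgePink.IsCanonical p k E ι) ∧
    (∃! ξ, HodgePink.IsComparison E φN ξ) ∧
    ∀ ι (hι : HodgePink.IsCanonical p k E ι) ξ, HodgePink.IsComparison E φN ξ →
      HodgePink.IsHodgePinkModule E (HodgePink.phiD E φN) (HodgePink.VD E φN ι hι ξ) ∧
      HodgePink.IsWeaklyAdmissible E (HodgePink.phiD E φN) (HodgePink.VD E φN ι hι ξ) := by
  have hE' : HodgePink.IsEis E := ⟨hE_monic, hE_deg, hE⟩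
  obtain ⟨r, b, T, hT, C, hC⟩ := hN.pim
  have h := HodgePink.PIM₀_twist (T := HodgePink.T𝒜 T) hE' hst hC
  exact ⟨HodgePink.existsUnique_canonical hE', (HodgePink.existsUnique_comparison hE' hT h).1,
    fun ι hι ξ hξ => HodgePink.isWeaklyAdmissible_VD hE' hT h hι hξ⟩
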